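/- Let $n\ge 1$ and let $(X,\sigma)$ be a complex symplectic manifold of complex dimension $2n$, i.e. $X$ is a connected compact complex manifold with $\dim_{\mathbb C}X=2n$ and $\sigma$ is a smooth $d$-closed $(2,0)$-form on $X$ which is non-degenerate at every point. Assume that $X$ satisfies the $\partial\bar\partial$-lemma, i.e. $\ker\partial\cap\ker\bar\partial\cap\operatorname{im}d=\operatorname{im}\partial\bar\partial$ in the space of smooth complex-valued differential forms on $X$. For $p,q\ge 0$ let $\mathcal A^{p,q}(X)$ be the space of smooth $(p,q)$-forms and let $$H^{p,q}_{\bar\partial}(X)=\frac{\ker(\bar\partial:\mathcal A^{p,q}(X)\to\mathcal A^{p,q+1}(X))}{\operatorname{im}(\bar\partial:\mathcal A^{p,q-1}(X)\to\mathcal A^{p,q}(X))}$$ be the Dolbeault cohomology of $X$ (with $\mathcal A^{p,-1}(X)=0$). Then the map $$L^{n-1}_{\sigma\bar\sigma}:H^{1,1}_{\bar\partial}(X)\longrightarrow H^{2n-1,2n-1}_{\bar\partial}(X),\qquad [\alpha]_{\bar\partial}\longmapsto[(\sigma\wedge\bar\sigma)^{n-1}\wedge\alpha]_{\bar\partial}$$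 is well defined and is an isomorphism of complex vector spaces. -/

import Mathlib

open scoped Manifold ContDiff ComplexConjugate

noncomputable section

namespace CplxSympl

/-! ### Linear algebra of complex-valued alternating forms -/

section LinearAlgebra

/-- Real-multilinear alternating maps in `k` arguments from `V` to a normed space `F`. (The
norm on `F` is an argument so that all the structure on `F` is derived from it.) -/
abbrev AltMaps (V F : Type*) [AddCommGroup V] [Module ℝ V] [TopologicalSpace V]
    [NormedAddCommGroup F] [NormedSpace ℝ F] (k : ℕ) :=
  V [⋀^Fin k]→L[ℝ] F

/-- Complex-valued real-multilinear alternating maps in `k` arguments. -/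
abbrev CAlt (V : Type*) [AddCommGroup V] [Module ℝ V] [TopologicalSpace V] (k : ℕ) :=
  AltMaps V ℂ k

variable {V : Type*} [AddCommGroup V] [Module ℝ V] [TopologicalSpace V]

/-- The wedge product of two complex-valued alternating forms, as an alternating form in `k = i + j`
arguments:
`(a ∧ b) (v₁, …, v_k) = ∑ sign(s) a (v_{s 1}, …, v_{s i}) b (v_{s (i+1)}, …, v_{s k})`, the sum
being over the `(i, j)`-shuffles `s`. -/
def wedgeAlt {i j k : ℕ} (h : i + j = k) (a : CAlt V i) (b : CAlt V j) :
    CAlt V k :=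
  { ((LinearMap.mul' ℝ ℂ).compAlternatingMap
      (a.toAlternatingMap.domCoprod b.toAlternatingMap)).domDomCongr
        (finSumFinEquiv.trans (finCongr h)) with
    cont := by
      change Continuous fun v : Fin k → V => LinearMap.mul' ℝ ℂ
        (a.toAlternatingMap.domCoprod b.toAlternatingMap
          (fun t => v ((finSumFinEquiv.trans (finCongr h)) t)))
      simp only [AlternatingMap.domCoprod_apply, sum_apply, map_sum]
      refine continuous_finsetSum _ fun s _ => ?_
      induction s using Quotient.inductionOn' with
      | _ s =>
        have key : ∀ w : Fin i ⊕ Fin j → V,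
            LinearMap.mul' ℝ ℂ (AlternatingMap.domCoprod.summand a.toAlternatingMap
              b.toAlternatingMap (Quotient.mk'' s) w) =
            Equiv.Perm.sign s • (a (fun t => w (s (Sum.inl t))) * b (fun t => w (s (Sum.inr t)))) := by
          intro w
          rcases Int.units_eq_one_or (Equiv.Perm.sign s) with hs | hs
          · rw [AlternatingMap.domCoprod.summand_mk'', hs, one_smul, one_smul]; rfl
          · rw [AlternatingMap.domCoprod.summand_mk'', hs, Units.neg_smul, one_smul,
              Units.neg_smul, one_smul]
            exact map_neg (LinearMap.mul' ℝ ℂ) (TensorProduct.tmul ℝ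
              (a (fun t => w (s (Sum.inl t)))) (b (fun t => w (s (Sum.inr t)))))
        simp only [key, Units.smul_def]
        refine Continuous.const_smul (Continuous.mul ?_ ?_) _
        · exact a.cont.comp (continuous_pi fun t => continuous_apply _)
        · exact b.cont.comp (continuous_pi fun t => continuous_apply _) }

/-- The complex conjugate `v ↦ conj (a v)` of a complex-valued alternating form. -/
def conjAlt {k : ℕ} (a : CAlt V k) : CAlt V k :=
  (Complex.conjCLE : ℂ →L[ℝ] ℂ).compContinuousAlternatingMap a

end LinearAlgebra

section Parts

variable {E F : Type*} [NormedAddCommGroup E] [NormedSpace ℂ E]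
  [NormedAddCommGroup F] [NormedSpace ℂ F]

/-- Multiplication by the imaginary unit, as a real-linear map. -/
def mulI (E : Type*) [NormedAddCommGroup E] [NormedSpace ℂ E] : E →L[ℝ] E :=
  (Complex.I • ContinuousLinearMap.id ℂ E).restrictScalars ℝ

/-- The complex-linear part `v ↦ (A v - i A (i v)) / 2` of a real-linear map `A`. -/
def linPart (A : E →L[ℝ] F) : E →L[ℝ] F :=
  (1 / 2 : ℂ) • (A - Complex.I • A.comp (mulI E))

/-- The complex-antilinear part `v ↦ (A v + i A (i v)) / 2` of a real-linear map `A`. -/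
def antilinPart (A : E →L[ℝ] F) : E →L[ℝ] F :=
  (1 / 2 : ℂ) • (A + Complex.I • A.comp (mulI E))

theorem linPart_add (A B : E →L[ℝ] F) : linPart (A + B) = linPart A + linPart B := by
  simp only [linPart, ContinuousLinearMap.add_comp]
  module

theorem linPart_smul (c : ℂ) (A : E →L[ℝ] F) : linPart (c • A) = c • linPart A := by
  simp only [linPart, ContinuousLinearMap.smul_comp]
  module

theorem antilinPart_add (A B : E →L[ℝ] F) :
    antilinPart (A + B) = antilinPart A + antilinPart B := by
  simp only [antilinPart, ContinuousLinearMap.add_comp]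
  module

theorem antilinPart_smul (c : ℂ) (A : E →L[ℝ] F) :
    antilinPart (c • A) = c • antilinPart A := by
  simp only [antilinPart, ContinuousLinearMap.smul_comp]
  module

theorem linPart_add_antilinPart (A : E →L[ℝ] F) : linPart A + antilinPart A = A := by
  simp only [linPart, antilinPart]
  module

end Parts

/-! ### Differential forms on a complex manifold modelled on `E` -/

/-- Complex-valued `k`-forms on `X` (no regularity imposed): at each point `x` a real-multilinear
alternating map on the tangent space at `x`, with complex values. -/
abbrev DForm (E : Type*) [NormedAddCommGroup E] [NormedSpace ℂ E] (X : Type*) [TopologicalSpace X]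
    [ChartedSpace E X] (k : ℕ) :=
  ∀ x : X, CAlt (TangentSpace 𝓘(ℂ, E) x) k

section Forms

variable {E : Type*} [NormedAddCommGroup E] [NormedSpace ℂ E]
  {X : Type*} [TopologicalSpace X] [ChartedSpace E X] {i j k : ℕ}

/-- The local expression `(φ⁻¹)^* α` of the form `α` in the chart `φ` at `x₀`, a form on the
target of the chart. -/
def inChart (α : DForm E X k) (x₀ : X) (y : E) : CAlt E k :=
  (α ((chartAt E x₀).symm y)).compContinuousLinearMap
    ((mfderiv 𝓘(ℂ, E) 𝓘(ℂ, E) (chartAt E x₀).symm y).restrictScalars ℝ)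

/-- The pull-back to the tangent space at `x` of a form on `E` under the chart `φ` at `x`. -/
def pullChart (x : X) (a : CAlt E k) : CAlt (TangentSpace 𝓘(ℂ, E) x) k :=
  ContinuousAlternatingMap.compContinuousLinearMap a
    ((mfderiv 𝓘(ℂ, E) 𝓘(ℂ, E) (chartAt E x) x).restrictScalars ℝ :
      TangentSpace 𝓘(ℂ, E) x →L[ℝ] E)

/-- A form is smooth if its local expressions are `C^∞` (in the real sense). -/
def IsSmooth (α : DForm E X k) : Prop :=
  ∀ x₀ : X, ContDiffOn ℝ ∞ (inChart α x₀) (chartAt E x₀).target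

/-- The exterior derivative, computed at `x` in the chart at `x`. -/
def extD (α : DForm E X k) : DForm E X (k + 1) := fun x =>
  pullChart x (extDeriv (inChart α x) (chartAt E x x))

/-- The operator `∂`. In a holomorphic chart
`∂ (f dz_I ∧ dz̄_J) = ∂f ∧ dz_I ∧ dz̄_J`, where `∂f` is the complex-linear part of the derivative
of `f`; thus `∂α` is the alternatization of the complex-linear part of the derivative of the local
expression of `α`, just as `dα` is the alternatization of the whole derivative. -/
def del (α : DForm E X k) : DForm E X (k + 1) := fun x =>
  pullChart x (.alternatizeUncurryFin (linPart (fderiv ℝ (inChart α x) (chartAt E x x))))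

/-- The operator `∂̄`: in a holomorphic chart
`∂̄ (f dz_I ∧ dz̄_J) = ∂̄f ∧ dz_I ∧ dz̄_J`, where `∂̄f` is the complex-antilinear part of the
derivative of `f`. -/
def delbar (α : DForm E X k) : DForm E X (k + 1) := fun x =>
  pullChart x (.alternatizeUncurryFin (antilinPart (fderiv ℝ (inChart α x) (chartAt E x x))))

/-- The wedge product of differential forms. -/
def wedge (h : i + j = k) (α : DForm E X i) (β : DForm E X j) : DForm E X k := fun x =>
  wedgeAlt h (α x) (β x)

/-- The complex conjugate of a differential form. -/
def conjForm (α : DForm E X k) : DForm E X k := fun x => conjAlt (α x)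

/-- The wedge power `τ ∧ ⋯ ∧ τ` (`r` factors), with `τ ^ 0 = 1`. -/
def wedgePow (τ : DForm E X k) : (r : ℕ) → DForm E X (k * r)
  | 0 => fun x => ContinuousAlternatingMap.constOfIsEmpty ℝ (TangentSpace 𝓘(ℂ, E) x) (Fin 0) 1
  | r + 1 => wedge rfl (wedgePow τ r) τ

/-- A form is of type `(p, q)` if it is a `(p + q)`-form on which multiplication of all the
tangent vectors by a complex number `c` acts as multiplication by `c ^ p c̄ ^ q`. (The forms
`dz_I ∧ dz̄_J` with `|I| = a`, `|J| = b`, `a + b = p + q`, are multiplied by `c ^ a c̄ ^ b`, so this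
says that only those with `|I| = p`, `|J| = q` occur.) -/
def IsOfType (p q : ℕ) (α : DForm E X k) : Prop :=
  k = p + q ∧ ∀ (x : X) (c : ℂ) (v : Fin k → TangentSpace 𝓘(ℂ, E) x),
    α x (fun t => c • v t) = c ^ p * conj c ^ q * α x v

end Forms

/-! ### Linearity of the operators on smooth forms -/

section Linearity

variable {E : Type*} [NormedAddCommGroup E] [NormedSpace ℂ E]
  {X : Type*} [TopologicalSpace X] [ChartedSpace E X] {k : ℕ}

theorem inChart_add (α β : DForm E X k) (x₀ : X) :
    inChart (α + β) x₀ = inChart α x₀ + inChart β x₀ := rfl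

theorem inChart_smul (c : ℂ) (α : DForm E X k) (x₀ : X) :
    inChart (c • α) x₀ = c • inChart α x₀ := rfl

theorem inChart_zero (x₀ : X) : inChart (0 : DForm E X k) x₀ = 0 := rfl

theorem IsSmooth.zero : IsSmooth (0 : DForm E X k) := fun x₀ => by
  rw [inChart_zero]; exact contDiffOn_const

theorem IsSmooth.add {α β : DForm E X k} (hα : IsSmooth α) (hβ : IsSmooth β) :
    IsSmooth (α + β) := fun x₀ => by
  rw [inChart_add]; exact (hα x₀).add (hβ x₀)

theorem IsSmooth.smul (c : ℂ) {α : DForm E X k} (hα : IsSmooth α) : IsSmooth (c • α) :=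
  fun x₀ => by rw [inChart_smul]; exact (hα x₀).const_smul c

theorem IsSmooth.differentiableAt {α : DForm E X k} (hα : IsSmooth α) (x : X) :
    DifferentiableAt ℝ (inChart α x) (chartAt E x x) :=
  ((hα x).differentiableOn (by simp)).differentiableAt
    ((chartAt E x).open_target.mem_nhds (mem_chart_target E x))

theorem pullChart_add (x : X) (a b : CAlt E k) :
    pullChart x (a + b) = pullChart x a + pullChart x b := rfl

theorem pullChart_smul (x : X) (c : ℂ) (a : CAlt E k) :
    pullChart x (c • a) = c • pullChart x a := rfl

theorem delbar_add {α β : DForm E X k} (hα : IsSmooth α) (hβ : IsSmooth β) :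
    delbar (α + β) = delbar α + delbar β := by
  funext x
  simp only [delbar, inChart_add, fderiv_add (hα.differentiableAt x) (hβ.differentiableAt x),
    antilinPart_add, ContinuousAlternatingMap.alternatizeUncurryFin_add, pullChart_add,
    Pi.add_apply]

theorem delbar_smul (c : ℂ) {α : DForm E X k} (hα : IsSmooth α) :
    delbar (c • α) = c • delbar α := by
  funext x
  simp only [delbar, inChart_smul, fderiv_const_smul (hα.differentiableAt x),
    antilinPart_smul, ContinuousAlternatingMap.alternatizeUncurryFin_smul, pullChart_smul,
    Pi.smul_apply]

theorem delbar_zero : delbar (0 : DForm E X k) = 0 := by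
  have h := delbar_smul (0 : ℂ) (IsSmooth.zero (E := E) (X := X) (k := k))
  rwa [zero_smul, zero_smul] at h

theorem extD_eq_del_add_delbar (α : DForm E X k) : extD α = del α + delbar α := by
  funext x
  simp only [extD, del, delbar, Pi.add_apply, ← pullChart_add,
    ← ContinuousAlternatingMap.alternatizeUncurryFin_add, linPart_add_antilinPart, extDeriv]

end Linearity

/-! ### Dolbeault cohomology, the `∂∂̄`-lemma, complex symplectic forms -/

section Cohomology

variable (E : Type*) [NormedAddCommGroup E] [NormedSpace ℂ E]
  (X : Type*) [TopologicalSpace X] [ChartedSpace E X]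

/-- The space `A^{p,q}(X)` of smooth `(p, q)`-forms. -/
def smoothForms (p q : ℕ) : Submodule ℂ (DForm E X (p + q)) where
  carrier := {α | IsSmooth α ∧ IsOfType p q α}
  zero_mem' := ⟨IsSmooth.zero, rfl, fun x c v => by simp⟩
  add_mem' := fun {α β} ha hb => ⟨ha.1.add hb.1, rfl, fun x c v => by
    simp only [Pi.add_apply, ContinuousAlternatingMap.add_apply, ha.2.2, hb.2.2]; ring⟩
  smul_mem' := fun c α ha => ⟨ha.1.smul c, rfl, fun x c' v => by
    simp only [Pi.smul_apply, ContinuousAlternatingMap.smul_apply, ha.2.2, smul_eq_mul]; ring⟩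

/-- The kernel of `∂̄ : A^{p,q}(X) → A^{p,q+1}(X)`. -/
def dolbeaultCocycles (p q : ℕ) : Submodule ℂ (DForm E X (p + q)) where
  carrier := {α | α ∈ smoothForms E X p q ∧ delbar α = 0}
  zero_mem' := ⟨zero_mem _, delbar_zero⟩
  add_mem' := fun {α β} ha hb => ⟨add_mem ha.1 hb.1, by
    rw [delbar_add ha.1.1 hb.1.1, ha.2, hb.2, add_zero]⟩
  smul_mem' := fun c α ha => ⟨Submodule.smul_mem _ c ha.1, by
    rw [delbar_smul c ha.1.1, ha.2, smul_zero]⟩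

/-- The image of `∂̄ : A^{p,q-1}(X) → A^{p,q}(X)`, which is `0` for `q = 0`. -/
def dolbeaultCoboundaries (p : ℕ) : (q : ℕ) → Submodule ℂ (DForm E X (p + q))
  | 0 => ⊥
  | q + 1 =>
    { carrier := {α | ∃ β ∈ smoothForms E X p q, α = delbar β}
      zero_mem' := ⟨0, zero_mem _, delbar_zero.symm⟩
      add_mem' := by
        rintro _ _ ⟨β, hβ, rfl⟩ ⟨γ, hγ, rfl⟩
        exact ⟨β + γ, add_mem hβ hγ, (delbar_add hβ.1 hγ.1).symm⟩
      smul_mem' := by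
        rintro c _ ⟨β, hβ, rfl⟩
        exact ⟨c • β, Submodule.smul_mem _ c hβ, (delbar_smul c hβ.1).symm⟩ }

/-- The Dolbeault cohomology `H^{p,q}_{∂̄}(X)`. -/
abbrev DolbeaultCohomology (p q : ℕ) :=
  dolbeaultCocycles E X p q ⧸
    (dolbeaultCoboundaries E X p q).submoduleOf (dolbeaultCocycles E X p q)

variable {E X}

/-- The class of a `∂̄`-closed smooth `(p, q)`-form. -/
def dolbeaultClass {p q : ℕ} (α : DForm E X (p + q)) (hα : α ∈ dolbeaultCocycles E X p q) :
    DolbeaultCohomology E X p q :=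
  Submodule.Quotient.mk ⟨α, hα⟩

/-- The form lies in the image of `d` on smooth forms. -/
def IsDExact : {k : ℕ} → DForm E X k → Prop
  | 0, α => α = 0
  | _ + 1, α => ∃ β, IsSmooth β ∧ α = extD β

/-- The form lies in the image of `∂∂̄` on smooth forms. -/
def IsDelDelbarExact : {k : ℕ} → DForm E X k → Prop
  | 0, α => α = 0
  | 1, α => α = 0
  | _ + 2, α => ∃ γ, IsSmooth γ ∧ α = del (delbar γ)

variable (E X) in
/-- `X` satisfies the `∂∂̄`-lemma: `ker ∂ ∩ ker ∂̄ ∩ im d = im ∂∂̄` in the space of smooth forms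
(each of the operators being homogeneous, the equality is stated degree by degree). -/
def SatisfiesDelDelbarLemma : Prop :=
  ∀ (k : ℕ) (α : DForm E X k), IsSmooth α →
    ((del α = 0 ∧ delbar α = 0 ∧ IsDExact α) ↔ IsDelDelbarExact α)

/-- `σ` is a complex symplectic form: a smooth `d`-closed form of type `(2, 0)` which is
non-degenerate at every point. -/
structure IsComplexSymplectic (σ : DForm E X 2) : Prop where
  smooth : IsSmooth σ
  type : IsOfType 2 0 σ
  closed : extD σ = 0
  nondegenerate : ∀ (x : X) (v : TangentSpace 𝓘(ℂ, E) x),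
    (∀ w : TangentSpace 𝓘(ℂ, E) x, σ x ![v, w] = 0) → v = 0

end Cohomology

end CplxSympl

end

noncomputable section

set_option linter.unusedSectionVars false

namespace CplxSympl

section

/-! ### The wedge product: evaluation and contraction -/

section Shuffle

/-! Write n = m + 1, and let L and L̄ be the wedge products with σ and σ̄. Both forms have even
degree, so multiplication by (σ ∧ σ̄)^m is L̄^m L^m. The proof combines pointwise linear algebra
with the ∂∂̄-lemma; no harmonic theory enters.

Linear algebra. The contraction Λ with the bivector inverse to σ satisfies [Λ, L] = 2p - 2n on forms
of type (p, q) (`lam_mul_of_isType`). Since Λ kills type (1, q) and L kills type (2n - 1, q), the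
composites Λ^m L^m and L^m Λ^m are there one and the same nonzero scalar. Hence L^m maps smooth (1,
q)-forms bijectively onto smooth (2m + 1, q)-forms for every q (`eq_zero_of_lmul_pow_eq_zero`,
`exists_lmul_pow_eq`), and by conjugation L̄^m maps (p, 1)-forms bijectively onto (p, 2m + 1)-forms
for every p. Both commute with ∂ and ∂̄, because dσ = 0 forces ∂σ = ∂̄σ = 0.

The ∂∂̄-lemma is used in this form: if B is of pure type and ∂∂̄B = 0, then ∂̄B, and likewise ∂B,
equals ∂∂̄C with C of pure type. In particular every ∂̄-closed form that is needed can be made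
d-closed by subtracting a ∂̄-exact one.

Injectivity. Let A be a d-closed (1, 1)-form with L̄^m L^m A ∂̄-exact, and put T = L^m A. Then L̄^m
T = ∂∂̄U; writing ∂̄U = L̄^m K gives T = ∂K. Since T is ∂̄-closed, T = ∂∂̄W; writing ∂W = L^m P
gives A = -∂̄P.

Surjectivity. Let B be d-closed of type (2m + 1, 2m + 1), and B = L̄^m T. Then ∂T = 0, so T - ∂W is
∂̄-closed for some W, and T - ∂W = L^m A with ∂̄A = 0. The error ∂ L̄^m W is ∂-exact and ∂̄-closed,
hence ∂∂̄-exact, hence invisible in Dolbeault cohomology.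

For the formal work, forms of all degrees are collected in one family, so that identities become
operator identities. These are proved by induction on the degree through contraction with vectors.
Types are eigenspaces of the action of complex scalars on the arguments, so neither the basis dz_I ∧
dz̄_J nor a full type decomposition is needed. -/

theorem sum_perm_sign_cons {α M : Type*} [AddCommGroup M] {k : ℕ} (F : (Fin (k + 1) → α) → M)
    (v : α) (w : Fin k → α) :
    ∑ s : Equiv.Perm (Fin (k + 1)), Equiv.Perm.sign s • F ((Fin.cons v w : Fin (k + 1) → α) ∘ s) =
      ∑ p : Fin (k + 1), (-1 : ℤ) ^ (p : ℕ) •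
        ∑ t : Equiv.Perm (Fin k), Equiv.Perm.sign t • F (p.insertNth v (w ∘ t)) := by
  -- A permutation is recorded by the position `p` that it sends to `0`, which is the slot receiving
  -- `v`, and by a permutation `t` of the rest. The cycle `p.cycleRange` moves `p` to `0` and
  -- carries the sign (-1)^p; surjectivity follows by counting.
  have hb : Function.Bijective (fun x : Fin (k + 1) × Equiv.Perm (Fin k) =>
      Equiv.Perm.decomposeFin.symm (0, x.2) * x.1.cycleRange) := by
    rw [Fintype.bijective_iff_injective_and_card]
    constructor
    · rintro ⟨p, t⟩ ⟨p', t'⟩ h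
      simp only at h
      have h0 : ∀ (q : Fin (k + 1)) (u : Equiv.Perm (Fin k)),
          (Equiv.Perm.decomposeFin.symm (0, u) * q.cycleRange) q = 0 := by
        intro q u
        rw [Equiv.Perm.mul_apply, Fin.cycleRange_self, Equiv.Perm.decomposeFin_symm_apply_zero]
      have hp : p = p' := by
        have h1 := h0 p t
        rw [h] at h1
        exact (Equiv.injective _) (h1.trans (h0 p' t').symm)
      subst hp
      have h2 := mul_right_cancel h
      have h3 := Equiv.Perm.decomposeFin.symm.injective h2
      simpa using h3
    · simp [Fintype.card_perm, Nat.factorial_succ]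
  rw [← Function.Bijective.sum_comp hb, Fintype.sum_prod_type]
  refine Finset.sum_congr rfl fun p _ => ?_
  rw [Finset.smul_sum]
  refine Finset.sum_congr rfl fun t _ => ?_
  have hc : (Fin.cons v w : Fin (k + 1) → α) ∘ (Equiv.Perm.decomposeFin.symm (0, t) * p.cycleRange)
      = p.insertNth v (w ∘ t) := by
    rw [Equiv.Perm.coe_mul, ← Function.comp_assoc, ← Fin.cons_comp_cycleRange]
    congr 1
    funext x
    refine Fin.cases ?_ (fun y => ?_) x
    · simp
    · simp
  simp only
  rw [hc, Equiv.Perm.sign_mul, Equiv.Perm.decomposeFin.symm_sign, Fin.sign_cycleRange]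
  simp only [if_true, one_mul, Units.smul_def, smul_smul]
  congr 1
  push_cast
  ring

end Shuffle

variable {V : Type*} [NormedAddCommGroup V] [NormedSpace ℂ V]

/-- Summing over all permutations counts each shuffle i! j! times. In this form the quotient
defining shuffles disappears from the later computations. -/
theorem wedgeAlt_apply {i j k : ℕ} (h : i + j = k) (a : CAlt V i) (b : CAlt V j) (v : Fin k → V) :
    ((i.factorial * j.factorial : ℕ) : ℂ) * wedgeAlt h a b v =
      ∑ s : Equiv.Perm (Fin k), Equiv.Perm.sign s •
        (a (fun t => v (s (finCongr h (finSumFinEquiv (Sum.inl t))))) *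
          b (fun t => v (s (finCongr h (finSumFinEquiv (Sum.inr t)))))) := by
  subst h
  have key := congrArg (fun f => LinearMap.mul' ℝ ℂ (f (fun t => v (finSumFinEquiv t))))
    (MultilinearMap.domCoprod_alternization_eq (R' := ℝ) a.toAlternatingMap b.toAlternatingMap)
  simp only [MultilinearMap.alternatization_apply, AlternatingMap.smul_apply, map_nsmul, map_sum,
    Fintype.card_fin, MultilinearMap.domDomCongr_apply, MultilinearMap.domCoprod_apply] at key
  rw [nsmul_eq_mul] at key
  refine Eq.trans ?_ (key.symm.trans ?_)
  · rfl
  · refine Fintype.sum_equiv (finSumFinEquiv.permCongr) _ _ fun s => ?_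
    have h1 : ∀ (u : ℤˣ) (z : TensorProduct ℝ ℂ ℂ),
        LinearMap.mul' ℝ ℂ (u • z) = u • LinearMap.mul' ℝ ℂ z := fun u z => by
      rw [Units.smul_def, Units.smul_def, map_zsmul]
    rw [h1, Equiv.Perm.sign_permCongr, LinearMap.mul'_apply]
    simp [Equiv.permCongr_apply]

/-- This and the next three lemmas are bookkeeping: a vector inserted in the block of slots of one
factor is inserted in that factor's arguments, and the other factor does not see it. -/
theorem insertNth_inl_inl {α : Type*} {i j k : ℕ} (h : i + 1 + j = k + 1) (h' : i + j = k)
    (p : Fin (i + 1)) (v : α) (u : Fin k → α) :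
    (fun x => ((finCongr h (finSumFinEquiv (Sum.inl p))).insertNth v u : Fin (k + 1) → α)
      (finCongr h (finSumFinEquiv (Sum.inl x)))) =
      p.insertNth v (fun x => u (finCongr h' (finSumFinEquiv (Sum.inl x)))) := by
  funext x
  refine Fin.succAboveCases p ?_ (fun y => ?_) x
  · simp
  · have : finCongr h (finSumFinEquiv (Sum.inl (p.succAbove y))) =
        (finCongr h (finSumFinEquiv (Sum.inl p))).succAbove
          (finCongr h' (finSumFinEquiv (Sum.inl y))) := by
      ext
      simp [Fin.succAbove, Fin.lt_def]
      split_ifs <;> simp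
    rw [this, Fin.insertNth_apply_succAbove, Fin.insertNth_apply_succAbove]

theorem insertNth_inl_inr {α : Type*} {i j k : ℕ} (h : i + 1 + j = k + 1) (h' : i + j = k)
    (p : Fin (i + 1)) (v : α) (u : Fin k → α) :
    (fun x => ((finCongr h (finSumFinEquiv (Sum.inl p))).insertNth v u : Fin (k + 1) → α)
      (finCongr h (finSumFinEquiv (Sum.inr x)))) =
      fun x => u (finCongr h' (finSumFinEquiv (Sum.inr x))) := by
  funext x
  have : finCongr h (finSumFinEquiv (Sum.inr x)) =
      (finCongr h (finSumFinEquiv (Sum.inl p))).succAbove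
        (finCongr h' (finSumFinEquiv (Sum.inr x))) := by
    ext
    simp [Fin.succAbove, Fin.lt_def]
    split_ifs <;> simp <;> omega
  rw [this, Fin.insertNth_apply_succAbove]

theorem insertNth_inr_inl {α : Type*} {i j k : ℕ} (h : i + (j + 1) = k + 1) (h' : i + j = k)
    (p : Fin (j + 1)) (v : α) (u : Fin k → α) :
    (fun x => ((finCongr h (finSumFinEquiv (Sum.inr p))).insertNth v u : Fin (k + 1) → α)
      (finCongr h (finSumFinEquiv (Sum.inl x)))) =
      fun x => u (finCongr h' (finSumFinEquiv (Sum.inl x))) := by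
  funext x
  have : finCongr h (finSumFinEquiv (Sum.inl x)) =
      (finCongr h (finSumFinEquiv (Sum.inr p))).succAbove
        (finCongr h' (finSumFinEquiv (Sum.inl x))) := by
    ext
    simp [Fin.succAbove, Fin.lt_def]
    split_ifs <;> simp <;> omega
  rw [this, Fin.insertNth_apply_succAbove]

theorem insertNth_inr_inr {α : Type*} {i j k : ℕ} (h : i + (j + 1) = k + 1) (h' : i + j = k)
    (p : Fin (j + 1)) (v : α) (u : Fin k → α) :
    (fun x => ((finCongr h (finSumFinEquiv (Sum.inr p))).insertNth v u : Fin (k + 1) → α)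
      (finCongr h (finSumFinEquiv (Sum.inr x)))) =
      p.insertNth v (fun x => u (finCongr h' (finSumFinEquiv (Sum.inr x)))) := by
  funext x
  refine Fin.succAboveCases p ?_ (fun y => ?_) x
  · simp
  · have : finCongr h (finSumFinEquiv (Sum.inr (p.succAbove y))) =
        (finCongr h (finSumFinEquiv (Sum.inr p))).succAbove
          (finCongr h' (finSumFinEquiv (Sum.inr y))) := by
      ext
      simp [Fin.succAbove, Fin.lt_def]
      split_ifs <;> simp <;> omega
    rw [this, Fin.insertNth_apply_succAbove, Fin.insertNth_apply_succAbove]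

/-- Moving `v` to the front of `a` costs (-1)^p, which cancels the sign of the expansion. So the i +
1 slots contribute equally, and i! becomes (i + 1)!. -/
theorem sum_insertNth_inl {i j k : ℕ} (h : i + 1 + j = k + 1) (h' : i + j = k)
    (a : CAlt V (i + 1)) (b : CAlt V j) (v : V) (w : Fin k → V) :
    ∑ p : Fin (i + 1), (-1 : ℤ) ^ ((finCongr h (finSumFinEquiv (Sum.inl p)) : Fin (k + 1)) : ℕ) •
      ∑ t : Equiv.Perm (Fin k), Equiv.Perm.sign t •
        (a (fun x => ((finCongr h (finSumFinEquiv (Sum.inl p))).insertNth v (w ∘ t) :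
            Fin (k + 1) → V) (finCongr h (finSumFinEquiv (Sum.inl x)))) *
          b (fun x => ((finCongr h (finSumFinEquiv (Sum.inl p))).insertNth v (w ∘ t) :
            Fin (k + 1) → V) (finCongr h (finSumFinEquiv (Sum.inr x))))) =
      (((i + 1).factorial * j.factorial : ℕ) : ℂ) * wedgeAlt h' (a.curryLeft v) b w := by
  have : (((i + 1).factorial * j.factorial : ℕ) : ℂ) * wedgeAlt h' (a.curryLeft v) b w =
      ∑ p : Fin (i + 1), ((i.factorial * j.factorial : ℕ) : ℂ) * wedgeAlt h' (a.curryLeft v) b w := by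
    rw [Finset.sum_const, Finset.card_univ, Fintype.card_fin, Nat.factorial_succ, nsmul_eq_mul]
    push_cast
    ring
  rw [this]
  refine Finset.sum_congr rfl fun p _ => ?_
  rw [wedgeAlt_apply, Finset.smul_sum]
  refine Finset.sum_congr rfl fun t _ => ?_
  rw [insertNth_inl_inl h h', insertNth_inl_inr h h', ContinuousAlternatingMap.map_insertNth,
    smul_comm]
  congr 1
  rw [← smul_mul_assoc]
  simp only [finCongr_apply, finSumFinEquiv_apply_left, Fin.val_cast, Fin.val_castAdd, smul_smul,
    ← pow_add, ← two_mul]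
  simp

/-- Slot p of `b` is slot i + p of the product, so the two signs combine to (-1)^i, and again all
slots contribute equally. -/
theorem sum_insertNth_inr {i j k : ℕ} (h : i + (j + 1) = k + 1) (h' : i + j = k)
    (a : CAlt V i) (b : CAlt V (j + 1)) (v : V) (w : Fin k → V) :
    ∑ p : Fin (j + 1), (-1 : ℤ) ^ ((finCongr h (finSumFinEquiv (Sum.inr p)) : Fin (k + 1)) : ℕ) •
      ∑ t : Equiv.Perm (Fin k), Equiv.Perm.sign t •
        (a (fun x => ((finCongr h (finSumFinEquiv (Sum.inr p))).insertNth v (w ∘ t) :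
            Fin (k + 1) → V) (finCongr h (finSumFinEquiv (Sum.inl x)))) *
          b (fun x => ((finCongr h (finSumFinEquiv (Sum.inr p))).insertNth v (w ∘ t) :
            Fin (k + 1) → V) (finCongr h (finSumFinEquiv (Sum.inr x))))) =
      ((i.factorial * (j + 1).factorial : ℕ) : ℂ) *
        ((-1) ^ i * wedgeAlt h' a (b.curryLeft v) w) := by
  have : ((i.factorial * (j + 1).factorial : ℕ) : ℂ) *
      ((-1) ^ i * wedgeAlt h' a (b.curryLeft v) w) =
      ∑ p : Fin (j + 1), (-1) ^ i *
        (((i.factorial * j.factorial : ℕ) : ℂ) * wedgeAlt h' a (b.curryLeft v) w) := by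
    rw [Finset.sum_const, Finset.card_univ, Fintype.card_fin, Nat.factorial_succ, nsmul_eq_mul]
    push_cast
    ring
  rw [this]
  refine Finset.sum_congr rfl fun p _ => ?_
  rw [wedgeAlt_apply, Finset.smul_sum, Finset.mul_sum]
  refine Finset.sum_congr rfl fun t _ => ?_
  rw [insertNth_inr_inl h h', insertNth_inr_inr h h', ContinuousAlternatingMap.map_insertNth,
    smul_comm, mul_smul_comm]
  rw [mul_smul_comm, smul_smul]
  simp only [finCongr_apply, finSumFinEquiv_apply_right, Fin.val_cast, Fin.val_natAdd,
    ← pow_add, add_assoc, ← two_mul]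
  rw [pow_add, pow_mul]
  simp

theorem wedgeAlt_cons_eq_sum {i j k : ℕ} (h : i + j = k + 1) (a : CAlt V i) (b : CAlt V j)
    (v : V) (w : Fin k → V) :
    ((i.factorial * j.factorial : ℕ) : ℂ) * wedgeAlt h a b (Fin.cons v w : Fin (k + 1) → V) =
      ∑ p : Fin i ⊕ Fin j, (-1 : ℤ) ^ ((finCongr h (finSumFinEquiv p) : Fin (k + 1)) : ℕ) •
      ∑ t : Equiv.Perm (Fin k), Equiv.Perm.sign t •
        (a (fun x => ((finCongr h (finSumFinEquiv p)).insertNth v (w ∘ t) :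
            Fin (k + 1) → V) (finCongr h (finSumFinEquiv (Sum.inl x)))) *
          b (fun x => ((finCongr h (finSumFinEquiv p)).insertNth v (w ∘ t) :
            Fin (k + 1) → V) (finCongr h (finSumFinEquiv (Sum.inr x))))) := by
  rw [wedgeAlt_apply]
  have := sum_perm_sign_cons (fun u : Fin (k + 1) → V =>
    a (fun x => u (finCongr h (finSumFinEquiv (Sum.inl x)))) *
      b (fun x => u (finCongr h (finSumFinEquiv (Sum.inr x))))) v w
  refine this.trans ?_
  exact (Equiv.sum_comp (finSumFinEquiv.trans (finCongr h)) _).symm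

theorem factorial_mul_factorial_ne_zero (i j : ℕ) :
    ((i.factorial * j.factorial : ℕ) : ℂ) ≠ 0 := by
  exact_mod_cast Nat.mul_ne_zero (Nat.factorial_ne_zero i) (Nat.factorial_ne_zero j)

/-- Contraction is an antiderivation: `v` lands among the arguments of `a` or of `b`. Factors of
degree 0 are treated separately below, since they have no argument to fill. -/
theorem wedgeAlt_curryLeft_succ_succ {i j k : ℕ} (h : i + 1 + (j + 1) = k + 1)
    (a : CAlt V (i + 1)) (b : CAlt V (j + 1)) (v : V) :
    (wedgeAlt h a b).curryLeft v =
      wedgeAlt (show i + (j + 1) = k by omega) (a.curryLeft v) b +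
        (-1 : ℂ) ^ (i + 1) • wedgeAlt (show i + 1 + j = k by omega) a (b.curryLeft v) := by
  ext w
  refine mul_left_cancel₀ (factorial_mul_factorial_ne_zero (i + 1) (j + 1)) ?_
  refine (wedgeAlt_cons_eq_sum h a b v w).trans ?_
  rw [Fintype.sum_sum_type, sum_insertNth_inl, sum_insertNth_inr]
  rw [ContinuousAlternatingMap.add_apply, ContinuousAlternatingMap.smul_apply, smul_eq_mul, mul_add]

theorem wedgeAlt_curryLeft_zero_succ {j k : ℕ} (h : 0 + (j + 1) = k + 1)
    (a : CAlt V 0) (b : CAlt V (j + 1)) (v : V) :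
    (wedgeAlt h a b).curryLeft v = wedgeAlt (show 0 + j = k by omega) a (b.curryLeft v) := by
  ext w
  refine mul_left_cancel₀ (factorial_mul_factorial_ne_zero 0 (j + 1)) ?_
  refine (wedgeAlt_cons_eq_sum h a b v w).trans ?_
  rw [Fintype.sum_sum_type, sum_insertNth_inr]
  · simp
  · omega

theorem wedgeAlt_curryLeft_succ_zero {i k : ℕ} (h : i + 1 + 0 = k + 1)
    (a : CAlt V (i + 1)) (b : CAlt V 0) (v : V) :
    (wedgeAlt h a b).curryLeft v = wedgeAlt (show i + 0 = k by omega) (a.curryLeft v) b := by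
  ext w
  refine mul_left_cancel₀ (factorial_mul_factorial_ne_zero (i + 1) 0) ?_
  refine (wedgeAlt_cons_eq_sum h a b v w).trans ?_
  rw [Fintype.sum_sum_type, sum_insertNth_inl]
  · simp
  · omega

theorem wedgeAlt_zero_zero (a b : CAlt V 0) (v : Fin 0 → V) :
    wedgeAlt (show 0 + 0 = 0 from rfl) a b v = a v * b v := by
  have := wedgeAlt_apply (show 0 + 0 = 0 from rfl) a b v
  simp at this
  convert this using 3

theorem wedgeAlt_add_left {i j k : ℕ} (h : i + j = k) (a a' : CAlt V i) (b : CAlt V j) :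
    wedgeAlt h (a + a') b = wedgeAlt h a b + wedgeAlt h a' b := by
  ext v
  refine mul_left_cancel₀ (factorial_mul_factorial_ne_zero i j) ?_
  rw [ContinuousAlternatingMap.add_apply, mul_add]
  simp only [wedgeAlt_apply, ← Finset.sum_add_distrib, ContinuousAlternatingMap.add_apply, add_mul,
    smul_add]

theorem wedgeAlt_add_right {i j k : ℕ} (h : i + j = k) (a : CAlt V i) (b b' : CAlt V j) :
    wedgeAlt h a (b + b') = wedgeAlt h a b + wedgeAlt h a b' := by
  ext v
  refine mul_left_cancel₀ (factorial_mul_factorial_ne_zero i j) ?_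
  rw [ContinuousAlternatingMap.add_apply, mul_add]
  simp only [wedgeAlt_apply, ← Finset.sum_add_distrib, ContinuousAlternatingMap.add_apply, mul_add,
    smul_add]

theorem wedgeAlt_smul_left {i j k : ℕ} (h : i + j = k) (c : ℂ) (a : CAlt V i) (b : CAlt V j) :
    wedgeAlt h (c • a) b = c • wedgeAlt h a b := by
  ext v
  refine mul_left_cancel₀ (factorial_mul_factorial_ne_zero i j) ?_
  rw [ContinuousAlternatingMap.smul_apply, mul_smul_comm]
  simp only [wedgeAlt_apply, Finset.smul_sum, ContinuousAlternatingMap.smul_apply, smul_mul_assoc]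
  exact Finset.sum_congr rfl fun s _ => smul_comm _ _ _

theorem wedgeAlt_smul_right {i j k : ℕ} (h : i + j = k) (c : ℂ) (a : CAlt V i) (b : CAlt V j) :
    wedgeAlt h a (c • b) = c • wedgeAlt h a b := by
  ext v
  refine mul_left_cancel₀ (factorial_mul_factorial_ne_zero i j) ?_
  rw [ContinuousAlternatingMap.smul_apply, mul_smul_comm]
  simp only [wedgeAlt_apply, Finset.smul_sum, ContinuousAlternatingMap.smul_apply, mul_smul_comm]
  exact Finset.sum_congr rfl fun s _ => smul_comm _ _ _

theorem wedgeAlt_compContinuousLinearMap {W : Type*} [NormedAddCommGroup W] [NormedSpace ℂ W]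
    {i j k : ℕ} (h : i + j = k) (a : CAlt V i) (b : CAlt V j) (f : W →L[ℝ] V) :
    (wedgeAlt h a b).compContinuousLinearMap f =
      wedgeAlt h (a.compContinuousLinearMap f) (b.compContinuousLinearMap f) := by
  ext v
  refine mul_left_cancel₀ (factorial_mul_factorial_ne_zero i j) ?_
  rw [ContinuousAlternatingMap.compContinuousLinearMap_apply, wedgeAlt_apply, wedgeAlt_apply]
  rfl

theorem conjAlt_wedgeAlt {i j k : ℕ} (h : i + j = k) (a : CAlt V i) (b : CAlt V j) :
    conjAlt (wedgeAlt h a b) = wedgeAlt h (conjAlt a) (conjAlt b) := by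
  ext v
  refine mul_left_cancel₀ (factorial_mul_factorial_ne_zero i j) ?_
  rw [wedgeAlt_apply]
  have h1 : ∀ {l : ℕ} (x : CAlt V l) (u : Fin l → V), conjAlt x u = conj (x u) := fun _ _ => rfl
  simp only [h1, ← map_mul]
  rw [← Complex.conj_natCast, ← map_mul, wedgeAlt_apply, map_sum]
  exact Finset.sum_congr rfl fun s _ => by simp [Units.smul_def]

end

section

/-! ### Graded families of alternating forms -/

/-- Families `(a_k)_k` of complex-valued alternating forms, one in each degree `k`. -/
abbrev Gr (V : Type*) [NormedAddCommGroup V] [NormedSpace ℂ V] := ∀ k : ℕ, CAlt V k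

namespace Gr

variable {V : Type*} [NormedAddCommGroup V] [NormedSpace ℂ V]
  {W : Type*} [NormedAddCommGroup W] [NormedSpace ℂ W]

instance instAddCommGroupCAlt (k : ℕ) : AddCommGroup (CAlt V k) := inferInstance
instance instModuleCAlt (k : ℕ) : Module ℂ (CAlt V k) := inferInstance
instance instAddCommGroup : AddCommGroup (Gr V) := Pi.addCommGroup
instance instAddCommMonoid : AddCommMonoid (Gr V) := instAddCommGroup.toAddCommMonoid
instance instModule : Module ℂ (Gr V) := Pi.module _ _ _
instance instAddCommGroupHom : AddCommGroup (Gr V →ₗ[ℂ] Gr W) := LinearMap.addCommGroup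
instance instModuleHom : Module ℂ (Gr V →ₗ[ℂ] Gr W) := LinearMap.module

/-- The wedge product in degree `k`, extended by zero to all pairs of degrees. -/
def wedgeAux (k i j : ℕ) (a : CAlt V i) (b : CAlt V j) : CAlt V k :=
  if h : i + j = k then wedgeAlt h a b else 0

/-- The wedge product of graded families. -/
def mul : Gr V →ₗ[ℂ] Gr V →ₗ[ℂ] Gr V :=
  LinearMap.mk₂ ℂ (fun a b k => ∑ p ∈ Finset.HasAntidiagonal.antidiagonal k, wedgeAux k p.1 p.2 (a p.1) (b p.2))
    (fun a a' b => by
      funext k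
      simp only [Pi.add_apply, ← Finset.sum_add_distrib]
      refine Finset.sum_congr rfl fun p hp => ?_
      simp only [wedgeAux, dif_pos (Finset.HasAntidiagonal.mem_antidiagonal.1 hp), wedgeAlt_add_left])
    (fun c a b => by
      funext k
      simp only [Pi.smul_apply, Finset.smul_sum]
      refine Finset.sum_congr rfl fun p hp => ?_
      simp only [wedgeAux, dif_pos (Finset.HasAntidiagonal.mem_antidiagonal.1 hp), wedgeAlt_smul_left])
    (fun a b b' => by
      funext k
      simp only [Pi.add_apply, ← Finset.sum_add_distrib]
      refine Finset.sum_congr rfl fun p hp => ?_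
      simp only [wedgeAux, dif_pos (Finset.HasAntidiagonal.mem_antidiagonal.1 hp), wedgeAlt_add_right])
    (fun c a b => by
      funext k
      simp only [Pi.smul_apply, Finset.smul_sum]
      refine Finset.sum_congr rfl fun p hp => ?_
      simp only [wedgeAux, dif_pos (Finset.HasAntidiagonal.mem_antidiagonal.1 hp), wedgeAlt_smul_right])

theorem mul_apply (a b : Gr V) (k : ℕ) :
    mul a b k = ∑ p ∈ Finset.HasAntidiagonal.antidiagonal k, wedgeAux k p.1 p.2 (a p.1) (b p.2) := rfl

/-- Contraction with a vector. -/
def contr (v : V) : Gr V →ₗ[ℂ] Gr V where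
  toFun a k := (a (k + 1)).curryLeft v
  map_add' _ _ := rfl
  map_smul' _ _ := rfl

theorem contr_apply (v : V) (a : Gr V) (k : ℕ) : contr v a k = (a (k + 1)).curryLeft v := rfl

theorem contr_add_vec (v w : V) (a : Gr V) : contr (v + w) a = contr v a + contr w a := by
  funext k
  simp [contr_apply]

theorem contr_smul_vec (c : ℝ) (v : V) (a : Gr V) : contr (c • v) a = (c : ℂ) • contr v a := by
  funext k
  ext w
  rw [contr_apply, map_smul, Pi.smul_apply, ContinuousAlternatingMap.smul_apply,
    ContinuousAlternatingMap.smul_apply, Complex.real_smul, smul_eq_mul, contr_apply]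

theorem apply_zero_ext {a b : CAlt V 0} (h : a 0 = b 0) : a = b := by
  ext v
  rw [Subsingleton.elim v 0, h]

/-- The induction principle of the algebraic part: an identity in degree k + 1 is tested by
contractions in degree k, where the Leibniz rule applies. -/
theorem apply_succ_ext {a b : Gr V} {k : ℕ} (h : ∀ v, contr v a k = contr v b k) :
    a (k + 1) = b (k + 1) := by
  ext v
  have := congrArg (fun f => f (Fin.tail v)) (h (v 0))
  simp only [contr_apply, ContinuousAlternatingMap.curryLeft_apply_apply] at this
  rwa [Matrix.vecCons, Fin.cons_self_tail] at this

/-- The grading involution, multiplication by `(-1) ^ k` in degree `k`. -/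
def eps : Gr V →ₗ[ℂ] Gr V where
  toFun a k := (-1 : ℂ) ^ k • a k
  map_add' _ _ := by funext k; simp
  map_smul' c a := by funext k; exact smul_comm ((-1 : ℂ) ^ k) c (a k)

theorem eps_apply (a : Gr V) (k : ℕ) : eps a k = (-1 : ℂ) ^ k • a k := rfl

theorem eps_eps (a : Gr V) : eps (eps a) = a := by
  funext k
  rw [eps_apply, eps_apply, smul_smul, ← mul_pow]
  simp

theorem contr_eps (v : V) (a : Gr V) : contr v (eps a) = -eps (contr v a) := by
  funext k
  ext w
  simp [contr_apply, eps_apply, pow_succ]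

theorem eps_mul (a b : Gr V) : eps (mul a b) = mul (eps a) (eps b) := by
  funext k
  rw [eps_apply, mul_apply, mul_apply, Finset.smul_sum]
  refine Finset.sum_congr rfl fun p hp => ?_
  have hp' := Finset.HasAntidiagonal.mem_antidiagonal.1 hp
  simp only [wedgeAux, dif_pos hp', eps_apply, wedgeAlt_smul_left, wedgeAlt_smul_right, smul_smul]
  rw [← pow_add, add_comm, hp']

theorem contr_contr (v w : V) (a : Gr V) : contr v (contr w a) = -contr w (contr v a) := by
  have h0 : ∀ u : V, contr u (contr u a) = 0 := by
    intro u
    funext k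
    exact ContinuousAlternatingMap.curryLeft_same _ _
  have h := h0 (v + w)
  simp only [contr_add_vec, map_add, h0, zero_add, add_zero] at h
  exact eq_neg_of_add_eq_zero_right h

theorem contr_mul (v : V) (a b : Gr V) :
    contr v (mul a b) = mul (contr v a) b + mul (eps a) (contr v b) := by
  funext k
  -- The two Leibniz terms, set to zero where the contracted factor has degree 0, so that both
  -- reindex to the antidiagonal of k.
  let T1 : ℕ × ℕ → CAlt V k := fun p => match p with
    | (0, _) => 0
    | (i + 1, j) => wedgeAux k i j (contr v a i) (b j)
  let T2 : ℕ × ℕ → CAlt V k := fun p => match p with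
    | (_, 0) => 0
    | (i, j + 1) => wedgeAux k i j (eps a i) (contr v b j)
  have h : ∀ p ∈ Finset.HasAntidiagonal.antidiagonal (k + 1),
      (wedgeAux (k + 1) p.1 p.2 (a p.1) (b p.2)).curryLeft v = T1 p + T2 p := by
    rintro ⟨i, j⟩ hp
    have hp' : i + j = k + 1 := Finset.HasAntidiagonal.mem_antidiagonal.1 hp
    rcases i with _ | i <;> rcases j with _ | j
    · omega
    · have h1 : 0 + j = k := by omega
      simp only [T1, T2, wedgeAux, dif_pos hp', dif_pos h1, wedgeAlt_curryLeft_zero_succ]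
      simp [eps_apply, contr_apply]
    · have h1 : i + 0 = k := by omega
      simp only [T1, T2, wedgeAux, dif_pos hp', dif_pos h1, wedgeAlt_curryLeft_succ_zero, add_zero]
      rfl
    · have h1 : i + (j + 1) = k := by omega
      have h2 : i + 1 + j = k := by omega
      simp only [T1, T2, wedgeAux, dif_pos hp', dif_pos h1, dif_pos h2,
        wedgeAlt_curryLeft_succ_succ, eps_apply, wedgeAlt_smul_left]
      rfl
  have hsum : contr v (mul a b) k = ∑ p ∈ Finset.HasAntidiagonal.antidiagonal (k + 1),
      (wedgeAux (k + 1) p.1 p.2 (a p.1) (b p.2)).curryLeft v := by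
    ext w
    rw [contr_apply, ContinuousAlternatingMap.curryLeft_apply_apply, mul_apply,
      ContinuousAlternatingMap.sum_apply, ContinuousAlternatingMap.sum_apply]
    rfl
  rw [hsum, Finset.sum_congr rfl h, Finset.sum_add_distrib, Finset.Nat.sum_antidiagonal_succ,
    Finset.Nat.sum_antidiagonal_succ']
  simp [T1, T2, mul_apply]

theorem mul_apply_zero (a b : Gr V) : mul a b 0 0 = a 0 0 * b 0 0 := by
  rw [mul_apply, Finset.HasAntidiagonal.antidiagonal_zero, Finset.sum_singleton]
  exact wedgeAlt_zero_zero _ _ _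

theorem mul_assoc (a b c : Gr V) : mul (mul a b) c = mul a (mul b c) := by
  funext k
  induction k generalizing a b c with
  | zero =>
    apply apply_zero_ext
    simp only [mul_apply_zero, _root_.mul_assoc]
  | succ k ih =>
    refine apply_succ_ext fun v => ?_
    simp only [contr_mul, eps_mul, map_add, LinearMap.add_apply, Pi.add_apply, ih, add_assoc]

/-- The two parities must be handled together, since contracting `a` with a vector exchanges them.
-/
theorem mul_comm_parity (k : ℕ) (a b : Gr V) :
    (eps a = a → mul a b k = mul b a k) ∧ (eps a = -a → mul a b k = mul (eps b) a k) := by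
  induction k generalizing a b with
  | zero =>
    constructor <;> intro _ <;> apply apply_zero_ext <;>
      simp only [mul_apply_zero, eps_apply, pow_zero, one_smul, _root_.mul_comm]
  | succ k ih =>
    constructor
    · intro h
      refine apply_succ_ext fun v => ?_
      have h' : eps (contr v a) = -contr v a := by rw [← neg_eq_iff_eq_neg, ← contr_eps, h]
      rw [contr_mul, contr_mul, Pi.add_apply, Pi.add_apply, h, (ih _ _).2 h', (ih _ _).1 h,
        add_comm]
    · intro h
      refine apply_succ_ext fun v => ?_
      have h' : eps (contr v a) = contr v a := by
        rw [← neg_inj, ← contr_eps, h, map_neg]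
      rw [contr_mul, contr_mul, Pi.add_apply, Pi.add_apply, h, (ih _ _).1 h', eps_eps, contr_eps,
        map_neg, map_neg, LinearMap.neg_apply, LinearMap.neg_apply, Pi.neg_apply, Pi.neg_apply,
        (ih _ _).2 h, add_comm]

theorem mul_comm_of_even {a : Gr V} (h : eps a = a) (b : Gr V) : mul a b = mul b a :=
  funext fun k => (mul_comm_parity k a b).1 h

theorem mul_comm_of_odd {a : Gr V} (h : eps a = -a) (b : Gr V) : mul a b = mul (eps b) a :=
  funext fun k => (mul_comm_parity k a b).2 h

/-- Pull-back along a real-linear map. -/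
def pull (f : W →L[ℝ] V) : Gr V →ₗ[ℂ] Gr W where
  toFun a k := (a k).compContinuousLinearMap f
  map_add' _ _ := rfl
  map_smul' _ _ := rfl

theorem pull_apply (f : W →L[ℝ] V) (a : Gr V) (k : ℕ) :
    pull f a k = (a k).compContinuousLinearMap f := rfl

theorem pull_mul (f : W →L[ℝ] V) (a b : Gr V) : pull f (mul a b) = mul (pull f a) (pull f b) := by
  funext k
  ext w
  rw [pull_apply, mul_apply, ContinuousAlternatingMap.compContinuousLinearMap_apply, mul_apply,
    ContinuousAlternatingMap.sum_apply, ContinuousAlternatingMap.sum_apply]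
  refine Finset.sum_congr rfl fun p hp => ?_
  simp only [wedgeAux, dif_pos (Finset.HasAntidiagonal.mem_antidiagonal.1 hp), pull_apply,
    ← wedgeAlt_compContinuousLinearMap]
  rfl

theorem contr_pull (f : W →L[ℝ] V) (w : W) (a : Gr V) :
    contr w (pull f a) = pull f (contr (f w) a) := by
  funext k
  exact ContinuousAlternatingMap.curryLeft_compContinuousLinearMap _ _ _

/-- Complex conjugation of the values. -/
def conjG (a : Gr V) : Gr V := fun k => conjAlt (a k)

theorem conjG_mul (a b : Gr V) : conjG (mul a b) = mul (conjG a) (conjG b) := by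
  funext k
  ext w
  change conj (mul a b k w) = _
  rw [mul_apply, mul_apply, ContinuousAlternatingMap.sum_apply, ContinuousAlternatingMap.sum_apply,
    map_sum]
  refine Finset.sum_congr rfl fun p hp => ?_
  simp only [wedgeAux, dif_pos (Finset.HasAntidiagonal.mem_antidiagonal.1 hp), conjG, ← conjAlt_wedgeAlt]
  rfl

theorem single_mul_apply {i j k : ℕ} (h : i + j = k) (a : CAlt V i) (b : Gr V) :
    mul (Pi.single i a) b k = wedgeAlt h a (b j) := by
  rw [mul_apply, Finset.sum_eq_single (i, j)]
  · rw [wedgeAux, dif_pos h, Pi.single_eq_same]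
  · rintro ⟨i', j'⟩ hp hne
    have hp' : i' + j' = k := Finset.HasAntidiagonal.mem_antidiagonal.1 hp
    have hi : i' ≠ i := by
      rintro rfl
      exact hne (by rw [show j' = j by omega])
    rw [wedgeAux, dif_pos hp', Pi.single_eq_of_ne hi]
    have := wedgeAlt_smul_left hp' (0 : ℂ) 0 (b j')
    rwa [smul_zero, zero_smul] at this
  · intro hn
    exact absurd (Finset.HasAntidiagonal.mem_antidiagonal.2 h) hn

theorem single_mul_apply_of_lt {i k : ℕ} (h : k < i) (a : CAlt V i) (b : Gr V) :
    mul (Pi.single i a) b k = 0 := by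
  rw [mul_apply]
  refine Finset.sum_eq_zero ?_
  rintro ⟨i', j'⟩ hp
  have hp' : i' + j' = k := Finset.HasAntidiagonal.mem_antidiagonal.1 hp
  have hi : i' ≠ i := by omega
  rw [wedgeAux, dif_pos hp', Pi.single_eq_of_ne hi]
  have := wedgeAlt_smul_left hp' (0 : ℂ) 0 (b j')
  rwa [smul_zero, zero_smul] at this

theorem single_mul_single {i j k : ℕ} (h : i + j = k) (a : CAlt V i) (b : CAlt V j) :
    mul (Pi.single i a) (Pi.single j b) = Pi.single k (wedgeAlt h a b) := by
  have h0 : ∀ {l m n : ℕ} (h : l + m = n) (a : CAlt V l), wedgeAlt h a (0 : CAlt V m) = 0 := by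
    intro l m n h a
    have := wedgeAlt_smul_right h (0 : ℂ) a 0
    rwa [smul_zero, zero_smul] at this
  funext l
  by_cases hl : i ≤ l
  · obtain ⟨m, rfl⟩ := Nat.exists_eq_add_of_le hl
    rw [single_mul_apply rfl]
    by_cases hm : m = j
    · subst hm
      subst h
      rw [Pi.single_eq_same, Pi.single_eq_same]
    · rw [Pi.single_eq_of_ne hm, Pi.single_eq_of_ne (by omega), h0]
  · rw [single_mul_apply_of_lt (by omega), Pi.single_eq_of_ne (by omega)]

/-- The constant function `1`, as a form of degree `0`. -/
def one : Gr V := Pi.single 0 (ContinuousAlternatingMap.constOfIsEmpty ℝ V (Fin 0) 1)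

theorem contr_single_zero (v : V) (a : CAlt V 0) : contr v (Pi.single 0 a : Gr V) = 0 := by
  funext k
  rw [contr_apply, Pi.single_eq_of_ne (by omega)]
  simp

theorem one_mul (a : Gr V) : mul one a = a := by
  funext k
  induction k generalizing a with
  | zero =>
    apply apply_zero_ext
    rw [mul_apply_zero]
    simp [one]
  | succ k ih =>
    refine apply_succ_ext fun v => ?_
    have h : eps (one : Gr V) = one := by
      funext k
      rcases k with _ | k
      · simp [eps_apply]
      · simp [eps_apply, one]
    rw [contr_mul, h, one, contr_single_zero, map_zero, LinearMap.zero_apply, zero_add]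
    exact ih _

theorem eps_single (i : ℕ) (a : CAlt V i) :
    eps (Pi.single i a : Gr V) = (-1 : ℂ) ^ i • Pi.single i a := by
  funext k
  rw [eps_apply, Pi.smul_apply]
  by_cases h : k = i
  · rw [h]
  · rw [Pi.single_eq_of_ne h, smul_zero, smul_zero]

theorem contr_single_succ (v : V) (i : ℕ) (a : CAlt V (i + 1)) :
    contr v (Pi.single (i + 1) a : Gr V) = Pi.single i (a.curryLeft v) := by
  funext k
  rw [contr_apply]
  by_cases h : k = i
  · subst h
    rw [Pi.single_eq_same, Pi.single_eq_same]
  · rw [Pi.single_eq_of_ne h, Pi.single_eq_of_ne (by omega)]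
    simp

end Gr

end

section

/-! ### Contractions of types `(-1, 0)` and `(0, -1)`, types of forms -/

namespace Gr

variable {V : Type*} [NormedAddCommGroup V] [NormedSpace ℂ V]
  {W : Type*} [NormedAddCommGroup W] [NormedSpace ℂ W]

/-- The part of type `(-1, 0)` of the contraction with a vector. -/
def contrHol (v : V) : Gr V →ₗ[ℂ] Gr V :=
  (1 / 2 : ℂ) • (contr v - Complex.I • contr (Complex.I • v))

/-- The part of type `(0, -1)` of the contraction with a vector. -/
def contrAnti (v : V) : Gr V →ₗ[ℂ] Gr V :=
  (1 / 2 : ℂ) • (contr v + Complex.I • contr (Complex.I • v))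

theorem contrHol_apply (v : V) (a : Gr V) :
    contrHol v a = (1 / 2 : ℂ) • (contr v a - Complex.I • contr (Complex.I • v) a) := rfl

theorem contrAnti_apply (v : V) (a : Gr V) :
    contrAnti v a = (1 / 2 : ℂ) • (contr v a + Complex.I • contr (Complex.I • v) a) := rfl

theorem contrHol_add_contrAnti (v : V) (a : Gr V) : contrHol v a + contrAnti v a = contr v a := by
  rw [contrHol_apply, contrAnti_apply]
  module

theorem contr_complex_smul (c : ℂ) (v : V) (a : Gr V) :
    contr (c • v) a = (c.re : ℂ) • contr v a + (c.im : ℂ) • contr (Complex.I • v) a := by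
  have h : c • v = c.re • v + c.im • (Complex.I • v) := by
    conv_lhs => rw [← Complex.re_add_im c]
    rw [add_smul, mul_smul, Complex.coe_smul, Complex.coe_smul]
  rw [h, contr_add_vec, contr_smul_vec, contr_smul_vec]

theorem contr_I_smul_I_smul (v : V) (a : Gr V) :
    contr (Complex.I • Complex.I • v) a = -contr v a := by
  rw [smul_smul, Complex.I_mul_I, contr_complex_smul]
  simp

/-- Contraction depends only real-linearly on the vector, the forms being real-multilinear. Its
complex-linear part in the vector can be expanded in a complex basis. -/
theorem contrHol_smul (c : ℂ) (v : V) (a : Gr V) : contrHol (c • v) a = c • contrHol v a := by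
  rw [contrHol_apply, contrHol_apply, smul_comm Complex.I c v, contr_complex_smul c v,
    contr_complex_smul c (Complex.I • v), contr_I_smul_I_smul]
  conv_rhs => rw [← Complex.re_add_im c]
  have hI : ((c.im : ℂ) * Complex.I) * Complex.I = -(c.im : ℂ) := by
    rw [_root_.mul_assoc, Complex.I_mul_I, mul_neg, mul_one]
  have : ((c.im : ℂ) * Complex.I) • (Complex.I • contr (Complex.I • v) a) =
      -((c.im : ℂ) • contr (Complex.I • v) a) := by rw [smul_smul, hI, neg_smul]
  rw [smul_comm _ (1 / 2 : ℂ), add_smul, smul_sub ((c.im : ℂ) * Complex.I), this]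
  module

theorem contrAnti_smul (c : ℂ) (v : V) (a : Gr V) :
    contrAnti (c • v) a = conj c • contrAnti v a := by
  rw [contrAnti_apply, contrAnti_apply, smul_comm Complex.I c v, contr_complex_smul c v,
    contr_complex_smul c (Complex.I • v), contr_I_smul_I_smul]
  have hc : conj c = (c.re : ℂ) - c.im * Complex.I := by
    conv_lhs => rw [← Complex.re_add_im c]
    rw [map_add, map_mul, Complex.conj_I, Complex.conj_ofReal, Complex.conj_ofReal, mul_neg,
      sub_eq_add_neg]
  have hI : ((c.im : ℂ) * Complex.I) * Complex.I = -(c.im : ℂ) := by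
    rw [_root_.mul_assoc, Complex.I_mul_I, mul_neg, mul_one]
  have : ((c.im : ℂ) * Complex.I) • (Complex.I • contr (Complex.I • v) a) =
      -((c.im : ℂ) • contr (Complex.I • v) a) := by rw [smul_smul, hI, neg_smul]
  rw [hc, smul_comm _ (1 / 2 : ℂ), sub_smul, smul_add ((c.im : ℂ) * Complex.I), this]
  module

theorem contrHol_add_vec (v w : V) (a : Gr V) :
    contrHol (v + w) a = contrHol v a + contrHol w a := by
  simp only [contrHol_apply, smul_add, contr_add_vec]
  module

theorem contrHol_sum_smul {ι : Type*} (s : Finset ι) (c : ι → ℂ) (v : ι → V) (a : Gr V) :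
    contrHol (∑ i ∈ s, c i • v i) a = ∑ i ∈ s, c i • contrHol (v i) a := by
  let f : V →+ Gr V := AddMonoidHom.mk' (fun v => contrHol v a) fun v w => contrHol_add_vec v w a
  have := map_sum f (fun i => c i • v i) s
  refine this.trans (Finset.sum_congr rfl fun i _ => contrHol_smul _ _ _)

theorem contrHol_mul (v : V) (a b : Gr V) :
    contrHol v (mul a b) = mul (contrHol v a) b + mul (eps a) (contrHol v b) := by
  simp only [contrHol_apply, contr_mul, map_smul, map_sub, LinearMap.smul_apply,
    LinearMap.sub_apply]
  module

theorem contrAnti_mul (v : V) (a b : Gr V) :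
    contrAnti v (mul a b) = mul (contrAnti v a) b + mul (eps a) (contrAnti v b) := by
  simp only [contrAnti_apply, contr_mul, map_smul, map_add, LinearMap.smul_apply,
    LinearMap.add_apply]
  module

theorem contrHol_eps (v : V) (a : Gr V) : contrHol v (eps a) = -eps (contrHol v a) := by
  simp only [contrHol_apply, contr_eps, map_smul, map_sub]
  module

theorem contrHol_contrHol (v w : V) (a : Gr V) :
    contrHol v (contrHol w a) = -contrHol w (contrHol v a) := by
  simp only [contrHol_apply, map_smul, map_sub]
  rw [contr_contr v w, contr_contr v (Complex.I • w), contr_contr (Complex.I • v) w,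
    contr_contr (Complex.I • v) (Complex.I • w)]
  module

theorem contrAnti_contrHol (v w : V) (a : Gr V) :
    contrAnti v (contrHol w a) = -contrHol w (contrAnti v a) := by
  simp only [contrHol_apply, contrAnti_apply, map_smul, map_sub, map_add]
  rw [contr_contr v w, contr_contr v (Complex.I • w), contr_contr (Complex.I • v) w,
    contr_contr (Complex.I • v) (Complex.I • w)]
  module

theorem contrHol_self (v : V) (a : Gr V) : contrHol v (contrHol v a) = 0 := by
  have h := contrHol_contrHol v v a
  have h2 : (2 : ℂ) • contrHol v (contrHol v a) = 0 := by
    rw [two_smul]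
    nth_rewrite 1 [h]
    exact neg_add_cancel _
  exact (smul_eq_zero.1 h2).resolve_left two_ne_zero

/-- The action of a complex scalar on forms, by multiplication of all the arguments. -/
def rot (c : ℂ) : Gr V →ₗ[ℂ] Gr V :=
  pull ((c • ContinuousLinearMap.id ℂ V).restrictScalars ℝ)

theorem rot_apply (c : ℂ) (a : Gr V) (k : ℕ) (v : Fin k → V) :
    rot c a k v = a k (fun t => c • v t) := rfl

theorem contr_rot (c : ℂ) (v : V) (a : Gr V) : contr v (rot c a) = rot c (contr (c • v) a) :=
  contr_pull _ _ _

/-- Complex linearity in the vector produces the factor c. This is why the contraction lowers the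
first index of the type by one and keeps the second. -/
theorem contrHol_rot (c : ℂ) (v : V) (a : Gr V) :
    contrHol v (rot c a) = c • rot c (contrHol v a) := by
  rw [← map_smul, ← contrHol_smul, contrHol_apply, contrHol_apply, contr_rot, contr_rot,
    smul_comm c Complex.I v]
  simp only [map_smul, map_sub]

theorem contrAnti_rot (c : ℂ) (v : V) (a : Gr V) :
    contrAnti v (rot c a) = conj c • rot c (contrAnti v a) := by
  rw [← map_smul, ← contrAnti_smul, contrAnti_apply, contrAnti_apply, contr_rot, contr_rot,
    smul_comm c Complex.I v]
  simp only [map_smul, map_add]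

/-- A family of forms is of type `(p, q)`, where `p` and `q` are allowed to be negative. -/
def IsType (p q : ℤ) (a : Gr V) : Prop :=
  ∀ c : ℂ, c ≠ 0 → rot c a = (c ^ p * conj c ^ q) • a

theorem conj_ne_zero {c : ℂ} (hc : c ≠ 0) : conj c ≠ 0 := (map_ne_zero _).2 hc

theorem IsType.contrHol {p q : ℤ} {a : Gr V} (h : IsType p q a) (v : V) :
    IsType (p - 1) q (contrHol v a) := by
  intro c hc
  have h1 := contrHol_rot c v a
  rw [h c hc, map_smul] at h1
  rw [← inv_smul_smul₀ hc (rot c _), ← h1, smul_smul, zpow_sub_one₀ hc]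
  congr 1
  ring

theorem IsType.contrAnti {p q : ℤ} {a : Gr V} (h : IsType p q a) (v : V) :
    IsType p (q - 1) (contrAnti v a) := by
  intro c hc
  have h1 := contrAnti_rot c v a
  have hc' := conj_ne_zero hc
  rw [h c hc, map_smul] at h1
  rw [← inv_smul_smul₀ hc' (rot c _), ← h1, smul_smul, zpow_sub_one₀ hc']
  congr 1
  ring

theorem IsType.mul {p q p' q' : ℤ} {a b : Gr V} (h : IsType p q a) (h' : IsType p' q' b) :
    IsType (p + p') (q + q') (mul a b) := by
  intro c hc
  have hc' := conj_ne_zero hc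
  rw [rot, pull_mul, ← rot, h c hc, h' c hc, map_smul, map_smul, LinearMap.smul_apply, smul_smul,
    zpow_add₀ hc, zpow_add₀ hc']
  congr 1
  ring

theorem IsType.smul {p q : ℤ} {a : Gr V} (h : IsType p q a) (z : ℂ) : IsType p q (z • a) := by
  intro c hc
  rw [map_smul, h c hc, smul_comm]

theorem IsType.add {p q : ℤ} {a b : Gr V} (h : IsType p q a) (h' : IsType p q b) :
    IsType p q (a + b) := by
  intro c hc
  rw [map_add, h c hc, h' c hc, smul_add]

theorem IsType.sum {ι : Type*} {s : Finset ι} {p q : ℤ} {a : ι → Gr V}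
    (h : ∀ i ∈ s, IsType p q (a i)) : IsType p q (∑ i ∈ s, a i) := by
  intro c hc
  rw [map_sum, Finset.smul_sum]
  exact Finset.sum_congr rfl fun i hi => h i hi c hc

theorem exists_zpow_mul_conj_zpow_ne_one {p q : ℤ} (h : p ≠ 0) :
    ∃ c : ℂ, c ≠ 0 ∧ c ^ p * conj c ^ q ≠ 1 := by
  by_cases hpq : p + q = 0
  · obtain rfl : q = -p := by omega
    -- On the antidiagonal q = -p real scalars see nothing. This c has c^p = i, so c^p c̄^(-p) = i /
    -- (-i) = -1.
    refine ⟨Complex.exp ((Real.pi / (2 * p) : ℝ) * Complex.I), Complex.exp_ne_zero _, ?_⟩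
    have hp : (p : ℂ) ≠ 0 := by exact_mod_cast h
    have h1 : Complex.exp ((Real.pi / (2 * p) : ℝ) * Complex.I) ^ p = Complex.I := by
      rw [← Complex.exp_int_mul]
      refine Eq.trans (congrArg Complex.exp ?_) Complex.exp_pi_div_two_mul_I
      push_cast
      field_simp
    rw [zpow_neg, ← map_zpow₀, h1, Complex.conj_I, inv_neg, Complex.inv_I, neg_neg,
      Complex.I_mul_I]
    norm_num
  · refine ⟨2, two_ne_zero, ?_⟩
    have h2 : conj (2 : ℂ) = 2 := Complex.conj_ofNat 2
    rw [h2, ← zpow_add₀ two_ne_zero]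
    intro h3
    have h4 : (2 : ℝ) ^ (p + q) = 1 := by
      apply Complex.ofReal_injective
      push_cast
      exact h3
    exact hpq ((zpow_eq_one_iff_right₀ (by norm_num) (by norm_num)).1 h4)

/-- Scalars act trivially on a form without arguments, so every eigenvalue c^p c̄^q would have to be
1. -/
theorem IsType.apply_zero {p q : ℤ} {a : Gr V} (h : IsType p q a) (hp : p ≠ 0) : a 0 = 0 := by
  obtain ⟨c, hc, hne⟩ := exists_zpow_mul_conj_zpow_ne_one (q := q) hp
  apply apply_zero_ext
  have h1 := congrArg (fun f => f 0 0) (h c hc)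
  simp only [rot_apply, Pi.smul_apply, ContinuousAlternatingMap.smul_apply, smul_eq_mul] at h1
  rw [Subsingleton.elim (fun t : Fin 0 => c • (0 : Fin 0 → V) t) 0] at h1
  have h2 : (c ^ p * conj c ^ q - 1) * a 0 0 = 0 := by
    rw [sub_mul, ← h1, _root_.one_mul, sub_self]
  exact (mul_eq_zero.1 h2).resolve_left (sub_ne_zero.2 hne)

/-- The `1`-form of type `(1, 0)` given by a complex-linear functional. -/
def holForm (l : V →L[ℂ] ℂ) : Gr V :=
  Pi.single 1 (ContinuousAlternatingMap.ofSubsingleton ℝ V ℂ (0 : Fin 1) (l.restrictScalars ℝ))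

theorem contr_holForm (v : V) (l : V →L[ℂ] ℂ) : contr v (holForm l) = l v • one := by
  rw [holForm, contr_single_succ, one, ← Pi.single_smul]
  congr 1
  ext w
  simp

theorem contrHol_holForm (v : V) (l : V →L[ℂ] ℂ) : contrHol v (holForm l) = l v • one := by
  rw [contrHol_apply, contr_holForm, contr_holForm, map_smul, smul_eq_mul, smul_smul,
    ← _root_.mul_assoc, Complex.I_mul_I]
  module

theorem contrAnti_holForm (v : V) (l : V →L[ℂ] ℂ) : contrAnti v (holForm l) = 0 := by
  rw [contrAnti_apply, contr_holForm, contr_holForm, map_smul, smul_eq_mul, smul_smul,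
    ← _root_.mul_assoc, Complex.I_mul_I]
  module

theorem eps_holForm (l : V →L[ℂ] ℂ) : eps (holForm l) = -holForm l := by
  rw [holForm, eps_single]
  simp

theorem holForm_mul_anticomm (l m : V →L[ℂ] ℂ) :
    mul (holForm l) (holForm m) = -mul (holForm m) (holForm l) := by
  rw [mul_comm_of_odd (eps_holForm l), eps_holForm, map_neg, LinearMap.neg_apply]

/-! ### The number operator -/

section Number

theorem sum_coord_smul_contrHol {ι : Type*} [Fintype ι] (b : Module.Basis ι ℂ V) (v : V) (a : Gr V) :
    ∑ i, b.coord i v • contrHol (b i) a = contrHol v a := by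
  rw [← contrHol_sum_smul]
  congr 2
  exact b.sum_repr v

variable [FiniteDimensional ℂ V] {ι : Type*} [Fintype ι] (b : Module.Basis ι ℂ V)

/-- The coordinate functionals of a basis, as forms of type `(1, 0)`. -/
def coordForm {ι : Type*} (b : Module.Basis ι ℂ V) (i : ι) : Gr V := holForm (LinearMap.toContinuousLinearMap (b.coord i))

/-- The operator multiplying by `p` the part of type `dz_i ∧ (⋯)` of a form. -/
def numAt {ι : Type*} (b : Module.Basis ι ℂ V) (i : ι) : Module.End ℂ (Gr V) := mul (coordForm b i) ∘ₗ contrHol (b i)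

/-- The number operator, acting on forms of type `(p, q)` by multiplication by `p`. -/
def num : Module.End ℂ (Gr V) := ∑ i, numAt b i

theorem num_apply (a : Gr V) : num b a = ∑ i, mul (coordForm b i) (contrHol (b i) a) := by
  simp [num, numAt]

theorem contrHol_coordForm {ι : Type*} (b : Module.Basis ι ℂ V) [DecidableEq ι] (i j : ι) :
    contrHol (b i) (coordForm b j) = (if i = j then (1 : ℂ) else 0) • one := by
  rw [coordForm, contrHol_holForm]
  simp [Finsupp.single_apply]

/-- The commutator of ι_v with ∑ dz_i ∧ ι_{b_i} is ∑ dz_i(v) ι_{b_i} = ι_v. -/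
theorem contrHol_num (v : V) (a : Gr V) :
    contrHol v (num b a) = contrHol v a + num b (contrHol v a) := by
  simp only [num_apply, map_sum, contrHol_mul, Finset.sum_add_distrib]
  refine congrArg₂ (· + ·) ?_ ?_
  · rw [← sum_coord_smul_contrHol b v a]
    refine Finset.sum_congr rfl fun i _ => ?_
    rw [coordForm, contrHol_holForm, map_smul, LinearMap.smul_apply, one_mul,
      LinearMap.coe_toContinuousLinearMap']
  · refine Finset.sum_congr rfl fun i _ => ?_
    rw [coordForm, eps_holForm, contrHol_contrHol v, map_neg, map_neg, LinearMap.neg_apply, neg_neg]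

theorem contrAnti_num (v : V) (a : Gr V) : contrAnti v (num b a) = num b (contrAnti v a) := by
  simp only [num_apply, map_sum, contrAnti_mul]
  refine Finset.sum_congr rfl fun i _ => ?_
  rw [coordForm, contrAnti_holForm, eps_holForm, contrAnti_contrHol v, map_neg, map_neg,
    LinearMap.neg_apply, neg_neg, map_zero, LinearMap.zero_apply, zero_add]

/-- Induction on the degree. The (-1, 0)-contraction has first index p - 1 and its commutator with
`num` supplies the missing 1; the (0, -1)-contraction keeps p and commutes with `num`. In degree 0
both sides vanish. -/
theorem num_apply_of_isType {p q : ℤ} {a : Gr V} (h : IsType p q a) : num b a = (p : ℂ) • a := by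
  funext k
  induction k generalizing p q a with
  | zero =>
    have h0 : num b a 0 = 0 := by
      apply apply_zero_ext
      rw [num_apply, Finset.sum_apply, ContinuousAlternatingMap.sum_apply]
      refine Finset.sum_eq_zero fun i _ => ?_
      rw [mul_apply_zero, coordForm, holForm, Pi.single_eq_of_ne (by norm_num)]
      simp
    rw [h0, Pi.smul_apply]
    by_cases hp : p = 0
    · rw [hp, Int.cast_zero, zero_smul]
    · rw [h.apply_zero hp, smul_zero]
  | succ k ih =>
    refine apply_succ_ext fun v => ?_
    rw [← contrHol_add_contrAnti v (num b a), contrHol_num, contrAnti_num, Pi.add_apply,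
      Pi.add_apply, ih (h.contrHol v), ih (h.contrAnti v), ← contrHol_add_contrAnti]
    simp only [map_smul, Pi.add_apply, Pi.smul_apply]
    push_cast
    module

theorem numAt_mul_self {ι : Type*} (b : Module.Basis ι ℂ V) (i : ι) : numAt b i * numAt b i = numAt b i := by
  classical
  ext1 a
  change mul (coordForm b i) (contrHol (b i) (mul (coordForm b i) (contrHol (b i) a))) =
    mul (coordForm b i) (contrHol (b i) a)
  rw [contrHol_mul, contrHol_coordForm, if_pos rfl, one_smul, one_mul, contrHol_self, map_zero,
    add_zero]

theorem numAt_commute {ι : Type*} (b : Module.Basis ι ℂ V) (i j : ι) : Commute (numAt b i) (numAt b j) := by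
  classical
  rcases eq_or_ne i j with rfl | hij
  · exact Commute.refl _
  have key : ∀ i j : ι, i ≠ j → ∀ a, numAt b i (numAt b j a) =
      -mul (mul (coordForm b i) (coordForm b j)) (contrHol (b i) (contrHol (b j) a)) := by
    intro i j hij a
    change mul (coordForm b i) (contrHol (b i) (mul (coordForm b j) (contrHol (b j) a))) = _
    rw [contrHol_mul, contrHol_coordForm, if_neg hij, zero_smul, map_zero, LinearMap.zero_apply,
      zero_add, coordForm, coordForm, eps_holForm, map_neg, LinearMap.neg_apply, map_neg, mul_assoc]
  refine LinearMap.ext fun a => ?_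
  rw [Module.End.mul_apply, Module.End.mul_apply, key i j hij, key j i hij.symm,
    contrHol_contrHol (b i), coordForm, coordForm, holForm_mul_anticomm, map_neg, map_neg,
    LinearMap.neg_apply, neg_neg]

/-- A sum of N commuting idempotents has eigenvalues only in {0, …, N}. For one of them, Q i, the
vector Q i x is an eigenvector of the remaining sum for z - 1, hence zero; then x itself is an
eigenvector of the remaining sum for z. -/
theorem eq_zero_of_sum_idempotents {κ M : Type*} [AddCommGroup M] [Module ℂ M] (s : Finset κ)
    (Q : κ → Module.End ℂ M) (hQ : ∀ i, Q i * Q i = Q i) (hc : ∀ i j, Commute (Q i) (Q j))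
    (z : ℂ) (hz : ∀ m : ℕ, m ≤ s.card → z ≠ m) (x : M) (hx : (∑ i ∈ s, Q i) x = z • x) :
    x = 0 := by
  classical
  induction s using Finset.induction_on generalizing z x with
  | empty =>
    rw [Finset.sum_empty, LinearMap.zero_apply] at hx
    exact (smul_eq_zero.1 hx.symm).resolve_left (by simpa using hz 0 (by simp))
  | insert i s his ih =>
    rw [Finset.sum_insert his, LinearMap.add_apply] at hx
    rw [Finset.card_insert_of_notMem his] at hz
    have hcomm : ∀ y, Q i ((∑ j ∈ s, Q j) y) = (∑ j ∈ s, Q j) (Q i y) := fun y => by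
      have : Commute (Q i) (∑ j ∈ s, Q j) := Commute.sum_right _ _ _ fun j _ => hc i j
      exact congrArg (fun f : Module.End ℂ M => f y) this.eq
    have hid : ∀ y, Q i (Q i y) = Q i y := fun y =>
      congrArg (fun f : Module.End ℂ M => f y) (hQ i)
    have h1 : Q i x = 0 := by
      refine ih (z - 1) (fun m hm h => hz (m + 1) (by omega) ?_) (Q i x) ?_
      · rw [sub_eq_iff_eq_add] at h
        rw [h]
        push_cast
        rfl
      · have := congrArg (Q i) hx
        rw [map_add, hid, hcomm, map_smul] at this
        rw [sub_smul, one_smul, ← this]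
        abel
    rw [h1, zero_add] at hx
    exact ih z (fun m hm => hz m (by omega)) x hx

/-- The number operator acts by p, yet it is a sum of dim V commuting idempotents. This replaces the
usual argument with a basis of the exterior algebra. -/
theorem IsType.eq_zero (b : Module.Basis ι ℂ V) {p q : ℤ} {a : Gr V} (h : IsType p q a)
    (hp : p < 0 ∨ (Fintype.card ι : ℤ) < p) : a = 0 := by
  refine eq_zero_of_sum_idempotents Finset.univ (numAt b) (numAt_mul_self b) (numAt_commute b)
    (p : ℂ) (fun m hm hpm => ?_) a (num_apply_of_isType b h)
  have h1 : p = (m : ℤ) := by exact_mod_cast hpm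
  rw [Finset.card_univ] at hm
  omega

end Number

end Gr

end

section

/-! ### The Lefschetz operator of a symplectic form and its adjoint -/

namespace Gr

variable {V : Type*} [NormedAddCommGroup V] [NormedSpace ℂ V]

/-- The contraction `∑ i, ι_{f i} ι_{e i}` of bidegree `(-2, 0)` with a bivector. -/
def lam {ι : Type*} [Fintype ι] (e f : ι → V) : Module.End ℂ (Gr V) :=
  ∑ i, contrHol (f i) ∘ₗ contrHol (e i)

theorem lam_apply {ι : Type*} [Fintype ι] (e f : ι → V) (a : Gr V) :
    lam e f a = ∑ i, contrHol (f i) (contrHol (e i) a) := by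
  simp [lam]

theorem IsType.lam {ι : Type*} [Fintype ι] (e f : ι → V) {p q : ℤ} {a : Gr V}
    (h : IsType p q a) : IsType (p - 2) q (lam e f a) := by
  rw [lam_apply]
  refine IsType.sum fun i _ => ?_
  have := (h.contrHol (e i)).contrHol (f i)
  rwa [sub_sub, one_add_one_eq_two] at this

theorem IsType.lam_pow {ι : Type*} [Fintype ι] {p q : ℤ} {a : Gr V} (e f : ι → V) (ha : IsType p q a) (r : ℕ) :
    IsType (p - 2 * r) q ((Gr.lam e f ^ r) a) := by
  induction r with
  | zero => simpa using ha
  | succ r ih =>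
    rw [pow_succ', Module.End.mul_apply]
    have := ih.lam e f
    convert this using 1
    push_cast
    ring

/-- The basis dual to `b` with respect to the bilinear form with matrix `M`. -/
def dualVec {ι : Type*} [Fintype ι] [DecidableEq ι] (b : ι → V) (M : Matrix ι ι ℂ) (i : ι) : V :=
  ∑ l, M⁻¹ i l • b l

section SymplecticMatrix

variable [FiniteDimensional ℂ V] {ι : Type*} [Fintype ι] [DecidableEq ι]
  (b : Module.Basis ι ℂ V) (M : Matrix ι ι ℂ) (s : Gr V)

/-- The form `s` of type `(2, 0)` has the matrix `M` in the basis `b`, and `M` is invertible and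
antisymmetric. -/
structure IsSymplecticMatrix : Prop where
  type : IsType 2 0 s
  even : eps s = s
  contr : ∀ l, contrHol (b l) s = ∑ j, M l j • coordForm b j
  det : IsUnit M.det
  antisymm : M.transpose = -M

variable {b M s}

namespace IsSymplecticMatrix

theorem contrHol_dualVec (h : IsSymplecticMatrix b M s) (i : ι) :
    contrHol (dualVec b M i) s = coordForm b i := by
  rw [dualVec, contrHol_sum_smul]
  simp only [h.contr, Finset.smul_sum, smul_smul]
  rw [Finset.sum_comm]
  simp only [← Finset.sum_smul]
  have h1 : ∀ j, ∑ l, M⁻¹ i l * M l j = (1 : Matrix ι ι ℂ) i j := fun j => by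
    rw [← Matrix.nonsing_inv_mul M h.det, Matrix.mul_apply]
  simp only [h1, Matrix.one_apply, ite_smul, one_smul, zero_smul]
  simp

theorem sum_smul_dualVec (h : IsSymplecticMatrix b M s) (j : ι) :
    ∑ i, M i j • dualVec b M i = -b j := by
  simp only [dualVec, Finset.smul_sum, smul_smul]
  rw [Finset.sum_comm]
  simp only [← Finset.sum_smul]
  have h1 : ∀ l, ∑ i, M i j * M⁻¹ i l = -(1 : Matrix ι ι ℂ) j l := fun l => by
    rw [← Matrix.mul_nonsing_inv M h.det, Matrix.mul_apply, ← Finset.sum_neg_distrib]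
    refine Finset.sum_congr rfl fun i _ => ?_
    have := congrFun (congrFun h.antisymm j) i
    rw [Matrix.transpose_apply, Matrix.neg_apply] at this
    rw [this]
    ring
  simp only [h1, Matrix.one_apply, neg_smul, ite_smul, one_smul, zero_smul]
  simp

/-- Insert ι_{b_i} s = ∑ M_ij dz_j and sum over i first: what remains is dz_j ∧ ι_{-b_j}, the minus
sign coming from the antisymmetry of M. -/
theorem sum_contrHol_mul (h : IsSymplecticMatrix b M s) (a : Gr V) :
    ∑ i, mul (contrHol (b i) s) (contrHol (dualVec b M i) a) = -num b a := by
  simp only [h.contr, map_sum, map_smul, LinearMap.sum_apply, LinearMap.smul_apply]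
  rw [Finset.sum_comm, num_apply, ← Finset.sum_neg_distrib]
  refine Finset.sum_congr rfl fun j _ => ?_
  simp only [← map_smul (mul (coordForm b j))]
  rw [← map_sum, ← map_neg]
  refine congrArg _ ?_
  rw [← contrHol_sum_smul, h.sum_smul_dualVec, ← neg_one_smul ℂ, contrHol_smul, neg_one_smul]

/-- The sl₂-commutator. For each i the Leibniz rule gives four terms. Both contractions on s give
-1, as ι_{f_i} ι_{b_i} s = -ι_{b_i} dz_i; each of the two mixed terms sums to the number operator;
both on a give s ∧ Λa. -/
theorem lam_mul (h : IsSymplecticMatrix b M s) (a : Gr V) :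
    lam b (dualVec b M) (mul s a) =
      mul s (lam b (dualVec b M) a) + (2 : ℂ) • num b a - (Fintype.card ι : ℂ) • a := by
  have h1 : ∀ i, contrHol (dualVec b M i) (contrHol (b i) (mul s a)) =
      -a - mul (contrHol (b i) s) (contrHol (dualVec b M i) a) +
        mul (coordForm b i) (contrHol (b i) a) +
        mul s (contrHol (dualVec b M i) (contrHol (b i) a)) := by
    intro i
    have he : eps (contrHol (b i) s) = -contrHol (b i) s := by
      rw [← neg_eq_iff_eq_neg, ← contrHol_eps, h.even]
    rw [contrHol_mul, map_add, contrHol_mul, h.even, contrHol_mul, h.even, he,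
      contrHol_contrHol (dualVec b M i) (b i) s, h.contrHol_dualVec, contrHol_coordForm, if_pos rfl,
      one_smul, map_neg, map_neg, LinearMap.neg_apply, LinearMap.neg_apply, one_mul]
    abel
  rw [lam_apply, Finset.sum_congr rfl fun i _ => h1 i, Finset.sum_add_distrib,
    Finset.sum_add_distrib, Finset.sum_sub_distrib, h.sum_contrHol_mul, ← num_apply, ← map_sum,
    ← lam_apply, Finset.sum_const, Finset.card_univ, ← Nat.cast_smul_eq_nsmul ℂ]
  module

theorem lam_mul_of_isType (h : IsSymplecticMatrix b M s) {p q : ℤ} {a : Gr V} (ha : IsType p q a) :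
    lam b (dualVec b M) (mul s a) =
      mul s (lam b (dualVec b M) a) + (2 * p - Fintype.card ι : ℂ) • a := by
  rw [h.lam_mul, num_apply_of_isType b ha]
  module

theorem isType_pow_mul (h : IsSymplecticMatrix b M s) {p q : ℤ} {a : Gr V} (ha : IsType p q a)
    (r : ℕ) : IsType (p + 2 * r) q ((mul s ^ r : Module.End ℂ (Gr V)) a) := by
  induction r with
  | zero => simpa using ha
  | succ r ih =>
    rw [pow_succ', Module.End.mul_apply]
    have := h.type.mul ih
    rw [zero_add] at this
    convert this using 1
    push_cast
    ring

variable {n : ℕ} {q : ℤ} {a : Gr V}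

/-- The commutators telescope. The start is Λa = 0, because its type would be (-1, q); passing from
r to r + 1 adds 2(2r + 3) - 2n to the scalar. -/
theorem lam_pow_mul (h : IsSymplecticMatrix b M s) (hn : Fintype.card ι = 2 * n)
    (ha : IsType 1 q a) (r : ℕ) :
    lam b (dualVec b M) ((mul s ^ (r + 1) : Module.End ℂ (Gr V)) a) =
      (2 * (r + 1) * (r + 1 - n) : ℂ) • (mul s ^ r : Module.End ℂ (Gr V)) a := by
  induction r with
  | zero =>
    rw [zero_add, pow_one, h.lam_mul_of_isType ha,
      (ha.lam b (dualVec b M)).eq_zero b (Or.inl (by norm_num)), map_zero, zero_add, hn]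
    simp only [pow_zero, Module.End.one_apply]
    push_cast
    module
  | succ r ih =>
    rw [pow_succ', Module.End.mul_apply, h.lam_mul_of_isType (h.isType_pow_mul ha (r + 1)), ih, hn,
      map_smul, ← Module.End.mul_apply, ← pow_succ']
    push_cast
    module

/-- The mirror image: now s ∧ a vanishes, because its type would be (2n + 1, q), and the same
scalars appear. -/
theorem mul_lam_pow (h : IsSymplecticMatrix b M s) (hn : Fintype.card ι = 2 * n)
    (ha : IsType (2 * n - 1) q a) (r : ℕ) :
    mul s ((lam b (dualVec b M) ^ (r + 1)) a) =
      (2 * (r + 1) * (r + 1 - n) : ℂ) • (lam b (dualVec b M) ^ r) a := by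
  have key : ∀ {p : ℤ} {x : Gr V}, IsType p q x → mul s (lam b (dualVec b M) x) =
      lam b (dualVec b M) (mul s x) - (2 * p - 2 * n : ℂ) • x := by
    intro p x hx
    rw [h.lam_mul_of_isType hx, hn]
    push_cast
    abel
  induction r with
  | zero =>
    rw [zero_add, pow_one, key ha, (h.type.mul ha).eq_zero b (Or.inr (by omega)), map_zero, zero_sub]
    simp only [pow_zero, Module.End.one_apply]
    push_cast
    module
  | succ r ih =>
    rw [pow_succ', Module.End.mul_apply, key (ha.lam_pow _ _ (r + 1)), ih, map_smul,
      ← Module.End.mul_apply, ← pow_succ']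
    push_cast
    module

theorem lam_pow_mul_pow (h : IsSymplecticMatrix b M s) (hn : Fintype.card ι = 2 * n)
    (ha : IsType 1 q a) (r : ℕ) :
    (lam b (dualVec b M) ^ r) ((mul s ^ r : Module.End ℂ (Gr V)) a) =
      (∏ t ∈ Finset.range r, (2 * (t + 1) * (t + 1 - n) : ℂ)) • a := by
  induction r with
  | zero => simp
  | succ r ih =>
    rw [pow_succ (lam b _), Module.End.mul_apply, h.lam_pow_mul hn ha, map_smul, ih, smul_smul,
      Finset.prod_range_succ, _root_.mul_comm]

theorem pow_mul_lam_pow (h : IsSymplecticMatrix b M s) (hn : Fintype.card ι = 2 * n)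
    (ha : IsType (2 * n - 1) q a) (r : ℕ) :
    (mul s ^ r : Module.End ℂ (Gr V)) ((lam b (dualVec b M) ^ r) a) =
      (∏ t ∈ Finset.range r, (2 * (t + 1) * (t + 1 - n) : ℂ)) • a := by
  induction r with
  | zero => simp
  | succ r ih =>
    rw [pow_succ (mul s), Module.End.mul_apply, h.mul_lam_pow hn ha, map_smul, ih, smul_smul,
      Finset.prod_range_succ, _root_.mul_comm]

end IsSymplecticMatrix

/-- The product stops at t = n - 2, just before the factor t + 1 - n becomes zero. -/
theorem prod_lefschetz_ne_zero (n : ℕ) :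
    ∏ t ∈ Finset.range (n - 1), (2 * (t + 1) * (t + 1 - n) : ℂ) ≠ 0 := by
  refine Finset.prod_ne_zero_iff.2 fun t ht => ?_
  have h1 : ((t : ℂ) + 1) ≠ 0 := Nat.cast_add_one_ne_zero t
  have h2 : ((t : ℂ) + 1 - n) ≠ 0 := by
    rw [sub_ne_zero]
    have := Finset.mem_range.1 ht
    exact_mod_cast (by omega : t + 1 ≠ n)
  exact mul_ne_zero (mul_ne_zero two_ne_zero h1) h2

end SymplecticMatrix

end Gr

end

section

/-! ### Alternatization of linear maps into forms -/

section FiniteDimensional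

variable {V : Type*} [NormedAddCommGroup V] [NormedSpace ℂ V] [FiniteDimensional ℂ V]

/-- Makes linear maps between spaces of forms automatically continuous, so that degreewise linear
operations preserve smoothness without estimates. -/
instance instFiniteDimensionalCAlt (k : ℕ) : FiniteDimensional ℝ (CAlt V k) := by
  have : FiniteDimensional ℝ V := inferInstance
  exact FiniteDimensional.of_injective
    (ContinuousMultilinearMap.toMultilinearMapLinear ∘ₗ
      ContinuousAlternatingMap.toContinuousMultilinearMapLinear (R := ℝ) (A := ℝ) :
        CAlt V k →ₗ[ℝ] MultilinearMap ℝ (fun _ : Fin k => V) ℂ)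
    fun a b h => by
      ext v
      exact congrArg (fun f : MultilinearMap ℝ (fun _ : Fin k => V) ℂ => f v) h

end FiniteDimensional

namespace Gr

section Alternatization

variable {V : Type*} [NormedAddCommGroup V] [NormedSpace ℂ V]

instance instModuleReal : Module ℝ (Gr V) := Pi.module _ _ _
instance instIsScalarTower : IsScalarTower ℝ ℂ (Gr V) := inferInstance
instance instSMulCommClass : SMulCommClass ℝ ℂ (Gr V) := inferInstance
instance instAddCommGroupReal : AddCommGroup (V →ₗ[ℝ] Gr V) := LinearMap.addCommGroup
instance instModuleRealHom : Module ℂ (V →ₗ[ℝ] Gr V) := LinearMap.module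

variable [FiniteDimensional ℂ V]

/-- The component in degree `k` of a linear map into graded families. -/
def component (A : V →ₗ[ℝ] Gr V) (k : ℕ) : V →L[ℝ] CAlt V k :=
  LinearMap.toContinuousLinearMap (LinearMap.proj k ∘ₗ A)

/-- The alternatization of a linear map into graded families, of degree one. -/
def alt : (V →ₗ[ℝ] Gr V) →ₗ[ℂ] Gr V where
  toFun A k := match k with
    | 0 => 0
    | k + 1 => ContinuousAlternatingMap.alternatizeUncurryFin (component A k)
  map_add' A B := by
    funext k
    rcases k with _ | k
    · exact (add_zero (0 : AltMaps V ℂ 0)).symm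
    · exact ContinuousAlternatingMap.alternatizeUncurryFin_add (component A k) (component B k)
  map_smul' c A := by
    funext k
    rcases k with _ | k
    · exact (smul_zero (A := CAlt V 0) c).symm
    · exact ContinuousAlternatingMap.alternatizeUncurryFin_smul c (component A k)

theorem alt_zero (A : V →ₗ[ℝ] Gr V) : alt A 0 = 0 := rfl

theorem alt_succ_apply (A : V →ₗ[ℝ] Gr V) (k : ℕ) (v : Fin (k + 1) → V) :
    alt A (k + 1) v = ∑ i : Fin (k + 1), (-1) ^ (i : ℕ) • A (v i) k (i.removeNth v) :=
  ContinuousAlternatingMap.alternatizeUncurryFin_apply _ _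

/-- Composition of a linear map into graded families with an endomorphism. -/
def post (T : Gr V →ₗ[ℂ] Gr V) (A : V →ₗ[ℝ] Gr V) : V →ₗ[ℝ] Gr V := T.restrictScalars ℝ ∘ₗ A

theorem post_apply (T : Gr V →ₗ[ℂ] Gr V) (A : V →ₗ[ℝ] Gr V) (v : V) : post T A v = T (A v) := rfl

/-- An algebraic Cartan formula: in the alternating sum, `v` is either fed to `A` or to the values
of `A`. It lets the Leibniz rules below go by induction on the degree. -/
theorem contr_alt (v : V) (A : V →ₗ[ℝ] Gr V) : contr v (alt A) = A v - alt (post (contr v) A) := by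
  funext k
  ext w
  have h : contr v (alt A) k w = alt A (k + 1) (Fin.cons v w : Fin (k + 1) → V) := rfl
  rw [h, alt_succ_apply, Fin.sum_univ_succ]
  rcases k with _ | k
  · simp [alt_zero]
  · rw [Pi.sub_apply, ContinuousAlternatingMap.sub_apply, alt_succ_apply, sub_eq_add_neg,
      ← Finset.sum_neg_distrib]
    congr 1
    · simp
    · refine Finset.sum_congr rfl fun i _ => ?_
      have h1 : (i.succ.removeNth (Fin.cons v w : Fin (k + 2) → V)) =
          Fin.cons v (i.removeNth w) := by
        funext j
        refine Fin.cases ?_ (fun j => ?_) j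
        · simp [Fin.removeNth]
        · simp [Fin.removeNth]
      rw [h1, Fin.cons_succ, Fin.val_succ, pow_succ, mul_neg, mul_one, neg_smul]
      rfl

theorem alt_post_eps (A : V →ₗ[ℝ] Gr V) : alt (post eps A) = -eps (alt A) := by
  funext k
  rcases k with _ | k
  · rw [alt_zero, Pi.neg_apply, eps_apply, alt_zero, smul_zero, neg_zero]
  · ext v
    rw [Pi.neg_apply, ContinuousAlternatingMap.neg_apply, eps_apply,
      ContinuousAlternatingMap.smul_apply, alt_succ_apply, alt_succ_apply, Finset.smul_sum,
      ← Finset.sum_neg_distrib]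
    refine Finset.sum_congr rfl fun i _ => ?_
    rw [post_apply, eps_apply, ContinuousAlternatingMap.smul_apply, pow_succ, smul_comm]
    simp

/-- Right multiplication by a graded family. -/
def mulRight (b : Gr V) : Gr V →ₗ[ℂ] Gr V := mul.flip b

theorem mulRight_apply (a b : Gr V) : mulRight b a = mul a b := rfl

/-- With `alt_mul_left`, this is the Leibniz rule stripped of the derivative. It applies to any part
of the derivative, so it serves ∂ and ∂̄ alike. -/
theorem alt_mul_right (A : V →ₗ[ℝ] Gr V) (b : Gr V) :
    alt (post (mulRight b) A) = mul (alt A) b := by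
  funext k
  induction k generalizing A b with
  | zero =>
    apply apply_zero_ext
    rw [alt_zero, mul_apply_zero, alt_zero]
    simp
  | succ k ih =>
    refine apply_succ_ext fun v => ?_
    have h : post (contr v) (post (mulRight b) A) =
        post (mulRight b) (post (contr v) A) + post (mulRight (contr v b)) (post eps A) := by
      refine LinearMap.ext fun u => ?_
      rw [LinearMap.add_apply]
      exact contr_mul v (A u) b
    rw [contr_alt, contr_mul, contr_alt, h, map_add, Pi.sub_apply, Pi.add_apply, Pi.add_apply, ih,
      ih, alt_post_eps, map_neg, map_sub, LinearMap.sub_apply, LinearMap.neg_apply, Pi.neg_apply,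
      Pi.sub_apply, post_apply, mulRight_apply]
    abel

theorem alt_mul_left (a : Gr V) (B : V →ₗ[ℝ] Gr V) :
    alt (post (mul a) B) = mul (eps a) (alt B) := by
  funext k
  induction k generalizing a B with
  | zero =>
    apply apply_zero_ext
    rw [alt_zero, mul_apply_zero, alt_zero]
    simp
  | succ k ih =>
    refine apply_succ_ext fun v => ?_
    have h : post (contr v) (post (mul a) B) =
        post (mul (contr v a)) B + post (mul (eps a)) (post (contr v) B) := by
      refine LinearMap.ext fun u => ?_
      rw [LinearMap.add_apply]
      exact contr_mul v a (B u)
    rw [contr_alt, contr_mul, contr_alt, h, map_add, Pi.sub_apply, Pi.add_apply, Pi.add_apply, ih,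
      ih, contr_eps, map_neg, LinearMap.neg_apply, Pi.neg_apply, eps_eps, map_sub, Pi.sub_apply,
      post_apply]
    abel

/-- The complex-linear part of a real-linear map into graded families. -/
def linG (A : V →ₗ[ℝ] Gr V) : V →ₗ[ℝ] Gr V :=
  (1 / 2 : ℂ) • (A - Complex.I • A ∘ₗ (mulI V : V →ₗ[ℝ] V))

/-- The complex-antilinear part of a real-linear map into graded families. -/
def antG (A : V →ₗ[ℝ] Gr V) : V →ₗ[ℝ] Gr V :=
  (1 / 2 : ℂ) • (A + Complex.I • A ∘ₗ (mulI V : V →ₗ[ℝ] V))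

theorem linG_apply (A : V →ₗ[ℝ] Gr V) (v : V) :
    linG A v = (1 / 2 : ℂ) • (A v - Complex.I • A (Complex.I • v)) := rfl

theorem antG_apply (A : V →ₗ[ℝ] Gr V) (v : V) :
    antG A v = (1 / 2 : ℂ) • (A v + Complex.I • A (Complex.I • v)) := rfl

theorem linG_add_antG (A : V →ₗ[ℝ] Gr V) : linG A + antG A = A := by
  refine LinearMap.ext fun v => ?_
  rw [LinearMap.add_apply, linG_apply, antG_apply]
  module

theorem linG_add (A B : V →ₗ[ℝ] Gr V) : linG (A + B) = linG A + linG B := by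
  refine LinearMap.ext fun v => ?_
  simp only [LinearMap.add_apply, linG_apply]
  module

theorem antG_add (A B : V →ₗ[ℝ] Gr V) : antG (A + B) = antG A + antG B := by
  refine LinearMap.ext fun v => ?_
  simp only [LinearMap.add_apply, antG_apply]
  module

theorem linG_post (T : Gr V →ₗ[ℂ] Gr V) (A : V →ₗ[ℝ] Gr V) : linG (post T A) = post T (linG A) := by
  refine LinearMap.ext fun v => ?_
  simp only [post_apply, linG_apply, map_smul, map_sub]

theorem antG_post (T : Gr V →ₗ[ℂ] Gr V) (A : V →ₗ[ℝ] Gr V) : antG (post T A) = post T (antG A) := by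
  refine LinearMap.ext fun v => ?_
  simp only [post_apply, antG_apply, map_smul, map_add]

theorem apply_complex_smul (A : V →ₗ[ℝ] Gr V) (c : ℂ) (v : V) :
    A (c • v) = (c.re : ℂ) • A v + (c.im : ℂ) • A (Complex.I • v) := by
  have h : c • v = c.re • v + c.im • (Complex.I • v) := by
    conv_lhs => rw [← Complex.re_add_im c]
    rw [add_smul, mul_smul, Complex.coe_smul, Complex.coe_smul]
  rw [h, map_add, map_smul, map_smul, Complex.coe_smul, Complex.coe_smul]

theorem linG_apply_smul (A : V →ₗ[ℝ] Gr V) (c : ℂ) (v : V) : linG A (c • v) = c • linG A v := by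
  have hI : linG A (Complex.I • v) = Complex.I • linG A v := by
    rw [linG_apply, linG_apply, smul_smul, Complex.I_mul_I, neg_one_smul, map_neg, smul_neg,
      smul_comm Complex.I (1 / 2 : ℂ), smul_sub Complex.I, smul_smul Complex.I Complex.I,
      Complex.I_mul_I]
    module
  rw [apply_complex_smul, hI, smul_smul, ← add_smul, Complex.re_add_im]

theorem antG_apply_smul (A : V →ₗ[ℝ] Gr V) (c : ℂ) (v : V) :
    antG A (c • v) = conj c • antG A v := by
  have hI : antG A (Complex.I • v) = -Complex.I • antG A v := by
    rw [antG_apply, antG_apply, smul_smul, Complex.I_mul_I, neg_one_smul, map_neg, smul_neg,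
      smul_comm (-Complex.I) (1 / 2 : ℂ), smul_add (-Complex.I), smul_smul (-Complex.I) Complex.I,
      neg_mul, Complex.I_mul_I]
    module
  have hc : conj c = (c.re : ℂ) + c.im * -Complex.I := by
    conv_lhs => rw [← Complex.re_add_im c]
    rw [map_add, map_mul, Complex.conj_I, Complex.conj_ofReal, Complex.conj_ofReal]
  rw [apply_complex_smul, hI, smul_smul, ← add_smul, hc]

theorem rot_alt (c : ℂ) (A B : V →ₗ[ℝ] Gr V) (h : ∀ v, B v = rot c (A (c • v))) :
    rot c (alt A) = alt B := by
  funext k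
  ext v
  rw [rot_apply]
  rcases k with _ | k
  · rfl
  · rw [alt_succ_apply, alt_succ_apply]
    refine Finset.sum_congr rfl fun i _ => ?_
    rw [h]
    rfl

/-- The slot of the derivative is complex-linear and contributes c when all arguments are scaled.
Hence ∂ raises the first index of the type by one. -/
theorem rot_alt_linG (c : ℂ) (A : V →ₗ[ℝ] Gr V) :
    rot c (alt (linG A)) = c • alt (linG (post (rot c) A)) := by
  rw [← map_smul]
  refine rot_alt c _ _ fun v => ?_
  rw [linG_apply_smul, linG_post, LinearMap.smul_apply, post_apply, map_smul]

theorem rot_alt_antG (c : ℂ) (A : V →ₗ[ℝ] Gr V) :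
    rot c (alt (antG A)) = conj c • alt (antG (post (rot c) A)) := by
  rw [← map_smul]
  refine rot_alt c _ _ fun v => ?_
  rw [antG_apply_smul, antG_post, LinearMap.smul_apply, post_apply, map_smul]

theorem conjG_alt (A B : V →ₗ[ℝ] Gr V) (h : ∀ v, B v = conjG (A v)) :
    conjG (alt A) = alt B := by
  funext k
  ext v
  change conj (alt A k v) = _
  rcases k with _ | k
  · exact map_zero _
  · rw [alt_succ_apply, alt_succ_apply, map_sum]
    refine Finset.sum_congr rfl fun i _ => ?_
    rw [h, map_zsmul]
    rfl

theorem conjG_add (a b : Gr V) : conjG (a + b) = conjG a + conjG b := by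
  funext k
  ext v
  exact map_add conj _ _

theorem conjG_smul (c : ℂ) (a : Gr V) : conjG (c • a) = conj c • conjG a := by
  funext k
  ext v
  exact map_mul conj _ _

theorem conjG_conjG (a : Gr V) : conjG (conjG a) = a := by
  funext k
  ext v
  exact Complex.conj_conj _

theorem rot_conjG (c : ℂ) (a : Gr V) : rot c (conjG a) = conjG (rot c a) := rfl

theorem IsType.conjG {p q : ℤ} {a : Gr V} (h : IsType p q a) : IsType q p (conjG a) := by
  intro c hc
  rw [rot_conjG, h c hc, conjG_smul, map_mul, map_zpow₀, map_zpow₀, Complex.conj_conj,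
    _root_.mul_comm]

theorem conjG_alt_antG (A B : V →ₗ[ℝ] Gr V) (h : ∀ v, B v = Gr.conjG (A v)) :
    Gr.conjG (alt (antG A)) = alt (linG B) := by
  refine conjG_alt _ _ fun v => ?_
  rw [linG_apply, antG_apply, h, h, conjG_smul, conjG_add, conjG_smul, Complex.conj_I]
  simp only [map_div₀, map_one, Complex.conj_ofNat, neg_smul, sub_eq_add_neg]

end Alternatization

end Gr

end

section

/-! ### Smooth graded forms on open subsets of a vector space -/

namespace Gr

variable {V : Type*} [NormedAddCommGroup V] [NormedSpace ℂ V] [FiniteDimensional ℂ V]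

/-- The wedge product as a continuous bilinear map. -/
def wedgeAuxL (k i j : ℕ) : CAlt V i →L[ℝ] CAlt V j →L[ℝ] CAlt V k :=
  LinearMap.toContinuousBilinearMap <| LinearMap.mk₂ ℝ (wedgeAux k i j)
    (fun a a' b => by
      unfold wedgeAux
      split_ifs
      · exact wedgeAlt_add_left _ _ _ _
      · exact (add_zero 0).symm)
    (fun c a b => by
      unfold wedgeAux
      split_ifs with h
      · have := wedgeAlt_smul_left h (c : ℂ) a b
        rwa [Complex.coe_smul, Complex.coe_smul] at this
      · exact (smul_zero c).symm)
    (fun a b b' => by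
      unfold wedgeAux
      split_ifs
      · exact wedgeAlt_add_right _ _ _ _
      · exact (add_zero 0).symm)
    (fun c a b => by
      unfold wedgeAux
      split_ifs with h
      · have := wedgeAlt_smul_right h (c : ℂ) a b
        rwa [Complex.coe_smul, Complex.coe_smul] at this
      · exact (smul_zero c).symm)

theorem isBoundedBilinearMap_wedgeAux (k i j : ℕ) : IsBoundedBilinearMap ℝ
    (fun p : CAlt V i × CAlt V j => wedgeAux k i j p.1 p.2) :=
  ContinuousLinearMap.isBoundedBilinearMap (E := CAlt V i) (F := CAlt V j) (G := CAlt V k)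
    (wedgeAuxL k i j)

/-- Pointwise differentiability, degree by degree. -/
def DiffAt (τ : V → Gr V) (y : V) : Prop := ∀ k, DifferentiableAt ℝ (fun z => τ z k) y

/-- Smoothness, degree by degree. -/
def SmoothOn (τ : V → Gr V) (s : Set V) : Prop := ∀ k, ContDiffOn ℝ ∞ (fun z => τ z k) s

/-- The total derivative, degree by degree. -/
def dG (τ : V → Gr V) (y : V) : V →ₗ[ℝ] Gr V :=
  LinearMap.pi fun k => (fderiv ℝ (fun z => τ z k) y : V →ₗ[ℝ] CAlt V k)

theorem dG_apply (τ : V → Gr V) (y v : V) (k : ℕ) :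
    dG τ y v k = fderiv ℝ (fun z => τ z k) y v := rfl

/-- The exterior derivative on a vector space. -/
def extG (τ : V → Gr V) (y : V) : Gr V := alt (dG τ y)

/-- The operator `∂` on a vector space. -/
def delG (τ : V → Gr V) (y : V) : Gr V := alt (linG (dG τ y))

/-- The operator `∂̄` on a vector space. -/
def delbarG (τ : V → Gr V) (y : V) : Gr V := alt (antG (dG τ y))

theorem delG_add_delbarG (τ : V → Gr V) (y : V) : delG τ y + delbarG τ y = extG τ y := by
  rw [delG, delbarG, extG, ← map_add, linG_add_antG]

theorem delG_succ (τ : V → Gr V) (y : V) (k : ℕ) : delG τ y (k + 1) =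
    .alternatizeUncurryFin (linPart (fderiv ℝ (fun z => τ z k) y)) := rfl

theorem delbarG_succ (τ : V → Gr V) (y : V) (k : ℕ) : delbarG τ y (k + 1) =
    .alternatizeUncurryFin (antilinPart (fderiv ℝ (fun z => τ z k) y)) := rfl

theorem dG_congr {τ η : V → Gr V} {y : V} (h : ∀ᶠ z in nhds y, τ z = η z) : dG τ y = dG η y := by
  refine LinearMap.ext fun v => funext fun k => ?_
  have : (fun z => τ z k) =ᶠ[nhds y] fun z => η z k := h.mono fun z hz => congrFun hz k
  rw [dG_apply, dG_apply, this.fderiv_eq]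

theorem DiffAt.congr {τ η : V → Gr V} {y : V} (hτ : DiffAt τ y)
    (h : ∀ᶠ z in nhds y, η z = τ z) : DiffAt η y := fun k =>
  (hτ k).congr_of_eventuallyEq (h.mono fun _ hz => congrFun hz k)

theorem SmoothOn.diffAt {τ : V → Gr V} {s : Set V} (h : SmoothOn τ s) (hs : IsOpen s) {y : V}
    (hy : y ∈ s) : DiffAt τ y := fun k =>
  ((h k).differentiableOn (by simp)).differentiableAt (hs.mem_nhds hy)

theorem SmoothOn.congr {τ η : V → Gr V} {s : Set V} (h : SmoothOn τ s)
    (he : ∀ y ∈ s, η y = τ y) : SmoothOn η s := fun k =>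
  (h k).congr fun y hy => congrFun (he y hy) k

theorem fderiv_wedgeAux {τ η : V → Gr V} {y : V} (hτ : DiffAt τ y) (hη : DiffAt η y)
    (k i j : ℕ) :
    DifferentiableAt ℝ (fun z => wedgeAux k i j (τ z i) (η z j)) y ∧
    ∀ v, fderiv ℝ (fun z => wedgeAux k i j (τ z i) (η z j)) y v =
      wedgeAux k i j (dG τ y v i) (η y j) + wedgeAux k i j (τ y i) (dG η y v j) := by
  have h := ((isBoundedBilinearMap_wedgeAux (V := V) k i j).hasFDerivAt (τ y i, η y j)).comp y
    ((hτ i).hasFDerivAt.prodMk (hη j).hasFDerivAt)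
  refine ⟨h.differentiableAt, fun v => ?_⟩
  rw [add_comm]
  exact congrArg (fun f => f v) h.fderiv

theorem dG_mul {τ η : V → Gr V} {y : V} (hτ : DiffAt τ y) (hη : DiffAt η y) :
    dG (fun z => mul (τ z) (η z)) y =
      post (mulRight (η y)) (dG τ y) + post (mul (τ y)) (dG η y) := by
  refine LinearMap.ext fun v => funext fun k => ?_
  rw [dG_apply, LinearMap.add_apply, Pi.add_apply, post_apply, post_apply,
    mulRight_apply, mul_apply, mul_apply]
  simp only [mul_apply]
  rw [fderiv_fun_sum fun (p : ℕ × ℕ) _ => (fderiv_wedgeAux hτ hη k p.1 p.2).1,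
    sum_apply, ← Finset.sum_add_distrib]
  exact Finset.sum_congr rfl fun p _ => (fderiv_wedgeAux hτ hη k p.1 p.2).2 v

theorem _root_.IsBoundedBilinearMap.contDiffOn_comp {A B C D : Type*} [NormedAddCommGroup A]
    [NormedSpace ℝ A] [NormedAddCommGroup B] [NormedSpace ℝ B] [NormedAddCommGroup C]
    [NormedSpace ℝ C] [NormedAddCommGroup D] [NormedSpace ℝ D] {f : A × B → C}
    (hf : IsBoundedBilinearMap ℝ f) {a : D → A} {b : D → B} {s : Set D}
    (ha : ContDiffOn ℝ ∞ a s) (hb : ContDiffOn ℝ ∞ b s) :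
    ContDiffOn ℝ ∞ (fun z => f (a z, b z)) s :=
  hf.contDiff.comp_contDiffOn (ha.prodMk hb)

theorem contDiffOn_wedgeAux {k i j : ℕ} {a : V → CAlt V i} {b : V → CAlt V j} {s : Set V}
    (ha : ContDiffOn ℝ ∞ a s) (hb : ContDiffOn ℝ ∞ b s) :
    ContDiffOn ℝ ∞ (fun z => wedgeAux k i j (a z) (b z)) s :=
  (isBoundedBilinearMap_wedgeAux (V := V) k i j).contDiffOn_comp ha hb

theorem SmoothOn.mul {τ η : V → Gr V} {s : Set V} (hτ : SmoothOn τ s) (hη : SmoothOn η s) :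
    SmoothOn (fun z => Gr.mul (τ z) (η z)) s := fun k => by
  simp only [mul_apply]
  exact ContDiffOn.sum fun (p : ℕ × ℕ) _ => contDiffOn_wedgeAux (hτ p.1) (hη p.2)

theorem delG_mul {τ η : V → Gr V} {y : V} (hτ : DiffAt τ y) (hη : DiffAt η y) :
    delG (fun z => mul (τ z) (η z)) y =
      mul (delG τ y) (η y) + mul (eps (τ y)) (delG η y) := by
  rw [delG, dG_mul hτ hη, linG_add, map_add, linG_post, linG_post, alt_mul_right, alt_mul_left]
  rfl

theorem delbarG_mul {τ η : V → Gr V} {y : V} (hτ : DiffAt τ y) (hη : DiffAt η y) :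
    delbarG (fun z => mul (τ z) (η z)) y =
      mul (delbarG τ y) (η y) + mul (eps (τ y)) (delbarG η y) := by
  rw [delbarG, dG_mul hτ hη, antG_add, map_add, antG_post, antG_post, alt_mul_right, alt_mul_left]
  rfl

section Degreewise

/-- Composition of smooth forms with maps that are linear in each degree. -/
theorem SmoothOn.map {τ : V → Gr V} {s : Set V} (hτ : SmoothOn τ s) (T : Gr V → Gr V) (d : ℕ → ℕ)
    (L : ∀ k, CAlt V (d k) →ₗ[ℝ] CAlt V k) (hT : ∀ a k, T a k = L k (a (d k))) :
    SmoothOn (fun z => T (τ z)) s := fun k => by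
  simp only [hT]
  exact (LinearMap.toContinuousLinearMap (L k)).contDiff.comp_contDiffOn (hτ (d k))

/-- The pull-back by multiplication by `c`, in a fixed degree. -/
def rotL (c : ℂ) (k : ℕ) : CAlt V k →ₗ[ℝ] CAlt V k where
  toFun a := a.compContinuousLinearMap ((c • ContinuousLinearMap.id ℂ V).restrictScalars ℝ)
  map_add' _ _ := rfl
  map_smul' _ _ := rfl

/-- Complex conjugation, in a fixed degree. -/
def conjL (k : ℕ) : CAlt V k →ₗ[ℝ] CAlt V k where
  toFun a := conjAlt a
  map_add' a b := by
    ext v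
    exact map_add conj _ _
  map_smul' c a := by
    ext v
    exact (Complex.conjCLE : ℂ →L[ℝ] ℂ).map_smul c (a v)

/-- Contraction with a fixed vector, in a fixed degree. -/
def contrL (v : V) (k : ℕ) : CAlt V (k + 1) →ₗ[ℝ] CAlt V k where
  toFun a := a.curryLeft v
  map_add' _ _ := rfl
  map_smul' _ _ := rfl

theorem SmoothOn.rot {τ : V → Gr V} {s : Set V} (hτ : SmoothOn τ s) (c : ℂ) :
    SmoothOn (fun z => Gr.rot c (τ z)) s :=
  hτ.map _ id (rotL c) fun _ _ => rfl

theorem SmoothOn.conjG {τ : V → Gr V} {s : Set V} (hτ : SmoothOn τ s) :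
    SmoothOn (fun z => Gr.conjG (τ z)) s :=
  hτ.map _ id conjL fun _ _ => rfl

theorem SmoothOn.contr {τ : V → Gr V} {s : Set V} (hτ : SmoothOn τ s) (v : V) :
    SmoothOn (fun z => Gr.contr v (τ z)) s :=
  hτ.map _ (· + 1) (contrL v) fun _ _ => rfl

theorem SmoothOn.add {τ η : V → Gr V} {s : Set V} (hτ : SmoothOn τ s) (hη : SmoothOn η s) :
    SmoothOn (fun z => τ z + η z) s := fun k => (hτ k).add (hη k)

theorem SmoothOn.const_smul {τ : V → Gr V} {s : Set V} (hτ : SmoothOn τ s) (c : ℂ) :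
    SmoothOn (fun z => c • τ z) s := fun k => (hτ k).const_smul c

theorem SmoothOn.smul {τ : V → Gr V} {s : Set V} {g : V → ℂ} (hg : ContDiffOn ℝ ∞ g s)
    (hτ : SmoothOn τ s) : SmoothOn (fun z => g z • τ z) s := fun k => hg.smul (hτ k)

theorem SmoothOn.sum {ι : Type*} {t : Finset ι} {τ : ι → V → Gr V} {s : Set V}
    (hτ : ∀ i ∈ t, SmoothOn (τ i) s) : SmoothOn (fun z => ∑ i ∈ t, τ i z) s := fun k => by
  simp only [Finset.sum_apply]
  exact ContDiffOn.sum fun i hi => hτ i hi k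

theorem SmoothOn.contrHol {τ : V → Gr V} {s : Set V} (hτ : SmoothOn τ s) (v : V) :
    SmoothOn (fun z => Gr.contrHol v (τ z)) s := by
  have h := ((hτ.contr v).add ((hτ.contr (Complex.I • v)).const_smul (-Complex.I))).const_smul
    (1 / 2)
  refine h.congr fun y _ => ?_
  rw [contrHol_apply, neg_smul, sub_eq_add_neg]

theorem DiffAt.rot {τ : V → Gr V} {y : V} (hτ : DiffAt τ y) (c : ℂ) :
    DiffAt (fun z => Gr.rot c (τ z)) y := fun k => by
  have h := ((LinearMap.toContinuousLinearMap (rotL c k)).differentiableAt (x := τ y k)).comp y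
    (hτ k)
  exact h

theorem dG_rot {τ : V → Gr V} {y : V} (hτ : DiffAt τ y) (c : ℂ) :
    dG (fun z => rot c (τ z)) y = post (rot c) (dG τ y) := by
  refine LinearMap.ext fun v => funext fun k => ?_
  have h := ((LinearMap.toContinuousLinearMap (rotL c k)).hasFDerivAt (x := τ y k)).comp y
    (hτ k).hasFDerivAt
  rw [dG_apply]
  exact congrArg (fun f => f v) h.fderiv

theorem dG_conjG {τ : V → Gr V} {y : V} (hτ : DiffAt τ y) (v : V) :
    dG (fun z => conjG (τ z)) y v = conjG (dG τ y v) := by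
  refine funext fun k => ?_
  have h := ((LinearMap.toContinuousLinearMap (conjL k)).hasFDerivAt (x := τ y k)).comp y
    (hτ k).hasFDerivAt
  rw [dG_apply]
  exact congrArg (fun f => f v) h.fderiv

theorem dG_add {τ η : V → Gr V} {y : V} (hτ : DiffAt τ y) (hη : DiffAt η y) :
    dG (fun z => τ z + η z) y = dG τ y + dG η y := by
  refine LinearMap.ext fun v => funext fun k => ?_
  exact congrArg (fun f => f v) (fderiv_add (hτ k) (hη k))

theorem dG_smul {τ : V → Gr V} {y : V} (hτ : DiffAt τ y) (c : ℂ) :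
    dG (fun z => c • τ z) y = c • dG τ y := by
  refine LinearMap.ext fun v => funext fun k => ?_
  exact congrArg (fun f => f v) (fderiv_const_smul (hτ k) c)

theorem rot_delG {τ : V → Gr V} {y : V} (hτ : DiffAt τ y) (c : ℂ) :
    rot c (delG τ y) = c • delG (fun z => rot c (τ z)) y := by
  rw [delG, rot_alt_linG, delG, dG_rot hτ]

theorem rot_delbarG {τ : V → Gr V} {y : V} (hτ : DiffAt τ y) (c : ℂ) :
    rot c (delbarG τ y) = conj c • delbarG (fun z => rot c (τ z)) y := by
  rw [delbarG, rot_alt_antG, delbarG, dG_rot hτ]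

theorem conjG_delbarG {τ : V → Gr V} {y : V} (hτ : DiffAt τ y) :
    conjG (delbarG τ y) = delG (fun z => conjG (τ z)) y :=
  conjG_alt_antG _ _ fun v => dG_conjG hτ v

theorem contDiff_alternatizeUncurryFin {k : ℕ} : ContDiff ℝ ∞
    (fun A : V →L[ℝ] CAlt V k => ContinuousAlternatingMap.alternatizeUncurryFin A) := by
  have : IsBoundedLinearMap ℝ
      (fun A : V →L[ℝ] CAlt V k => ContinuousAlternatingMap.alternatizeUncurryFin A) :=
    IsLinearMap.with_bound ⟨fun A B => ContinuousAlternatingMap.alternatizeUncurryFin_add A B,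
      fun c A => ContinuousAlternatingMap.alternatizeUncurryFin_smul c A⟩ (k + 1)
      fun A => ContinuousAlternatingMap.norm_alternatizeUncurryFin_le A
  exact this.contDiff

theorem SmoothOn.delG {τ : V → Gr V} {s : Set V} (hτ : SmoothOn τ s) (hs : IsOpen s) :
    SmoothOn (Gr.delG τ) s := by
  intro k
  rcases k with _ | k
  · exact contDiffOn_const
  · have h : ContDiffOn ℝ ∞ (fderiv ℝ (fun z => τ z k)) s :=
      (hτ k).fderiv_of_isOpen hs (by simp)
    simp only [delG_succ]
    refine contDiff_alternatizeUncurryFin.comp_contDiffOn ?_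
    exact (h.sub ((h.clm_comp contDiffOn_const).const_smul Complex.I)).const_smul (1 / 2 : ℂ)

theorem SmoothOn.delbarG {τ : V → Gr V} {s : Set V} (hτ : SmoothOn τ s) (hs : IsOpen s) :
    SmoothOn (Gr.delbarG τ) s := by
  intro k
  rcases k with _ | k
  · exact contDiffOn_const
  · have h : ContDiffOn ℝ ∞ (fderiv ℝ (fun z => τ z k)) s :=
      (hτ k).fderiv_of_isOpen hs (by simp)
    simp only [delbarG_succ]
    refine contDiff_alternatizeUncurryFin.comp_contDiffOn ?_
    exact (h.add ((h.clm_comp contDiffOn_const).const_smul Complex.I)).const_smul (1 / 2 : ℂ)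

end Degreewise

/-! ### Invariance under holomorphic maps -/

theorem eq_zero_of_add_eq_zero_of_I_smul {M : Type*} [AddCommGroup M] [Module ℂ M] {x y : M}
    (h1 : x + y = 0) (h2 : -Complex.I • x + Complex.I • y = 0) : x = 0 ∧ y = 0 := by
  have hy : y = -x := eq_neg_of_add_eq_zero_right h1
  rw [hy] at h2
  have h3 : (-(2 * Complex.I)) • x = 0 := by
    rw [← h2]
    module
  have hx : x = 0 := (smul_eq_zero.1 h3).resolve_left (by simp)
  exact ⟨hx, by rw [hy, hx, neg_zero]⟩

theorem extG_pull {τ : V → Gr V} {f : V → V} {y : V} (hτ : DiffAt τ (f y))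
    (hf : ContDiffAt ℝ ∞ f y) :
    extG (fun z => pull (fderiv ℝ f z) (τ (f z))) y = pull (fderiv ℝ f y) (extG τ (f y)) := by
  funext k
  rcases k with _ | k
  · ext v
    rfl
  · exact extDeriv_pullback (hτ k) hf (by simpa using ENat.LEInfty.out)

theorem pull_rot (c : ℂ) (A : V →L[ℂ] V) (a : Gr V) :
    pull (A.restrictScalars ℝ) (rot c a) = rot c (pull (A.restrictScalars ℝ) a) := by
  funext k
  ext v
  change a k (fun t => c • A (v t)) = a k (fun t => A (c • v t))
  simp only [map_smul]

/-- Naturality of d only gives naturality of the sum ∂ + ∂̄. Applied also to `rot I τ`, where ∂ and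
∂̄ acquire the factors -i and i, it gives a second equation, and the two separate ∂ from ∂̄.
Holomorphy of f enters because pull-back by a complex-linear map commutes with `rot`. -/
theorem delG_pull_and_delbarG_pull {τ : V → Gr V} {f : V → V} {y : V} (hτ : DiffAt τ (f y))
    (hf : ContDiffAt ℂ ∞ f y)
    (hfτ : DiffAt (fun z => pull ((fderiv ℂ f z).restrictScalars ℝ) (τ (f z))) y) :
    delG (fun z => pull ((fderiv ℂ f z).restrictScalars ℝ) (τ (f z))) y =
        pull ((fderiv ℂ f y).restrictScalars ℝ) (delG τ (f y)) ∧
      delbarG (fun z => pull ((fderiv ℂ f z).restrictScalars ℝ) (τ (f z))) y =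
        pull ((fderiv ℂ f y).restrictScalars ℝ) (delbarG τ (f y)) := by
  set η := fun z => pull ((fderiv ℂ f z).restrictScalars ℝ) (τ (f z)) with hη
  set P := pull (V := V) ((fderiv ℂ f y).restrictScalars ℝ) with hP
  have hd : ∀ᶠ z in nhds y, fderiv ℝ f z = (fderiv ℂ f z).restrictScalars ℝ := by
    have h1 : ∀ᶠ z in nhds y, ContDiffAt ℂ 1 f z := (hf.of_le (by simp)).eventually (by simp)
    exact h1.mono fun z hz => (hz.differentiableAt (by simp)).fderiv_restrictScalars ℝ
  have hext : ∀ (θ : V → Gr V), DiffAt θ (f y) →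
      extG (fun z => pull ((fderiv ℂ f z).restrictScalars ℝ) (θ (f z))) y =
        P (extG θ (f y)) := by
    intro θ hθ
    rw [hP, ← hd.self_of_nhds, ← extG_pull hθ (hf.restrict_scalars ℝ), extG, extG]
    refine congrArg alt (dG_congr (hd.mono fun z hz => ?_))
    simp only [hz]
  have hrotτ := hτ.rot Complex.I
  have e1 := hext τ hτ
  have e2 := hext _ hrotτ
  simp only [pull_rot] at e2
  have k1 : extG (fun z => rot Complex.I (η z)) y =
      -Complex.I • rot Complex.I (delG η y) + Complex.I • rot Complex.I (delbarG η y) := by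
    rw [rot_delG hfτ, rot_delbarG hfτ, smul_smul, smul_smul, Complex.conj_I, neg_mul, mul_neg,
      Complex.I_mul_I, neg_neg, one_smul, one_smul, delG_add_delbarG]
  have k2 : extG (fun z => rot Complex.I (τ z)) (f y) =
      -Complex.I • rot Complex.I (delG τ (f y)) + Complex.I • rot Complex.I (delbarG τ (f y)) := by
    rw [rot_delG hτ, rot_delbarG hτ, smul_smul, smul_smul, Complex.conj_I, neg_mul, mul_neg,
      Complex.I_mul_I, neg_neg, one_smul, one_smul, delG_add_delbarG]
  rw [k1, k2, map_add P, map_smul P, map_smul P, hP, pull_rot, pull_rot, ← hP,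
    ← map_smul (rot Complex.I), ← map_smul (rot Complex.I), ← map_smul (rot Complex.I),
    ← map_smul (rot Complex.I), ← map_add, ← map_add] at e2
  have hinj : ∀ a b : Gr V, rot Complex.I a = rot Complex.I b → a = b := by
    intro a b hab
    have : ∀ a : Gr V, rot (-Complex.I) (rot Complex.I a) = a := by
      intro a
      funext k
      ext v
      rw [rot_apply, rot_apply]
      simp [smul_smul]
    rw [← this a, hab, this]
  have e3 := hinj _ _ e2
  rw [← delG_add_delbarG, ← delG_add_delbarG, map_add] at e1
  obtain ⟨x1, x2⟩ := eq_zero_of_add_eq_zero_of_I_smul (x := delG η y - P (delG τ (f y)))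
    (y := delbarG η y - P (delbarG τ (f y)))
    (by rw [sub_add_sub_comm, e1, sub_self])
    (by rw [smul_sub, smul_sub, sub_add_sub_comm, e3, sub_self])
  exact ⟨sub_eq_zero.1 x1, sub_eq_zero.1 x2⟩

/-! ### Smoothness of the inverse of the Lefschetz operator -/

theorem contDiffOn_det {ι : Type*} [Fintype ι] [DecidableEq ι] {s : Set V} {M : V → Matrix ι ι ℂ}
    (hM : ∀ i j, ContDiffOn ℝ ∞ (fun z => M z i j) s) : ContDiffOn ℝ ∞ (fun z => (M z).det) s := by
  simp only [Matrix.det_apply, Units.smul_def, zsmul_eq_mul]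
  exact ContDiffOn.sum fun σ _ => contDiffOn_const.mul (contDiffOn_prod fun i _ => hM _ _)

/-- Cramer's rule: the entries of the inverse are cofactors divided by the determinant. -/
theorem contDiffOn_inv {ι : Type*} [Fintype ι] [DecidableEq ι] {s : Set V} {M : V → Matrix ι ι ℂ}
    (hM : ∀ i j, ContDiffOn ℝ ∞ (fun z => M z i j) s) (hdet : ∀ z ∈ s, IsUnit (M z).det)
    (i j : ι) : ContDiffOn ℝ ∞ (fun z => (M z)⁻¹ i j) s := by
  have h1 : ContDiffOn ℝ ∞ (fun z => (M z).adjugate i j) s := by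
    simp only [Matrix.adjugate_apply]
    refine contDiffOn_det fun k l => ?_
    simp only [Matrix.updateRow_apply]
    split_ifs
    · exact contDiffOn_const
    · exact hM k l
  have h2 := (contDiffOn_det hM).inv fun z hz => (hdet z hz).ne_zero
  refine (h2.mul h1).congr fun z _ => ?_
  rw [Matrix.inv_def, Ring.inverse_eq_inv', Matrix.smul_apply, smul_eq_mul]
  rfl

theorem SmoothOn.lam_dualVec {ι : Type*} [Fintype ι] [DecidableEq ι] {s : Set V}
    {M : V → Matrix ι ι ℂ} (hM : ∀ i j, ContDiffOn ℝ ∞ (fun z => M z i j) s)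
    (hdet : ∀ z ∈ s, IsUnit (M z).det) (b : ι → V) {τ : V → Gr V} (hτ : SmoothOn τ s) :
    SmoothOn (fun z => lam b (dualVec b (M z)) (τ z)) s := by
  have : SmoothOn (fun z => ∑ i, ∑ l, (M z)⁻¹ i l • Gr.contrHol (b l) (Gr.contrHol (b i) (τ z))) s :=
    SmoothOn.sum fun i _ => SmoothOn.sum fun l _ =>
      SmoothOn.smul (contDiffOn_inv hM hdet i l) ((hτ.contrHol (b i)).contrHol (b l))
  refine this.congr fun y _ => ?_
  rw [lam_apply]
  refine Finset.sum_congr rfl fun i _ => ?_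
  rw [dualVec, contrHol_sum_smul]

theorem SmoothOn.lam_dualVec_pow {ι : Type*} [Fintype ι] [DecidableEq ι] {s : Set V}
    {M : V → Matrix ι ι ℂ} (hM : ∀ i j, ContDiffOn ℝ ∞ (fun z => M z i j) s)
    (hdet : ∀ z ∈ s, IsUnit (M z).det) (b : ι → V) {τ : V → Gr V} (hτ : SmoothOn τ s) (r : ℕ) :
    SmoothOn (fun z => (lam b (dualVec b (M z)) ^ r) (τ z)) s := by
  induction r with
  | zero => simpa using hτ
  | succ r ih =>
    refine (SmoothOn.lam_dualVec hM hdet b ih).congr fun y _ => ?_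
    rw [pow_succ', Module.End.mul_apply]

end Gr

end

section

/-! ### Graded forms on a complex manifold -/

open Gr

variable {E : Type*} [NormedAddCommGroup E] [NormedSpace ℂ E] [FiniteDimensional ℂ E]
  {X : Type*} [TopologicalSpace X] [ChartedSpace E X]

/-- The derivative of the chart at `x` in the point `x`. -/
def chartD (x : X) : E →L[ℂ] E := mfderiv 𝓘(ℂ, E) 𝓘(ℂ, E) (chartAt E x) x

/-- The derivative of the inverse of the chart at `x₀`. -/
def symmD (x₀ : X) (y : E) : E →L[ℂ] E := mfderiv 𝓘(ℂ, E) 𝓘(ℂ, E) (chartAt E x₀).symm y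

/-- The local expression of a graded form in the chart at `x₀`. -/
def loc (A : X → Gr E) (x₀ : X) (y : E) : Gr E :=
  pull ((symmD x₀ y).restrictScalars ℝ) (A ((chartAt E x₀).symm y))

/-- The pull-back under the chart at `x` to the point `x`. -/
def unloc (x : X) : Gr E →ₗ[ℂ] Gr E := pull ((chartD x).restrictScalars ℝ)

/-- A graded form is smooth if its local expressions are. -/
def SmoothForm (A : X → Gr E) : Prop := ∀ x₀ : X, SmoothOn (loc A x₀) (chartAt E x₀).target

/-- The operator `∂` on graded forms. -/
def delX (A : X → Gr E) (x : X) : Gr E := unloc x (delG (loc A x) (chartAt E x x))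

/-- The operator `∂̄` on graded forms. -/
def delbarX (A : X → Gr E) (x : X) : Gr E := unloc x (delbarG (loc A x) (chartAt E x x))

theorem smoothForm_iff (A : X → Gr E) :
    SmoothForm A ↔ ∀ k, IsSmooth (fun x => A x k : DForm E X k) :=
  ⟨fun h k x₀ => h x₀ k, fun h x₀ k => h k x₀⟩

theorem pull_pull {U V W : Type*} [NormedAddCommGroup U] [NormedSpace ℂ U] [NormedAddCommGroup V]
    [NormedSpace ℂ V] [NormedAddCommGroup W] [NormedSpace ℂ W] (f : U →L[ℝ] V) (g : V →L[ℝ] W)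
    (a : Gr W) : pull f (pull g a) = pull (g.comp f) a := rfl

section Manifold

variable [IsManifold 𝓘(ℂ, E) ω X]

theorem unloc_pull_symmD (x : X) (a : Gr E) :
    unloc x (pull ((symmD x (chartAt E x x)).restrictScalars ℝ) a) = a := by
  have h := (mdifferentiable_chart (I := 𝓘(ℂ, E)) x).symm_comp_deriv (mem_chart_source E x)
  have h2 : (symmD x (chartAt E x x)).comp (chartD x) = ContinuousLinearMap.id ℂ E := h
  rw [unloc, pull_pull]
  have h3 : ((symmD x (chartAt E x x)).restrictScalars ℝ).comp ((chartD x).restrictScalars ℝ) =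
    ContinuousLinearMap.id ℝ E := by
    ext v
    exact congrArg (fun f => f v) h2
  rw [h3]
  rfl

theorem unloc_loc (A : X → Gr E) (x : X) : unloc x (loc A x (chartAt E x x)) = A x := by
  rw [loc, unloc_pull_symmD, (chartAt E x).left_inv (mem_chart_source E x)]

/-- The change of coordinates from the chart at `x₀` to the chart at `x`. -/
theorem exists_transition (x₀ : X) {y : E} (hy : y ∈ (chartAt E x₀).target) :
    let x := (chartAt E x₀).symm y
    ∃ f : E → E, ContDiffAt ℂ ∞ f y ∧ f y = chartAt E x x ∧
      (chartD x).comp (symmD x₀ y) = fderiv ℂ f y ∧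
      ∀ A : X → Gr E, ∀ᶠ z in nhds y,
        loc A x₀ z = pull ((fderiv ℂ f z).restrictScalars ℝ) (loc A x (f z)) := by
  intro x
  have hs : ∀ᶠ z in nhds y, z ∈ (chartAt E x₀).target ∧
      (chartAt E x₀).symm z ∈ (chartAt E x).source := by
    refine ((chartAt E x₀).open_target.mem_nhds hy |> fun h => Filter.eventually_mem_set.2 h).and ?_
    exact ((chartAt E x₀).continuousAt_symm hy).eventually_mem
      ((chartAt E x).open_source.mem_nhds (mem_chart_source E x))
  have hd0 : ∀ z ∈ (chartAt E x₀).target,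
      MDifferentiableAt 𝓘(ℂ, E) 𝓘(ℂ, E) (chartAt E x₀).symm z :=
    fun z hz => mdifferentiableAt_atlas_symm (chart_mem_atlas E x₀) hz
  have hd1 : ∀ z ∈ (chartAt E x).source,
      MDifferentiableAt 𝓘(ℂ, E) 𝓘(ℂ, E) (chartAt E x) z :=
    fun z hz => mdifferentiableAt_atlas (chart_mem_atlas E x) hz
  refine ⟨chartAt E x ∘ (chartAt E x₀).symm, ?_, rfl, ?_, ?_⟩
  · rw [← contMDiffAt_iff_contDiffAt]
    have h1 : ContMDiffAt 𝓘(ℂ, E) 𝓘(ℂ, E) ω (chartAt E x₀).symm y :=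
      (contMDiffOn_chart_symm (x := x₀)).contMDiffAt ((chartAt E x₀).open_target.mem_nhds hy)
    have h2 : ContMDiffAt 𝓘(ℂ, E) 𝓘(ℂ, E) ω (chartAt E x) x :=
      (contMDiffOn_chart (x := x)).contMDiffAt
        ((chartAt E x).open_source.mem_nhds (mem_chart_source E x))
    exact (h2.comp y h1).of_le le_top
  · rw [← mfderiv_eq_fderiv]
    exact (mfderiv_comp y (hd1 x (mem_chart_source E x)) (hd0 y hy)).symm
  -- The identity is needed on a neighbourhood of y, since both sides are going to be
  -- differentiated.
  · intro A
    filter_upwards [hs, hs.eventually_nhds] with z hz hz'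
    set w := chartAt E x ((chartAt E x₀).symm z) with hw
    have hwt : w ∈ (chartAt E x).target := (chartAt E x).map_source hz.2
    have e1 : (chartAt E x).symm w = (chartAt E x₀).symm z := (chartAt E x).left_inv hz.2
    have e2 : (symmD x w).comp (fderiv ℂ (chartAt E x ∘ (chartAt E x₀).symm) z) = symmD x₀ z := by
      have hf : MDifferentiableAt 𝓘(ℂ, E) 𝓘(ℂ, E) (chartAt E x ∘ (chartAt E x₀).symm) z :=
        (hd1 _ hz.2).comp z (hd0 z hz.1)
      rw [← mfderiv_eq_fderiv, symmD, symmD]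
      refine (mfderiv_comp z (mdifferentiableAt_atlas_symm (chart_mem_atlas E x) hwt) hf).symm.trans
        (Filter.EventuallyEq.mfderiv_eq ?_)
      filter_upwards [hz'] with u hu
      exact (chartAt E x).left_inv hu.2
    change pull _ _ = pull _ (pull _ _)
    rw [pull_pull, Function.comp_apply, ← hw, e1, ← e2]
    rfl

/-- The local expression of `∂A` and `∂̄A`. -/
theorem loc_delX_and_loc_delbarX {A : X → Gr E} (hA : SmoothForm A) (x₀ : X) {y : E}
    (hy : y ∈ (chartAt E x₀).target) :
    loc (delX A) x₀ y = delG (loc A x₀) y ∧ loc (delbarX A) x₀ y = delbarG (loc A x₀) y := by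
  -- At the point x the operators are computed in the preferred chart of x, which need not be the
  -- chart of x₀. Naturality under the holomorphic transition map f compares the two.
  obtain ⟨f, hf, hfy, hfd, hloc⟩ := exists_transition x₀ hy
  set x := (chartAt E x₀).symm y
  have h1 : DiffAt (loc A x) (f y) := by
    rw [hfy]
    exact (hA x).diffAt (chartAt E x).open_target (mem_chart_target E x)
  have h2 : DiffAt (loc A x₀) y := (hA x₀).diffAt (chartAt E x₀).open_target hy
  have h3 := delG_pull_and_delbarG_pull h1 hf (h2.congr ((hloc A).mono fun z hz => hz.symm))
  have hd := dG_congr (hloc A)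
  rw [delG, delbarG, ← hd] at h3
  constructor
  · refine Eq.trans ?_ h3.1.symm
    rw [hfy, ← hfd]
    rfl
  · refine Eq.trans ?_ h3.2.symm
    rw [hfy, ← hfd]
    rfl

theorem SmoothForm.delX {A : X → Gr E} (hA : SmoothForm A) : SmoothForm (delX A) := fun x₀ =>
  ((hA x₀).delG (chartAt E x₀).open_target).congr fun _ hy => (loc_delX_and_loc_delbarX hA x₀ hy).1

theorem SmoothForm.delbarX {A : X → Gr E} (hA : SmoothForm A) : SmoothForm (delbarX A) := fun x₀ =>
  ((hA x₀).delbarG (chartAt E x₀).open_target).congr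
    fun _ hy => (loc_delX_and_loc_delbarX hA x₀ hy).2

end Manifold

end

/-! ### The module of smooth graded forms and the relations between ∂ and ∂̄ -/

section

open Gr

section

variable {V : Type*} [NormedAddCommGroup V] [NormedSpace ℂ V] [FiniteDimensional ℂ V]

/-- The functions c̄², c c̄ and c² are linearly independent; the values at 1, i and 1 + i already
suffice. -/
theorem eq_zero_of_forall_conj_sq_smul_add {M : Type*} [AddCommGroup M] [Module ℂ M] (P Q R : M)
    (key : ∀ c : ℂ, c ≠ 0 → (conj c) ^ 2 • P + (c * conj c) • Q + c ^ 2 • R = 0) :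
    P = 0 ∧ Q = 0 ∧ R = 0 := by
  have h1 := key 1 one_ne_zero
  have h2 := key Complex.I Complex.I_ne_zero
  have h3 := key (1 + Complex.I) (fun h => by simpa using congrArg Complex.re h)
  have e1 : P + Q + R = 0 := by simpa using h1
  have e2 : -P + Q - R = 0 := by
    rw [← h2, Complex.conj_I, neg_sq, Complex.I_sq, mul_neg, Complex.I_mul_I]
    module
  have hQ : Q = 0 := by
    have : (2 : ℂ) • Q = (P + Q + R) + (-P + Q - R) := by module
    rw [e1, e2, add_zero] at this
    exact (smul_eq_zero.1 this).resolve_left two_ne_zero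
  rw [hQ, add_zero] at e1
  rw [hQ, smul_zero, add_zero] at h3
  have hR : R = -P := eq_neg_of_add_eq_zero_right e1
  have hP : P = 0 := by
    rw [hR] at h3
    have e3 : (-(4 * Complex.I)) • P = 0 := by
      rw [← h3, smul_neg, ← sub_eq_add_neg, ← sub_smul]
      congr 1
      simp only [map_add, map_one, Complex.conj_I]
      ring
    exact (smul_eq_zero.1 e3).resolve_left (by simp)
  exact ⟨hP, hQ, by rw [hR, hP, neg_zero]⟩

theorem Gr.linG_smul (c : ℂ) (A : V →ₗ[ℝ] Gr V) : linG (c • A) = c • linG A := by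
  refine LinearMap.ext fun v => ?_
  rw [LinearMap.smul_apply, linG_apply, linG_apply, LinearMap.smul_apply, LinearMap.smul_apply]
  module

theorem Gr.antG_smul (c : ℂ) (A : V →ₗ[ℝ] Gr V) : antG (c • A) = c • antG A := by
  refine LinearMap.ext fun v => ?_
  rw [LinearMap.smul_apply, antG_apply, antG_apply, LinearMap.smul_apply, LinearMap.smul_apply]
  module

end

variable {E : Type*} [NormedAddCommGroup E] [NormedSpace ℂ E] [FiniteDimensional ℂ E]
  {X : Type*} [TopologicalSpace X] [ChartedSpace E X]

theorem SmoothForm.diffAt {A : X → Gr E} (hA : SmoothForm A) (x : X) :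
    DiffAt (loc A x) (chartAt E x x) :=
  (hA x).diffAt (chartAt E x).open_target (mem_chart_target E x)

theorem SmoothForm.add {A B : X → Gr E} (hA : SmoothForm A) (hB : SmoothForm B) :
    SmoothForm fun x => A x + B x := fun x₀ => ((hA x₀).add (hB x₀)).congr fun y _ => by
  rw [loc, map_add]
  rfl

theorem SmoothForm.smul {A : X → Gr E} (hA : SmoothForm A) (c : ℂ) :
    SmoothForm fun x => c • A x := fun x₀ => ((hA x₀).const_smul c).congr fun y _ => by
  rw [loc, map_smul]
  rfl

variable (E X) in
/-- The space of smooth graded forms. -/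
@[ext]
structure GForms where
  /-- The underlying family of forms on the tangent spaces. -/
  val : X → Gr E
  smooth : SmoothForm val

namespace GForms

instance : Zero (GForms E X) := ⟨⟨fun _ => 0, fun x₀ k => by
  have : (fun z => loc (fun _ : X => (0 : Gr E)) x₀ z k) = fun _ => 0 := by
    funext z
    rw [loc, map_zero]
    rfl
  rw [this]
  exact contDiffOn_const⟩⟩

instance : Add (GForms E X) := ⟨fun A B => ⟨fun x => A.1 x + B.1 x, A.2.add B.2⟩⟩

/-- The scalars are general because the transferred group structure needs multiples by ℕ and ℤ
besides those by ℂ. -/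
instance {R : Type*} [SMul R ℂ] [SMul R (Gr E)] [IsScalarTower R ℂ (Gr E)] :
    SMul R (GForms E X) :=
  ⟨fun c A => ⟨fun x => c • A.1 x, by simpa using A.2.smul (c • (1 : ℂ))⟩⟩

instance : Neg (GForms E X) := ⟨fun A => ⟨fun x => -A.1 x, by simpa using A.2.smul (-1)⟩⟩

instance : Sub (GForms E X) :=
  ⟨fun A B => ⟨fun x => A.1 x - B.1 x, by
    simp only [sub_eq_add_neg]
    exact A.2.add (-B).2⟩⟩

theorem val_injective : Function.Injective (GForms.val : GForms E X → X → Gr E) :=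
  fun _ _ h => GForms.ext h

instance : AddCommGroup (GForms E X) :=
  val_injective.addCommGroup _ rfl (fun _ _ => rfl) (fun _ => rfl) (fun _ _ => rfl)
    (fun _ _ => rfl) (fun _ _ => rfl)

instance : Module ℂ (GForms E X) :=
  val_injective.module ℂ ⟨⟨GForms.val, rfl⟩, fun _ _ => rfl⟩ fun _ _ => rfl

/-- The wedge product with a smooth form. -/
def lmul (A : GForms E X) : GForms E X →ₗ[ℂ] GForms E X where
  toFun B := ⟨fun x => mul (A.1 x) (B.1 x), fun x₀ => ((A.2 x₀).mul (B.2 x₀)).congr fun y _ => by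
    rw [loc, pull_mul]
    rfl⟩
  map_add' B C := GForms.ext <| funext fun x => map_add (mul (A.1 x)) _ _
  map_smul' c B := GForms.ext <| funext fun x => map_smul (mul (A.1 x)) _ _

/-- The pull-back by multiplication by `c` on the tangent spaces. -/
def srot (c : ℂ) : GForms E X →ₗ[ℂ] GForms E X where
  toFun A := ⟨fun x => rot c (A.1 x), fun x₀ => ((A.2 x₀).rot c).congr fun y _ => by
    rw [loc, pull_rot]
    rfl⟩
  map_add' B C := GForms.ext <| funext fun x => map_add (rot (V := E) c) _ _
  map_smul' z B := GForms.ext <| funext fun x => map_smul (rot (V := E) c) _ _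

/-- Complex conjugation of forms. -/
def sconj (A : GForms E X) : GForms E X :=
  ⟨fun x => conjG (A.1 x), fun x₀ => (A.2 x₀).conjG⟩

theorem sconj_smul (c : ℂ) (A : GForms E X) : sconj (c • A) = conj c • sconj A :=
  GForms.ext <| funext fun _ => conjG_smul _ _

theorem sconj_sconj (A : GForms E X) : sconj (sconj A) = A :=
  GForms.ext <| funext fun _ => conjG_conjG _

theorem sconj_zero : sconj (0 : GForms E X) = 0 := by
  have h := sconj_smul 0 (0 : GForms E X)
  rwa [zero_smul, map_zero, zero_smul] at h

theorem sconj_lmul (A B : GForms E X) : sconj (lmul A B) = lmul (sconj A) (sconj B) :=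
  GForms.ext <| funext fun x => conjG_mul (A.1 x) (B.1 x)

variable [IsManifold 𝓘(ℂ, E) ω X]

/-- The operator `∂` on smooth forms. -/
def sdel : GForms E X →ₗ[ℂ] GForms E X where
  toFun A := ⟨delX A.1, A.2.delX⟩
  map_add' A B := GForms.ext <| funext fun x => by
    have h : loc (A + B).1 x = fun z => loc A.1 x z + loc B.1 x z := by
      funext z
      exact map_add (pull _) _ _
    simp only [delX, h]
    rw [delG, dG_add (A.2.diffAt x) (B.2.diffAt x), linG_add, map_add, map_add]
    rfl
  map_smul' c A := GForms.ext <| funext fun x => by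
    have h : loc (c • A).1 x = fun z => c • loc A.1 x z := by
      funext z
      exact map_smul (pull _) _ _
    simp only [delX, h]
    rw [delG, dG_smul (A.2.diffAt x), linG_smul, map_smul, map_smul]
    rfl

/-- The operator `∂̄` on smooth forms. -/
def sdelbar : GForms E X →ₗ[ℂ] GForms E X where
  toFun A := ⟨delbarX A.1, A.2.delbarX⟩
  map_add' A B := GForms.ext <| funext fun x => by
    have h : loc (A + B).1 x = fun z => loc A.1 x z + loc B.1 x z := by
      funext z
      exact map_add (pull _) _ _
    simp only [delbarX, h]
    rw [delbarG, dG_add (A.2.diffAt x) (B.2.diffAt x), antG_add, map_add, map_add]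
    rfl
  map_smul' c A := GForms.ext <| funext fun x => by
    have h : loc (c • A).1 x = fun z => c • loc A.1 x z := by
      funext z
      exact map_smul (pull _) _ _
    simp only [delbarX, h]
    rw [delbarG, dG_smul (A.2.diffAt x), antG_smul, map_smul, map_smul]
    rfl

theorem rot_unloc (c : ℂ) (x : X) (a : Gr E) : rot c (unloc x a) = unloc x (rot c a) :=
  (pull_rot c (chartD x) a).symm

theorem srot_sdel (c : ℂ) (A : GForms E X) : srot c (sdel A) = c • sdel (srot c A) :=
  GForms.ext <| funext fun x => by
    have h : loc (srot c A).1 x = fun z => rot (V := E) c (loc A.1 x z) := by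
      funext z
      exact pull_rot c _ _
    change rot (V := E) c (unloc x _) = c • unloc x (delG (loc (srot c A).1 x) _)
    rw [h, rot_unloc, rot_delG (A.2.diffAt x), map_smul]

theorem srot_sdelbar (c : ℂ) (A : GForms E X) :
    srot c (sdelbar A) = conj c • sdelbar (srot c A) :=
  GForms.ext <| funext fun x => by
    have h : loc (srot c A).1 x = fun z => rot (V := E) c (loc A.1 x z) := by
      funext z
      exact pull_rot c _ _
    change rot (V := E) c (unloc x _) = conj c • unloc x (delbarG (loc (srot c A).1 x) _)
    rw [h, rot_unloc, rot_delbarG (A.2.diffAt x), map_smul]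

theorem sconj_sdelbar (A : GForms E X) : sconj (sdelbar A) = sdel (sconj A) :=
  GForms.ext <| funext fun x => by
    change unloc x (conjG (delbarG (loc A.1 x) _)) = _
    rw [conjG_delbarG (A.2.diffAt x)]
    rfl

theorem sconj_sdel (A : GForms E X) : sconj (sdel A) = sdelbar (sconj A) := by
  rw [← sconj_sconj (sdelbar (sconj A)), sconj_sdelbar, sconj_sconj]

/-- In the Leibniz rule the term with ∂A vanishes, and evenness of A removes the sign of the other
term. -/
theorem sdel_lmul {A : GForms E X} (hA : ∀ x, eps (A.1 x) = A.1 x) (hA' : sdel A = 0)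
    (B : GForms E X) : sdel (lmul A B) = lmul A (sdel B) :=
  GForms.ext <| funext fun x => by
    have h : loc (lmul A B).1 x = fun z => mul (V := E) (loc A.1 x z) (loc B.1 x z) := by
      funext z
      exact pull_mul _ _ _
    change unloc x (delG (loc (lmul A B).1 x) _) = mul (V := E) (A.1 x) (unloc x _)
    have h0 : unloc x (delG (loc A.1 x) (chartAt E x x)) = 0 :=
      congrArg (fun A : GForms E X => A.1 x) hA'
    rw [h, delG_mul (A.2.diffAt x) (B.2.diffAt x), map_add, unloc, pull_mul, pull_mul, ← unloc,
      h0, map_zero, LinearMap.zero_apply, zero_add]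
    congr 2
    change eps (unloc x (loc A.1 x (chartAt E x x))) = _
    rw [unloc_loc, hA]

theorem sdelbar_lmul {A : GForms E X} (hA : ∀ x, eps (A.1 x) = A.1 x) (hA' : sdelbar A = 0)
    (B : GForms E X) : sdelbar (lmul A B) = lmul A (sdelbar B) :=
  GForms.ext <| funext fun x => by
    have h : loc (lmul A B).1 x = fun z => mul (V := E) (loc A.1 x z) (loc B.1 x z) := by
      funext z
      exact pull_mul _ _ _
    change unloc x (delbarG (loc (lmul A B).1 x) _) = mul (V := E) (A.1 x) (unloc x _)
    have h0 : unloc x (delbarG (loc A.1 x) (chartAt E x x)) = 0 :=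
      congrArg (fun A : GForms E X => A.1 x) hA'
    rw [h, delbarG_mul (A.2.diffAt x) (B.2.diffAt x), map_add, unloc, pull_mul, pull_mul, ← unloc,
      h0, map_zero, LinearMap.zero_apply, zero_add]
    congr 2
    change eps (unloc x (loc A.1 x (chartAt E x x))) = _
    rw [unloc_loc, hA]

/-- This is d² = 0, checked in a chart: near the point the local expression of dA is the exterior
derivative of that of A. -/
theorem ext_d_ext_d (A : GForms E X) :
    sdel (sdel A) + (sdel (sdelbar A) + sdelbar (sdel A)) + sdelbar (sdelbar A) = 0 := by
  have h0 : sdel (sdel A) + (sdel (sdelbar A) + sdelbar (sdel A)) + sdelbar (sdelbar A) =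
      sdel (sdel A + sdelbar A) + sdelbar (sdel A + sdelbar A) := by
    rw [map_add, map_add]
    abel
  rw [h0]
  set B := sdel A + sdelbar A with hB
  refine GForms.ext <| funext fun x => ?_
  change unloc x (delG (loc B.1 x) (chartAt E x x)) +
    unloc x (delbarG (loc B.1 x) (chartAt E x x)) = 0
  rw [← map_add, delG_add_delbarG]
  have hy := mem_chart_target E x
  have hloc : ∀ z ∈ (chartAt E x).target, loc B.1 x z = extG (loc A.1 x) z := by
    intro z hz
    obtain ⟨h1, h2⟩ := loc_delX_and_loc_delbarX A.2 x hz
    rw [← delG_add_delbarG, ← h1, ← h2]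
    exact map_add (pull _) _ _
  have h1 : ∀ᶠ z in nhds (chartAt E x x), loc B.1 x z = extG (loc A.1 x) z := by
    filter_upwards [(chartAt E x).open_target.mem_nhds hy] with z hz using hloc z hz
  have h2 : extG (loc B.1 x) (chartAt E x x) = extG (extG (loc A.1 x)) (chartAt E x x) :=
    congrArg alt (dG_congr h1)
  have h3 : extG (extG (loc A.1 x)) (chartAt E x x) = 0 := by
    funext k
    rcases k with _ | _ | k
    · rfl
    · change ContinuousAlternatingMap.alternatizeUncurryFin (fderiv ℝ (fun _ : E => (0 : CAlt E 0)) _) = 0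
      rw [fderiv_fun_const, Pi.zero_apply]
      ext v
      simp [ContinuousAlternatingMap.alternatizeUncurryFin_apply]
    · have hc : ContDiffAt ℝ ∞ (fun z => loc A.1 x z k) (chartAt E x x) :=
        (A.2 x k).contDiffAt ((chartAt E x).open_target.mem_nhds hy)
      exact extDeriv_extDeriv_apply hc (by simpa using ENat.LEInfty.out)
  rw [h2, h3, map_zero]

theorem srot_srot_inv {c : ℂ} (hc : c ≠ 0) (A : GForms E X) : srot c⁻¹ (srot c A) = A :=
  GForms.ext <| funext fun x => funext fun k => by
    ext v
    change A.1 x k (fun t => c • c⁻¹ • v t) = A.1 x k v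
    simp only [smul_inv_smul₀ hc]

/-- Applying d² = 0 to `srot c A` and undoing the rotation weights the parts of bidegree (2, 0), (1,
1), (0, 2) by c̄², c c̄, c². They therefore vanish separately, with no assumption on the type of A.
-/
theorem sdel_sq_and_sdelbar_sq (A : GForms E X) : sdel (sdel A) = 0 ∧
    sdel (sdelbar A) + sdelbar (sdel A) = 0 ∧ sdelbar (sdelbar A) = 0 := by
  have key : ∀ c : ℂ, c ≠ 0 → (conj c) ^ 2 • sdel (sdel A) +
      (c * conj c) • (sdel (sdelbar A) + sdelbar (sdel A)) + c ^ 2 • sdelbar (sdelbar A) = 0 := by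
    intro c hc
    rw [← srot_srot_inv hc (_ + _), ← map_zero (srot c⁻¹)]
    congr 1
    have h := congrArg (fun B => (c ^ 2 * conj c ^ 2) • B) (ext_d_ext_d (srot c A))
    simp only [smul_zero] at h
    rw [← h]
    simp only [map_add, map_smul, srot_sdel, srot_sdelbar, smul_add, smul_smul]
    ring_nf
  exact eq_zero_of_forall_conj_sq_smul_add _ _ _ key

theorem sdel_sdel (A : GForms E X) : sdel (sdel A) = 0 := (sdel_sq_and_sdelbar_sq A).1

theorem sdelbar_sdelbar (A : GForms E X) : sdelbar (sdelbar A) = 0 :=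
  (sdel_sq_and_sdelbar_sq A).2.2

theorem sdelbar_sdel (A : GForms E X) : sdelbar (sdel A) = -sdel (sdelbar A) :=
  eq_neg_of_add_eq_zero_right (sdel_sq_and_sdelbar_sq A).2.1

end GForms

end

section

/-! ### Symplectic forms on a vector space and recognition of types -/

namespace Gr

variable {V : Type*} [NormedAddCommGroup V] [NormedSpace ℂ V]

/-- Scaling by the real number 2 multiplies the part of degree k by 2^k and a form of type (p, q) by
2^(p + q). -/
theorem IsType.apply_eq_zero {p q : ℤ} {a : Gr V} (h : IsType p q a) {k : ℕ}
    (hk : (k : ℤ) ≠ p + q) : a k = 0 := by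
  ext v
  have h1 := congrArg (fun f => f k v) (h 2 two_ne_zero)
  have h2 : conj (2 : ℂ) = 2 := Complex.conj_ofNat 2
  have h3 : rot 2 a k v = (2 : ℂ) ^ (k : ℤ) * a k v := by
    have := (a k).map_smul_univ (fun _ => (2 : ℝ)) v
    rw [Finset.prod_const, Finset.card_univ, Fintype.card_fin] at this
    rw [rot_apply, zpow_natCast]
    have h4 : (fun t => (2 : ℂ) • v t) = fun t => (2 : ℝ) • v t := by
      funext t
      exact Complex.coe_smul 2 (v t)
    rw [h4, this, Complex.real_smul]
    push_cast
    rfl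
  simp only [Pi.smul_apply, ContinuousAlternatingMap.smul_apply, smul_eq_mul] at h1
  rw [h3, h2, ← zpow_add₀ two_ne_zero, ← sub_eq_zero, ← sub_mul] at h1
  refine (mul_eq_zero.1 h1).resolve_left fun h5 => hk ?_
  have h6 : (2 : ℝ) ^ (k : ℤ) = (2 : ℝ) ^ (p + q) := by
    apply Complex.ofReal_injective
    push_cast
    exact sub_eq_zero.1 h5
  exact zpow_right_injective₀ (by norm_num) (by norm_num) h6

theorem IsType.eq_zero_of_snd [FiniteDimensional ℂ V] {ι : Type*} [Fintype ι]
    (b : Module.Basis ι ℂ V) {p q : ℤ} {a : Gr V} (h : IsType p q a)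
    (hq : q < 0 ∨ (Fintype.card ι : ℤ) < q) : a = 0 := by
  rw [← conjG_conjG a, h.conjG.eq_zero b hq]
  funext k
  ext v
  exact map_zero conj

theorem IsType.contrAnti_eq_zero [FiniteDimensional ℂ V] {p : ℤ} {a : Gr V} (h : IsType p 0 a)
    (v : V) : Gr.contrAnti v a = 0 :=
  (h.contrAnti v).eq_zero_of_snd (Module.finBasis ℂ V) (Or.inl (by norm_num))

theorem IsType.contr_eq [FiniteDimensional ℂ V] {p : ℤ} {a : Gr V} (h : IsType p 0 a) (v : V) :
    contr v a = Gr.contrHol v a := by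
  rw [← contrHol_add_contrAnti, h.contrAnti_eq_zero, add_zero]

theorem ext_contr {a b : Gr V} (h0 : a 0 = b 0) (h : ∀ v, contr v a = contr v b) : a = b := by
  funext k
  rcases k with _ | k
  · exact h0
  · exact apply_succ_ext fun v => by rw [h v]

theorem contr_contr_single (a : CAlt V 2) (v w : V) :
    contr w (contr v (Pi.single 2 a : Gr V)) = a ![v, w] • one := by
  rw [contr_single_succ, contr_single_succ, one, ← Pi.single_smul]
  congr 1
  ext u
  simp only [ContinuousAlternatingMap.smul_apply, ContinuousAlternatingMap.constOfIsEmpty_apply,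
    smul_eq_mul, mul_one]
  change a (Matrix.vecCons v (Matrix.vecCons w u)) = _
  congr 1
  funext i
  fin_cases i <;> rfl

theorem smul_one_injective {z z' : ℂ} (h : z • (one : Gr V) = z' • one) : z = z' := by
  have := congrArg (fun f : Gr V => f 0 0) h
  simpa [one] using this

theorem isSymplecticMatrix_single [FiniteDimensional ℂ V] {ι : Type*} [Fintype ι] [DecidableEq ι]
    (b : Module.Basis ι ℂ V) (a : CAlt V 2) (ht : IsType 2 0 (Pi.single 2 a : Gr V))
    (hnd : ∀ v, (∀ w, a ![v, w] = 0) → v = 0) :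
    IsSymplecticMatrix b (Matrix.of fun i j => a ![b i, b j]) (Pi.single 2 a) := by
  set s : Gr V := Pi.single 2 a with hs
  have ht1 : ∀ v, IsType 1 0 (contrHol v s) := fun v => by simpa using ht.contrHol v
  have hcc : ∀ v w, contrHol w (contrHol v s) = a ![v, w] • one := fun v w => by
    rw [← (ht1 v).contr_eq, ← ht.contr_eq, contr_contr_single]
  refine ⟨ht, ?_, fun l => ?_, ?_, ?_⟩
  · rw [hs, eps_single]
    simp
  · refine ext_contr ?_ fun v => ?_
    · rw [(ht1 (b l)).apply_zero one_ne_zero, Finset.sum_apply]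
      refine (Finset.sum_eq_zero fun j _ => ?_).symm
      rw [Pi.smul_apply, coordForm, holForm, Pi.single_eq_of_ne (by norm_num), smul_zero]
    · rw [(ht1 (b l)).contr_eq, map_sum]
      simp only [map_smul, coordForm, contr_holForm, Matrix.of_apply]
      rw [← sum_coord_smul_contrHol b v]
      refine Finset.sum_congr rfl fun i _ => ?_
      rw [hcc, smul_comm]
      rfl
  · rw [isUnit_iff_ne_zero]
    intro hdet
    -- A null vector c of the matrix yields ∑ c_i b_i in the radical of the form, against
    -- non-degeneracy.
    obtain ⟨c, hc, hcM⟩ := Matrix.exists_vecMul_eq_zero_iff.2 hdet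
    have hv : ∑ i, c i • b i = 0 := by
      refine hnd _ fun w => smul_one_injective (V := V) ?_
      rw [← hcc, contrHol_sum_smul, map_sum, zero_smul]
      simp only [map_smul]
      have : ∀ l, contrHol w (contrHol (b l) s) =
          ∑ i, (b.coord i w * a ![b l, b i]) • (one : Gr V) := by
        intro l
        rw [← sum_coord_smul_contrHol b w]
        refine Finset.sum_congr rfl fun i _ => ?_
        rw [hcc, smul_smul]
      simp only [this, Finset.smul_sum, smul_smul]
      rw [Finset.sum_comm]
      refine Finset.sum_eq_zero fun i _ => ?_
      rw [← Finset.sum_smul]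
      have h1 : ∑ l, c l * a ![b l, b i] = 0 := congrFun hcM i
      have h2 : ∑ l, c l * (b.coord i w * a ![b l, b i]) =
          b.coord i w * ∑ l, c l * a ![b l, b i] := by
        rw [Finset.mul_sum]
        exact Finset.sum_congr rfl fun l _ => by ring
      rw [h2, h1, mul_zero, zero_smul]
    refine hc (funext fun i => ?_)
    have := congrArg (b.repr · i) hv
    simpa [Finsupp.single_apply] using this
  · ext i j
    refine smul_one_injective (V := V) ?_
    simp only [Matrix.transpose_apply, Matrix.neg_apply, Matrix.of_apply]
    rw [neg_smul, ← hcc, ← hcc, contrHol_contrHol]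

theorem rot_mul_rot (c d : ℂ) (a : Gr V) : rot c (rot d a) = rot (c * d) a := by
  funext k
  ext v
  simp only [rot_apply, smul_smul, _root_.mul_comm]

theorem conj_eq_inv_of_isPrimitiveRoot {z : ℂ} {N : ℕ} (hN : N ≠ 0) (hz : IsPrimitiveRoot z N) :
    conj z = z⁻¹ :=
  (Complex.inv_eq_conj (Complex.norm_eq_one_of_pow_eq_one hz.pow_eq_one hN)).symm

/-- A homogeneous form is of type `(p, q)` if a single root of unity of large order acts on it as on
forms of type `(p, q)`. -/
theorem isType_of_isPrimitiveRoot {z : ℂ} {N : ℕ} (hz : IsPrimitiveRoot z N) {k : ℕ} {p q : ℤ}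
    {a : Gr V} (ha : ∀ j ≠ k, a j = 0) (hpq : p + q = k) (hN : 2 * (|p| + k) < N)
    (h : rot z a = z ^ (p - q) • a) : IsType p q a := by
  have hN0 : N ≠ 0 := by
    rintro rfl
    have := abs_nonneg p
    omega
  have hz0 : z ≠ 0 := hz.ne_zero hN0
  have hzc := conj_eq_inv_of_isPrimitiveRoot hN0 hz
  induction k generalizing p q a with
  | zero =>
    have hr : ∀ c, rot c a = a := by
      intro c
      funext j
      ext v
      rcases j with _ | j
      · rw [rot_apply, Subsingleton.elim (fun t => c • v t) v]
      · rw [rot_apply, ha _ (by omega)]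
        rfl
    intro c hc
    rw [hr] at h ⊢
    by_cases hp : p = 0
    · obtain rfl : q = 0 := by omega
      simp [hp]
    -- Here q = -p, so z^(p - q) = z^(2p). As 0 < 2|p| < N this is not 1, while scalars act
    -- trivially in degree 0; hence a = 0.
    · have h1 : z ^ (p - q) ≠ 1 := by
        rw [Ne, hz.zpow_eq_one_iff_dvd]
        intro hd
        have := Int.le_of_dvd (abs_pos.2 (by omega)) ((dvd_abs _ _).2 hd)
        have h2 : |p - q| = 2 * |p| := by
          rw [show p - q = 2 * p by omega, abs_mul, abs_two]
        push_cast at hN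
        omega
      have h2 : (z ^ (p - q) - 1) • a = 0 := by rw [sub_smul, ← h, one_smul, sub_self]
      rw [(smul_eq_zero.1 h2).resolve_left (sub_ne_zero.2 h1), smul_zero]
  | succ k ih =>
    -- Contraction lowers k by one and raises |p| by at most one (p may become negative), so the
    -- bound on |p| + k survives the induction.
    have hH : ∀ v, IsType (p - 1) q (contrHol v a) := by
      intro v
      refine ih (fun j hj => ?_) (by push_cast at hpq; omega) ?_ ?_
      · rw [contrHol_apply, Pi.smul_apply, Pi.sub_apply, contr_apply, Pi.smul_apply, contr_apply,
          ha _ (by omega)]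
        ext w
        simp
      · have := abs_sub p 1
        rw [abs_one] at this
        push_cast at hN ⊢
        omega
      · have h1 := contrHol_rot z v a
        rw [h, map_smul] at h1
        rw [← inv_smul_smul₀ hz0 (rot z (contrHol v a)), ← h1, smul_smul,
          show p - 1 - q = p - q - 1 by ring, zpow_sub_one₀ hz0, _root_.mul_comm]
    have hA : ∀ v, IsType p (q - 1) (contrAnti v a) := by
      intro v
      refine ih (fun j hj => ?_) (by push_cast at hpq; omega) ?_ ?_
      · rw [contrAnti_apply, Pi.smul_apply, Pi.add_apply, contr_apply, Pi.smul_apply, contr_apply,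
          ha _ (by omega)]
        ext w
        simp
      · push_cast at hN ⊢
        omega
      · have h1 := contrAnti_rot z v a
        rw [h, map_smul, hzc] at h1
        rw [← inv_smul_smul₀ (inv_ne_zero hz0) (rot z (contrAnti v a)), ← h1, smul_smul, inv_inv,
          show p - (q - 1) = p - q + 1 by ring, zpow_add_one₀ hz0, _root_.mul_comm]
    intro c hc
    have hc' := conj_ne_zero hc
    refine ext_contr ?_ fun v => ?_
    · rw [Pi.smul_apply]
      change (a 0).compContinuousLinearMap _ = _
      rw [ha 0 (by omega), smul_zero]
      rfl
    · rw [← contrHol_add_contrAnti, contrHol_rot, contrAnti_rot, hH v c hc, hA v c hc, map_smul,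
        ← contrHol_add_contrAnti, smul_add, smul_smul, smul_smul, zpow_sub_one₀ hc,
        zpow_sub_one₀ hc']
      congr 2
      · field_simp
      · field_simp

end Gr

end

section

open Gr

variable {E : Type*} [NormedAddCommGroup E] [NormedSpace ℂ E] [FiniteDimensional ℂ E]
  {X : Type*} [TopologicalSpace X] [ChartedSpace E X]

namespace GForms

/-! ### Types of smooth forms -/

/-- The forms of type `(p, q)`. -/
def HasType (p q : ℤ) (A : GForms E X) : Prop := ∀ x, IsType (V := E) p q (A.1 x)

/-- The forms concentrated in degree `k`. -/
def Homog (k : ℕ) (A : GForms E X) : Prop := ∀ x, ∀ j ≠ k, A.1 x j = 0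

theorem hasType_iff {p q : ℤ} {A : GForms E X} :
    HasType p q A ↔ ∀ c : ℂ, c ≠ 0 → srot c A = (c ^ p * conj c ^ q) • A :=
  ⟨fun h c hc => GForms.ext <| funext fun x => h x c hc,
    fun h x c hc => congrArg (fun A : GForms E X => A.1 x) (h c hc)⟩

theorem HasType.homog {p q : ℤ} {k : ℕ} {A : GForms E X} (h : HasType p q A) (hk : p + q = k) :
    Homog k A := fun x j hj => (h x).apply_eq_zero (by omega)

theorem HasType.add {p q : ℤ} {A B : GForms E X} (h : HasType p q A) (h' : HasType p q B) :
    HasType p q (A + B) := fun x => (h x).add (h' x)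

theorem HasType.smul {p q : ℤ} {A : GForms E X} (h : HasType p q A) (c : ℂ) :
    HasType p q (c • A) := fun x => (h x).smul c

theorem HasType.neg {p q : ℤ} {A : GForms E X} (h : HasType p q A) : HasType p q (-A) := by
  have := h.smul (-1)
  rwa [neg_smul, one_smul] at this

theorem HasType.sub {p q : ℤ} {A B : GForms E X} (h : HasType p q A) (h' : HasType p q B) :
    HasType p q (A - B) := by
  rw [sub_eq_add_neg]
  exact h.add h'.neg

theorem HasType.sconj {p q : ℤ} {A : GForms E X} (h : HasType p q A) : HasType q p (sconj A) :=
  fun x => (h x).conjG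

theorem HasType.lmul {p q p' q' : ℤ} {A B : GForms E X} (h : HasType p q A)
    (h' : HasType p' q' B) : HasType (p + p') (q + q') (lmul A B) := fun x => (h x).mul (h' x)

variable [IsManifold 𝓘(ℂ, E) ω X]

theorem HasType.sdel {p q : ℤ} {A : GForms E X} (h : HasType p q A) :
    HasType (p + 1) q (sdel A) := by
  rw [hasType_iff] at h ⊢
  intro c hc
  rw [srot_sdel, h c hc, map_smul, smul_smul, zpow_add_one₀ hc]
  congr 1
  ring

theorem HasType.sdelbar {p q : ℤ} {A : GForms E X} (h : HasType p q A) :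
    HasType p (q + 1) (sdelbar A) := by
  rw [hasType_iff] at h ⊢
  intro c hc
  rw [srot_sdelbar, h c hc, map_smul, smul_smul, zpow_add_one₀ (conj_ne_zero hc)]
  congr 1
  ring

/-! ### Components of graded forms -/

/-- The component of degree `k`. -/
def comp (k : ℕ) (A : GForms E X) : DForm E X k := fun x => A.1 x k

theorem isSmooth_comp (k : ℕ) (A : GForms E X) : IsSmooth (comp k A) := fun x₀ => A.2 x₀ k

theorem comp_sdel (k : ℕ) (A : GForms E X) : comp (k + 1) (sdel A) = CplxSympl.del (comp k A) := rfl

theorem comp_sdelbar (k : ℕ) (A : GForms E X) :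
    comp (k + 1) (sdelbar A) = CplxSympl.delbar (comp k A) := rfl

theorem Homog.ext {k : ℕ} {A B : GForms E X} (hA : Homog k A) (hB : Homog k B)
    (h : comp k A = comp k B) : A = B :=
  GForms.ext <| funext fun x => funext fun j => by
    by_cases hj : j = k
    · subst hj
      exact congrFun h x
    · rw [hA x j hj, hB x j hj]

theorem Homog.add {k : ℕ} {A B : GForms E X} (hA : Homog k A) (hB : Homog k B) : Homog k (A + B) :=
  fun x j hj => by
    change A.1 x j + B.1 x j = 0
    rw [hA x j hj, hB x j hj, add_zero]

theorem Homog.smul {k : ℕ} {A : GForms E X} (hA : Homog k A) (c : ℂ) : Homog k (c • A) :=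
  fun x j hj => by
    change c • A.1 x j = 0
    rw [hA x j hj, smul_zero]

theorem Homog.srot {k : ℕ} {A : GForms E X} (hA : Homog k A) (c : ℂ) : Homog k (srot c A) :=
  fun x j hj => by
    change (A.1 x j).compContinuousLinearMap _ = 0
    rw [hA x j hj]
    rfl

theorem Homog.sum {ι : Type*} {s : Finset ι} {k : ℕ} {A : ι → GForms E X}
    (hA : ∀ i ∈ s, Homog k (A i)) : Homog k (∑ i ∈ s, A i) := by
  classical
  induction s using Finset.induction_on with
  | empty => exact fun x j hj => rfl
  | insert i s hi ih =>
    rw [Finset.sum_insert hi]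
    exact (hA i (Finset.mem_insert_self i s)).add
      (ih fun j hj => hA j (Finset.mem_insert_of_mem hj))

theorem comp_zero (k : ℕ) : comp k (0 : GForms E X) = 0 := rfl

theorem del_zero {k : ℕ} : CplxSympl.del (0 : DForm E X k) = 0 := by
  rw [← comp_zero, ← comp_sdel, map_zero, comp_zero]

theorem Homog.sdel {k : ℕ} {A : GForms E X} (hA : Homog k A) : Homog (k + 1) (sdel A) := by
  intro x j hj
  rcases j with _ | j
  · ext v
    rfl
  · have h0 : comp j A = 0 := funext fun x => hA x j (by omega)
    exact congrFun ((comp_sdel j A).trans (by rw [h0, del_zero])) x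

theorem Homog.sdelbar {k : ℕ} {A : GForms E X} (hA : Homog k A) : Homog (k + 1) (sdelbar A) := by
  intro x j hj
  rcases j with _ | j
  · ext v
    rfl
  · have h0 : comp j A = 0 := funext fun x => hA x j (by omega)
    exact congrFun ((comp_sdelbar j A).trans (by rw [h0, delbar_zero])) x

/-- A smooth form of degree `k`, as a graded form. -/
def ofForm {k : ℕ} (α : DForm E X k) (hα : IsSmooth α) : GForms E X :=
  ⟨fun x => Pi.single k (α x : CAlt E k), (smoothForm_iff _).2 fun j => by
    by_cases hj : j = k
    · subst hj
      have : (fun x => (Pi.single j (α x : CAlt E j) : Gr E) j : DForm E X j) = α :=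
        funext fun x => Pi.single_eq_same (M := fun k => CAlt E k) j (α x)
      rwa [this]
    · have : (fun x => (Pi.single k (α x : CAlt E k) : Gr E) j : DForm E X j) = 0 :=
        funext fun x => Pi.single_eq_of_ne (M := fun k => CAlt E k) hj (α x)
      rw [this]
      exact IsSmooth.zero⟩

theorem comp_ofForm {k : ℕ} (α : DForm E X k) (hα : IsSmooth α) : comp k (ofForm α hα) = α :=
  funext fun x => Pi.single_eq_same (M := fun k => CAlt E k) k (α x)

theorem homog_ofForm {k : ℕ} (α : DForm E X k) (hα : IsSmooth α) : Homog k (ofForm α hα) :=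
  fun x _ hj => Pi.single_eq_of_ne (M := fun k => CAlt E k) hj (α x)

theorem hasType_ofForm {p q k : ℕ} {α : DForm E X k} (hα : IsSmooth α) (h : IsOfType p q α) :
    HasType p q (ofForm α hα) := by
  rw [hasType_iff]
  intro c hc
  refine Homog.ext ((homog_ofForm α hα).srot c) ((homog_ofForm α hα).smul _) ?_
  funext x
  have e : (ofForm α hα).1 x k = α x := congrFun (comp_ofForm α hα) x
  ext v
  change (ofForm α hα).1 x k (fun t => c • v t) =
    (c ^ (p : ℤ) * conj c ^ (q : ℤ)) * (ofForm α hα).1 x k v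
  rw [e, zpow_natCast, zpow_natCast]
  exact h.2 x c v

theorem HasType.isOfType {p q k : ℕ} {A : GForms E X} (h : HasType p q A) (hk : k = p + q) :
    IsOfType p q (comp k A) := by
  refine ⟨hk, fun x c v => ?_⟩
  -- `IsType` tests only nonzero scalars. For c = 0 both sides vanish in positive degree, and in
  -- degree 0 the factor is 0^0 · 0^0 = 1.
  by_cases hc : c = 0
  · subst hc
    rcases k with _ | k
    · obtain rfl : p = 0 := by omega
      obtain rfl : q = 0 := by omega
      rw [Subsingleton.elim (fun t => (0 : ℂ) • v t) v]
      simp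
    · have h1 : (0 : ℂ) ^ p * conj (0 : ℂ) ^ q = 0 := by
        rw [map_zero, ← pow_add, ← hk, zero_pow (by omega)]
      rw [h1, zero_mul]
      exact (comp (k + 1) A x).map_coord_zero 0 (zero_smul _ _)
  · have := congrArg (fun f : Gr E => f k v) (h x c hc)
    simp only [zpow_natCast] at this
    exact this

/-! ### Projection to forms of a given type -/

/-- The average projecting to the forms of type `(p, q)` with `p - q = m`. -/
def sproj (z : ℂ) (N : ℕ) (m : ℤ) (A : GForms E X) : GForms E X :=
  (N : ℂ)⁻¹ • ∑ j ∈ Finset.range N, (z ^ j) ^ (-m) • srot (z ^ j) A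

theorem sproj_add (z : ℂ) (N : ℕ) (m : ℤ) (A B : GForms E X) :
    sproj z N m (A + B) = sproj z N m A + sproj z N m B := by
  simp only [sproj, map_add, smul_add, Finset.sum_add_distrib]

theorem Homog.sproj {k : ℕ} {A : GForms E X} (hA : Homog k A) (z : ℂ) (N : ℕ) (m : ℤ) :
    Homog k (sproj z N m A) :=
  (Homog.sum fun _ _ => (hA.srot _).smul _).smul _

theorem srot_srot (c d : ℂ) (A : GForms E X) : srot c (srot d A) = srot (c * d) A :=
  GForms.ext <| funext fun x => rot_mul_rot c d (A.1 x)

section PrimitiveRoot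

variable {z : ℂ} {N : ℕ}

/-- Rotation by z shifts the index of the average by one, and the average is cyclic since z^N = 1.
-/
theorem srot_sproj (hz : IsPrimitiveRoot z N) (hN : N ≠ 0) (m : ℤ) (A : GForms E X) :
    srot z (sproj z N m A) = z ^ m • sproj z N m A := by
  have hz0 : z ≠ 0 := hz.ne_zero hN
  set f : ℕ → GForms E X := fun j => (z ^ j) ^ (-m) • srot (z ^ j) A with hf
  have h1 : ∀ j, srot z (f j) = z ^ m • f (j + 1) := by
    intro j
    rw [hf]
    dsimp only
    rw [map_smul, srot_srot, smul_smul, pow_succ' z j, mul_zpow, ← _root_.mul_assoc,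
      ← zpow_add₀ hz0, add_neg_cancel, zpow_zero, _root_.one_mul]
  have h2 : f N = f 0 := by
    rw [hf]
    dsimp only
    rw [hz.pow_eq_one, pow_zero]
  have h3 : ∑ j ∈ Finset.range N, f (j + 1) = ∑ j ∈ Finset.range N, f j := by
    have := (Finset.sum_range_succ' f N).symm.trans (Finset.sum_range_succ f N)
    rw [h2] at this
    exact add_right_cancel this
  have h4 : sproj z N m A = (N : ℂ)⁻¹ • ∑ j ∈ Finset.range N, f j := rfl
  rw [h4, map_smul, map_sum, Finset.sum_congr rfl fun j _ => h1 j, ← Finset.smul_sum, h3,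
    smul_comm]

theorem sproj_of_hasType (hz : IsPrimitiveRoot z N) (hN : N ≠ 0) {p q : ℤ} {A : GForms E X}
    (h : HasType p q A) (m : ℤ) : sproj z N m A =
      ((N : ℂ)⁻¹ * ∑ j ∈ Finset.range N, (z ^ (p - q - m)) ^ j) • A := by
  have hz0 : z ≠ 0 := hz.ne_zero hN
  have hzc := conj_eq_inv_of_isPrimitiveRoot hN hz
  rw [sproj, mul_smul, Finset.sum_smul]
  congr 1
  refine Finset.sum_congr rfl fun j _ => ?_
  rw [hasType_iff.1 h _ (pow_ne_zero j hz0), smul_smul, map_pow, hzc, inv_pow, inv_zpow,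
    ← zpow_neg, ← zpow_add₀ (pow_ne_zero j hz0), ← zpow_add₀ (pow_ne_zero j hz0),
    ← zpow_natCast z j, ← zpow_natCast (z ^ _) j, ← zpow_mul, ← zpow_mul]
  congr 2
  ring

theorem sproj_eq_self (hz : IsPrimitiveRoot z N) (hN : N ≠ 0) {p q m : ℤ} {A : GForms E X}
    (h : HasType p q A) (hm : p - q = m) : sproj z N m A = A := by
  rw [sproj_of_hasType hz hN h, hm, sub_self, zpow_zero]
  simp only [one_pow, Finset.sum_const, Finset.card_range, nsmul_eq_mul, mul_one]
  rw [inv_mul_cancel₀ (by exact_mod_cast hN), one_smul]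

theorem sproj_eq_zero (hz : IsPrimitiveRoot z N) (hN : N ≠ 0) {p q m : ℤ} {A : GForms E X}
    (h : HasType p q A) (hm : ¬ (N : ℤ) ∣ p - q - m) : sproj z N m A = 0 := by
  rw [sproj_of_hasType hz hN h]
  have h1 : z ^ (p - q - m) ≠ 1 := fun h => hm ((hz.zpow_eq_one_iff_dvd _).1 h)
  have h2 : (z ^ (p - q - m)) ^ N = 1 := by
    rw [← zpow_natCast, ← zpow_mul, _root_.mul_comm, zpow_mul, zpow_natCast, hz.pow_eq_one,
      one_zpow]
  rw [geom_sum_eq h1, h2, sub_self, zero_div, mul_zero, zero_smul]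

/-- The operator ∂∂̄ has bidegree (1, 1), so rotations by c of modulus one commute with it: the
factor is c c̄ = 1. -/
theorem sproj_sdel_sdelbar (hz : IsPrimitiveRoot z N) (hN : N ≠ 0) (m : ℤ) (A : GForms E X) :
    sproj z N m (sdel (sdelbar A)) = sdel (sdelbar (sproj z N m A)) := by
  have hz0 : z ≠ 0 := hz.ne_zero hN
  have hzc := conj_eq_inv_of_isPrimitiveRoot hN hz
  have h1 : ∀ j, srot (z ^ j) (sdel (sdelbar A)) = sdel (sdelbar (srot (z ^ j) A)) := by
    intro j
    rw [srot_sdel, srot_sdelbar, map_smul, smul_smul, map_pow, hzc, ← mul_pow, mul_inv_cancel₀ hz0,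
      one_pow, one_smul]
  rw [sproj, sproj, map_smul, map_smul, map_sum, map_sum]
  refine congrArg _ (Finset.sum_congr rfl fun j _ => ?_)
  rw [map_smul, map_smul, h1]

end PrimitiveRoot

/-- The `(p + 1, q + 1)`-part of an equation `A + B = ∂∂̄Z`. -/
theorem exists_hasType_of_add_eq {p q : ℕ} {p' q' : ℤ} {A B Z : GForms E X}
    (hA : HasType (p + 1) (q + 1) A) (hB : HasType p' q' B)
    (hpq : p' - q' = p - q + 2 ∨ p' - q' = p - q - 2) (hZ : Homog (p + q) Z)
    (h : A + B = sdel (sdelbar Z)) : ∃ C, HasType p q C ∧ A = sdel (sdelbar C) := by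
  -- Large enough for a root of unity to recognise type (p, q) in degree p + q, and larger than 2,
  -- so that differences of ±2 are not divisible by N.
  set N := 2 * (p + (p + q)) + 3 with hNd
  have hN : N ≠ 0 := by omega
  have hz := Complex.isPrimitiveRoot_exp N hN
  set z := Complex.exp (2 * Real.pi * Complex.I / N)
  refine ⟨sproj z N (p - q) Z, fun x => ?_, ?_⟩
  · refine isType_of_isPrimitiveRoot hz (k := p + q) (hZ.sproj z N _ x) (by push_cast; rfl) ?_ ?_
    · rw [Nat.abs_cast, hNd]
      push_cast
      omega
    · exact congrArg (fun A : GForms E X => A.1 x) (srot_sproj hz hN (p - q) Z)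
  · have h1 := congrArg (sproj z N (p - q)) h
    rwa [sproj_add, sproj_eq_self hz hN hA (by ring), sproj_eq_zero hz hN hB, add_zero,
      sproj_sdel_sdelbar hz hN] at h1
    -- The index p' - q' of B differs from that of A by ±2, which is not a multiple of N ≥ 3; so the
    -- projection kills B.
    rintro ⟨t, ht⟩
    have h3 : (3 : ℤ) ≤ N := by
      rw [hNd]
      push_cast
      omega
    have h4 : t = 0 ∨ 1 ≤ t ∨ t ≤ -1 := by omega
    rcases h4 with rfl | h4 | h4
    · omega
    · have := mul_le_mul_of_nonneg_left h4 (by omega : (0 : ℤ) ≤ N)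
      omega
    · have := mul_le_mul_of_nonneg_left h4 (by omega : (0 : ℤ) ≤ N)
      omega

/-! ### Consequences of the `∂∂̄`-lemma -/

/-- If ∂∂̄B = 0 then dB is closed under both ∂ and ∂̄ and is d-exact, so the hypothesis on X applies
to it. The form Z has a degree but no type yet. -/
theorem exists_ext_d_eq_sdel_sdelbar (hX : SatisfiesDelDelbarLemma E X) {k : ℕ} {B : GForms E X}
    (hB : Homog (k + 1) B) (h : sdel (sdelbar B) = 0) :
    ∃ Z, Homog k Z ∧ sdel B + sdelbar B = sdel (sdelbar Z) := by
  set D := sdel B + sdelbar B with hD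
  have h1 : sdel D = 0 := by rw [hD, map_add, sdel_sdel, h, add_zero]
  have h2 : sdelbar D = 0 := by rw [hD, map_add, sdelbar_sdel, h, sdelbar_sdelbar, neg_zero, add_zero]
  obtain ⟨γ, hγ, hγ'⟩ := (hX (k + 2) (comp (k + 2) D) (isSmooth_comp _ _)).1
    ⟨by rw [← comp_sdel, h1, comp_zero], by rw [← comp_sdelbar, h2, comp_zero],
      comp (k + 1) B, isSmooth_comp _ _, by
        rw [extD_eq_del_add_delbar, ← comp_sdel, ← comp_sdelbar]
        rfl⟩
  refine ⟨ofForm γ hγ, homog_ofForm γ hγ, Homog.ext (hB.sdel.add hB.sdelbar)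
    (homog_ofForm γ hγ).sdelbar.sdel ?_⟩
  rw [comp_sdel, comp_sdelbar, comp_ofForm]
  exact hγ'

/-- The form ∂̄B is not given as d-exact, but it is the (p + 1, q + 1)-part of dB = ∂∂̄Z. The other
part ∂B has type (p + 2, q) and is removed by projection. -/
theorem exists_eq_sdel_sdelbar_of_eq_sdelbar (hX : SatisfiesDelDelbarLemma E X) {p q : ℕ}
    {B : GForms E X} (hB : HasType (p + 1) q B) (h : sdel (sdelbar B) = 0) :
    ∃ C, HasType p q C ∧ sdelbar B = sdel (sdelbar C) := by
  obtain ⟨Z, hZ, hZ'⟩ := exists_ext_d_eq_sdel_sdelbar hX (k := p + q)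
    (hB.homog (by push_cast; ring)) h
  rw [add_comm] at hZ'
  exact exists_hasType_of_add_eq hB.sdelbar hB.sdel (Or.inl (by ring)) hZ hZ'

theorem exists_eq_sdel_sdelbar_of_eq_sdel (hX : SatisfiesDelDelbarLemma E X) {p q : ℕ}
    {B : GForms E X} (hB : HasType p (q + 1) B) (h : sdel (sdelbar B) = 0) :
    ∃ C, HasType p q C ∧ sdel B = sdel (sdelbar C) := by
  obtain ⟨Z, hZ, hZ'⟩ := exists_ext_d_eq_sdel_sdelbar hX (k := p + q)
    (hB.homog (by push_cast; ring)) h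
  exact exists_hasType_of_add_eq hB.sdel hB.sdelbar (Or.inr (by ring)) hZ hZ'

/-- A `∂̄`-closed form has a `d`-closed representative. -/
theorem exists_sdel_sub_sdelbar_eq_zero (hX : SatisfiesDelDelbarLemma E X) {p q : ℕ}
    {A : GForms E X} (hA : HasType p (q + 1) A) (h : sdelbar A = 0) :
    ∃ C, HasType p q C ∧ sdel (A - sdelbar C) = 0 := by
  obtain ⟨C, hC, hC'⟩ := exists_eq_sdel_sdelbar_of_eq_sdel hX hA (by rw [h, map_zero])
  exact ⟨C, hC, by rw [map_sub, hC', sub_self]⟩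

/-- A `∂`-closed form differs from a `d`-closed one by a `∂`-exact form. -/
theorem exists_sdelbar_sub_sdel_eq_zero (hX : SatisfiesDelDelbarLemma E X) {p q : ℕ}
    {A : GForms E X} (hA : HasType (p + 1) q A) (h : sdel A = 0) :
    ∃ C, HasType p q C ∧ sdelbar (A - sdel C) = 0 := by
  obtain ⟨C, hC, hC'⟩ := exists_eq_sdel_sdelbar_of_eq_sdelbar hX hA (by
    rw [← neg_eq_zero, ← sdelbar_sdel, h, map_zero])
  exact ⟨-C, hC.neg, by rw [map_sub, map_neg, map_neg, sdelbar_sdel, hC', neg_neg, sub_self]⟩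

end GForms

end

section

open Gr

/-! ### The Lefschetz operator of a complex symplectic form -/

section

variable {V : Type*} [NormedAddCommGroup V] [NormedSpace ℂ V]

theorem Gr.IsType.eq_zero_of_ne {p q p' q' : ℤ} {a : Gr V} (h : IsType p q a)
    (h' : IsType p' q' a) (hp : p ≠ p') : a = 0 := by
  obtain ⟨c, hc, hne⟩ := exists_zpow_mul_conj_zpow_ne_one (p := p - p') (q := q - q')
    (sub_ne_zero.2 hp)
  have hc' := conj_ne_zero hc
  have h1 : (c ^ p * conj c ^ q) • a = (c ^ p' * conj c ^ q') • a := (h c hc).symm.trans (h' c hc)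
  rw [← sub_eq_zero, ← sub_smul] at h1
  refine (smul_eq_zero.1 h1).resolve_left fun h2 => hne ?_
  rw [zpow_sub₀ hc, zpow_sub₀ hc']
  have h3 := sub_eq_zero.1 h2
  have h4 := zpow_ne_zero p' hc
  have h5 := zpow_ne_zero q' hc'
  field_simp
  exact h3

theorem Gr.pull_mul_pow {W : Type*} [NormedAddCommGroup W] [NormedSpace ℂ W] (f : W →L[ℝ] V)
    (s a : Gr V) (m : ℕ) : pull f ((mul s ^ m : Module.End ℂ (Gr V)) a) =
      (mul (pull f s) ^ m : Module.End ℂ (Gr W)) (pull f a) := by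
  induction m with
  | zero => simp
  | succ m ih =>
    rw [pow_succ', pow_succ', Module.End.mul_apply, Module.End.mul_apply, pull_mul, ih]

theorem Gr.IsType.pull [FiniteDimensional ℂ V] {p q : ℤ} {a : Gr V} (h : IsType p q a) (f : V →L[ℂ] V) :
    IsType p q (Gr.pull (f.restrictScalars ℝ) a) := by
  intro c hc
  rw [← pull_rot, h c hc, map_smul]

theorem Gr.SmoothOn.apply {τ : V → Gr V} {s : Set V} [FiniteDimensional ℂ V] (hτ : SmoothOn τ s)
    {k : ℕ} (v : Fin k → V) : ContDiffOn ℝ ∞ (fun z => τ z k v) s := by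
  let ev : CAlt V k →ₗ[ℝ] ℂ :=
    { toFun := fun a => a v
      map_add' := fun _ _ => rfl
      map_smul' := fun _ _ => rfl }
  exact (LinearMap.toContinuousLinearMap ev).contDiff.comp_contDiffOn (hτ k)

end

variable {E : Type*} [NormedAddCommGroup E] [NormedSpace ℂ E] [FiniteDimensional ℂ E]
  {X : Type*} [TopologicalSpace X] [ChartedSpace E X] [IsManifold 𝓘(ℂ, E) ω X]

theorem symmD_bijective (x₀ : X) {y : E} (hy : y ∈ (chartAt E x₀).target) :
    Function.Bijective (symmD x₀ y) := by
  have h := (mdifferentiable_chart (I := 𝓘(ℂ, E)) x₀).comp_symm_deriv hy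
  have hinj : Function.Injective (symmD x₀ y) := by
    refine Function.LeftInverse.injective
      (g := (mfderiv 𝓘(ℂ, E) 𝓘(ℂ, E) (chartAt E x₀) ((chartAt E x₀).symm y) : E → E)) fun v => ?_
    exact congrArg (fun f => f v) h
  exact ⟨hinj, LinearMap.injective_iff_surjective (f := (symmD x₀ y : E →ₗ[ℂ] E)).1 hinj⟩

namespace GForms

theorem lmul_pow_val (S A : GForms E X) (m : ℕ) (x : X) :
    ((lmul S ^ m : Module.End ℂ (GForms E X)) A).1 x =
      (mul (V := E) (S.1 x) ^ m : Module.End ℂ (Gr E)) (A.1 x) := by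
  induction m with
  | zero => rfl
  | succ m ih =>
    rw [pow_succ', pow_succ', Module.End.mul_apply, Module.End.mul_apply, ← ih]
    rfl

theorem sconj_lmul_pow (S A : GForms E X) (m : ℕ) :
    sconj ((lmul S ^ m : Module.End ℂ (GForms E X)) A) =
      (lmul (sconj S) ^ m : Module.End ℂ (GForms E X)) (sconj A) := by
  induction m with
  | zero => rfl
  | succ m ih =>
    rw [pow_succ', pow_succ', Module.End.mul_apply, Module.End.mul_apply, ← ih, sconj_lmul]

theorem HasType.lmul_pow {p q p' q' : ℤ} {S A : GForms E X} (hS : HasType p q S)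
    (hA : HasType p' q' A) (m : ℕ) :
    HasType (m * p + p') (m * q + q') ((GForms.lmul S ^ m : Module.End ℂ (GForms E X)) A) := by
  induction m with
  | zero => simpa using hA
  | succ m ih =>
    rw [pow_succ', Module.End.mul_apply]
    have := hS.lmul ih
    convert this using 1 <;> push_cast <;> ring

/-- The properties of the graded form given by a complex symplectic form. -/
structure IsSymplectic (S : GForms E X) : Prop where
  type : HasType 2 0 S
  sdel_eq : sdel S = 0
  sdelbar_eq : sdelbar S = 0
  nondegenerate : ∀ (x : X) (v : E), (∀ w : E, (S.1 x 2 : CAlt E 2) ![v, w] = 0) → v = 0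

theorem isSymplectic_ofForm {σ : DForm E X 2} (hσ : IsComplexSymplectic σ) :
    IsSymplectic (ofForm σ hσ.smooth) := by
  set S := ofForm σ hσ.smooth with hS
  have ht : HasType 2 0 S := hasType_ofForm hσ.smooth hσ.type
  have hc : comp 2 S = σ := comp_ofForm _ _
  have h1 : sdel S + sdelbar S = 0 := by
    refine Homog.ext (k := 3) ((homog_ofForm _ _).sdel.add (homog_ofForm _ _).sdelbar)
      (fun _ _ _ => rfl) ?_
    have := hσ.closed
    rw [extD_eq_del_add_delbar, ← hc, ← comp_sdel, ← comp_sdelbar] at this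
    exact this
  have h2 : sdel S = 0 := by
    -- By closedness ∂S = -∂̄S, so this form has both types (3, 0) and (2, 1) and must vanish.
    refine GForms.ext <| funext fun x => (ht.sdel x).eq_zero_of_ne (p' := 2) (q' := 1) ?_
      (by norm_num)
    have : sdel S = -sdelbar S := eq_neg_of_add_eq_zero_left h1
    rw [this]
    exact ht.sdelbar.neg x
  refine ⟨ht, h2, by rwa [h2, zero_add] at h1, fun x v hv => hσ.nondegenerate x v fun w => ?_⟩
  rw [← hc]
  exact hv w

namespace IsSymplectic

variable {S : GForms E X}

theorem eq_single (hS : IsSymplectic S) (x : X) :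
    S.1 x = Pi.single (M := fun k => CAlt E k) 2 (S.1 x 2) := by
  funext j
  by_cases hj : j = 2
  · subst hj
    rw [Pi.single_eq_same]
  · rw [Pi.single_eq_of_ne hj]
    exact (hS.type x).apply_eq_zero (by omega)

theorem even (hS : IsSymplectic S) (x : X) : eps (V := E) (S.1 x) = S.1 x := by
  rw [hS.eq_single x, eps_single]
  simp

/-- The matrix of a symplectic form with respect to a fixed basis, at a point of the manifold. -/
theorem isSymplecticMatrix (hS : IsSymplectic S) (x : X) :
    IsSymplecticMatrix (Module.finBasis ℂ E)
      (Matrix.of fun i j => (S.1 x 2 : CAlt E 2) ![Module.finBasis ℂ E i, Module.finBasis ℂ E j])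
      (S.1 x) := by
  have h := isSymplecticMatrix_single (Module.finBasis ℂ E) (S.1 x 2 : CAlt E 2)
    (by rw [← hS.eq_single x]; exact hS.type x) (hS.nondegenerate x)
  rwa [← hS.eq_single x] at h

/-- The matrix of a symplectic form with respect to a fixed basis, in a chart. -/
theorem isSymplecticMatrix_loc (hS : IsSymplectic S) (x₀ : X) {y : E}
    (hy : y ∈ (chartAt E x₀).target) :
    IsSymplecticMatrix (Module.finBasis ℂ E)
      (Matrix.of fun i j => loc S.1 x₀ y 2 ![Module.finBasis ℂ E i, Module.finBasis ℂ E j])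
      (loc S.1 x₀ y) := by
  have h1 : loc S.1 x₀ y = Pi.single 2 (loc S.1 x₀ y 2) := by
    funext j
    by_cases hj : j = 2
    · subst hj
      rw [Pi.single_eq_same]
    · rw [Pi.single_eq_of_ne hj]
      exact ((hS.type _).pull _).apply_eq_zero (by omega)
  have h2 : IsType 2 0 (loc S.1 x₀ y) := (hS.type _).pull _
  have h := isSymplecticMatrix_single (Module.finBasis ℂ E) (loc S.1 x₀ y 2) (by rwa [← h1]) ?_
  · rwa [← h1] at h
  · intro v hv
    obtain ⟨hi, hs⟩ := symmD_bijective x₀ hy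
    refine hi ((hS.nondegenerate ((chartAt E x₀).symm y) _ fun w => ?_).trans (map_zero (symmD x₀ y)).symm)
    obtain ⟨w, rfl⟩ := hs w
    rw [← hv w]
    change _ = (S.1 ((chartAt E x₀).symm y) 2 : CAlt E 2) (fun t => symmD x₀ y (![v, w] t))
    congr 1
    funext t
    fin_cases t <;> rfl

theorem sdel_lmul_pow (hS : IsSymplectic S) (A : GForms E X) (m : ℕ) :
    sdel ((lmul S ^ m : Module.End ℂ (GForms E X)) A) =
      (lmul S ^ m : Module.End ℂ (GForms E X)) (sdel A) := by
  induction m with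
  | zero => rfl
  | succ m ih =>
    rw [pow_succ', Module.End.mul_apply, Module.End.mul_apply, sdel_lmul hS.even hS.sdel_eq, ih]

theorem sdelbar_lmul_pow (hS : IsSymplectic S) (A : GForms E X) (m : ℕ) :
    sdelbar ((lmul S ^ m : Module.End ℂ (GForms E X)) A) =
      (lmul S ^ m : Module.End ℂ (GForms E X)) (sdelbar A) := by
  induction m with
  | zero => rfl
  | succ m ih =>
    rw [pow_succ', Module.End.mul_apply, Module.End.mul_apply, sdelbar_lmul hS.even hS.sdelbar_eq,
      ih]

theorem sdel_lmul_sconj_pow (hS : IsSymplectic S) (A : GForms E X) (m : ℕ) :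
    sdel ((lmul (sconj S) ^ m : Module.End ℂ (GForms E X)) A) =
      (lmul (sconj S) ^ m : Module.End ℂ (GForms E X)) (sdel A) := by
  rw [← sconj_sconj A, ← sconj_lmul_pow, ← sconj_sdelbar, hS.sdelbar_lmul_pow, sconj_lmul_pow,
    sconj_sdelbar]

theorem sdelbar_lmul_sconj_pow (hS : IsSymplectic S) (A : GForms E X) (m : ℕ) :
    sdelbar ((lmul (sconj S) ^ m : Module.End ℂ (GForms E X)) A) =
      (lmul (sconj S) ^ m : Module.End ℂ (GForms E X)) (sdelbar A) := by
  rw [← sconj_sconj A, ← sconj_lmul_pow, ← sconj_sdel, hS.sdel_lmul_pow, sconj_lmul_pow,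
    sconj_sdel]

section Bijective

variable {m : ℕ}

theorem card_fin_finrank (hE : Module.finrank ℂ E = 2 * (m + 1)) :
    Fintype.card (Fin (Module.finrank ℂ E)) = 2 * (m + 1) := by rw [Fintype.card_fin, hE]

theorem eq_zero_of_lmul_pow_eq_zero (hS : IsSymplectic S)
    (hE : Module.finrank ℂ E = 2 * (m + 1)) {q : ℤ} {A : GForms E X} (hA : HasType 1 q A)
    (h : (lmul S ^ m : Module.End ℂ (GForms E X)) A = 0) : A = 0 := by
  refine GForms.ext <| funext fun x => ?_
  have h1 := (hS.isSymplecticMatrix x).lam_pow_mul_pow (card_fin_finrank hE) (hA x) m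
  rw [← lmul_pow_val, h] at h1
  have h2 : ((0 : GForms E X).1 x) = (0 : Gr E) := rfl
  rw [h2, map_zero] at h1
  exact (smul_eq_zero.1 h1.symm).resolve_left (prod_lefschetz_ne_zero (m + 1))

theorem exists_lmul_pow_eq (hS : IsSymplectic S)
    (hE : Module.finrank ℂ E = 2 * (m + 1)) {q : ℤ} {B : GForms E X}
    (hB : HasType (2 * m + 1) q B) :
    ∃ A, HasType 1 q A ∧ (lmul S ^ m : Module.End ℂ (GForms E X)) A = B := by
  set b := Module.finBasis ℂ E
  have hB' : ∀ x, IsType (V := E) (2 * (m + 1 : ℕ) - 1) q (B.1 x) := fun x => by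
    have := hB x
    convert this using 1
    push_cast
    ring
  set C : ℂ := ∏ t ∈ Finset.range m, (2 * (t + 1) * (t + 1 - (m + 1 : ℕ)) : ℂ) with hC
  have hC0 : C ≠ 0 := prod_lefschetz_ne_zero (m + 1)
  set M : X → Matrix _ _ ℂ := fun x => Matrix.of fun i j => (S.1 x 2 : CAlt E 2) ![b i, b j]
  -- The pointwise inverse of L^m. It uses a fixed basis of the model space read in the preferred
  -- chart of x, which may jump with x, so smoothness is not evident from the formula.
  set A : X → Gr E := fun x => C⁻¹ • (lam b (dualVec b (M x)) ^ m) (B.1 x) with hAdef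
  have hLA : ∀ x, (mul (V := E) (S.1 x) ^ m : Module.End ℂ (Gr E)) (A x) = B.1 x := by
    intro x
    rw [hAdef]
    dsimp only
    rw [map_smul, (hS.isSymplecticMatrix x).pow_mul_lam_pow (card_fin_finrank hE) (hB' x) m,
      inv_smul_smul₀ hC0]
  have hAt : ∀ x, IsType 1 q (A x) := fun x => by
    have := ((hB x).lam_pow b (dualVec b (M x)) m).smul C⁻¹
    convert this using 1
    ring
  have hAs : SmoothForm A := by
    intro x₀
    -- In one fixed chart the matrix of S varies smoothly, and the corresponding contraction gives a
    -- smooth candidate. It coincides with the local expression of A because it also inverts L^m,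
    -- which is injective on type (1, q).
    set M' : E → Matrix _ _ ℂ := fun y => Matrix.of fun i j => loc S.1 x₀ y 2 ![b i, b j] with hM'
    have hsm : SmoothOn (fun y => C⁻¹ • (lam b (dualVec b (M' y)) ^ m) (loc B.1 x₀ y))
        (chartAt E x₀).target := by
      refine SmoothOn.const_smul (SmoothOn.lam_dualVec_pow (fun i j => ?_) (fun y hy => ?_) b
        (B.2 x₀) m) _
      · exact (S.2 x₀).apply _
      · exact (hS.isSymplecticMatrix_loc x₀ hy).det
    refine hsm.congr fun y hy => ?_
    have h1 := (hS.isSymplecticMatrix_loc x₀ hy).lam_pow_mul_pow (card_fin_finrank hE)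
      ((hAt ((chartAt E x₀).symm y)).pull (symmD x₀ y)) m
    have h2 := pull_mul_pow ((symmD x₀ y).restrictScalars ℝ) (S.1 ((chartAt E x₀).symm y))
      (A ((chartAt E x₀).symm y)) m
    rw [hLA] at h2
    rw [loc] at h1
    rw [← h2, ← hC] at h1
    exact ((congrArg (C⁻¹ • ·) h1).trans (inv_smul_smul₀ hC0 _)).symm
  refine ⟨⟨A, hAs⟩, hAt, GForms.ext <| funext fun x => ?_⟩
  rw [lmul_pow_val]
  exact hLA x

theorem eq_zero_of_lmul_sconj_pow_eq_zero (hS : IsSymplectic S)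
    (hE : Module.finrank ℂ E = 2 * (m + 1)) {p : ℤ} {A : GForms E X} (hA : HasType p 1 A)
    (h : (lmul (sconj S) ^ m : Module.End ℂ (GForms E X)) A = 0) : A = 0 := by
  have h1 : (lmul S ^ m : Module.End ℂ (GForms E X)) (GForms.sconj A) = 0 := by
    rw [← sconj_sconj S, ← sconj_lmul_pow, h, sconj_zero]
  rw [← sconj_sconj A, hS.eq_zero_of_lmul_pow_eq_zero hE hA.sconj h1, sconj_zero]

theorem exists_lmul_sconj_pow_eq (hS : IsSymplectic S)
    (hE : Module.finrank ℂ E = 2 * (m + 1)) {p : ℤ} {B : GForms E X}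
    (hB : HasType p (2 * m + 1) B) :
    ∃ A, HasType p 1 A ∧ (lmul (sconj S) ^ m : Module.End ℂ (GForms E X)) A = B := by
  obtain ⟨A, hA, hAB⟩ := hS.exists_lmul_pow_eq hE hB.sconj
  exact ⟨sconj A, hA.sconj, by rw [← sconj_lmul_pow, hAB, sconj_sconj]⟩

end Bijective

end IsSymplectic

end GForms

end

/-! ### Powers of σ ∧ σ̄ as composites of the two Lefschetz operators -/

section

open Gr

section

variable {V : Type*} [NormedAddCommGroup V] [NormedSpace ℂ V]

theorem Gr.conjG_single (k : ℕ) (a : CAlt V k) :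
    conjG (Pi.single k a : Gr V) = Pi.single k (conjAlt a) := by
  funext j
  change conjAlt ((Pi.single k a : Gr V) j) = _
  by_cases hj : j = k
  · subst hj
    rw [Pi.single_eq_same, Pi.single_eq_same]
  · rw [Pi.single_eq_of_ne hj, Pi.single_eq_of_ne hj]
    ext v
    exact map_zero conj

/-- Multiplication by the powers of the product of two `2`-forms. -/
theorem Gr.mul_single_pow (a b : CAlt V 2) (w : ∀ r, CAlt V (4 * r))
    (h0 : w 0 = ContinuousAlternatingMap.constOfIsEmpty ℝ V (Fin 0) 1)
    (hw : ∀ r, w (r + 1) = wedgeAlt rfl (w r) (wedgeAlt (show 2 + 2 = 4 from rfl) a b))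
    (r : ℕ) (c : Gr V) : mul (Pi.single (4 * r) (w r)) c =
      (mul (Pi.single 2 b) ^ r : Module.End ℂ (Gr V))
        ((mul (Pi.single 2 a) ^ r : Module.End ℂ (Gr V)) c) := by
  set s : Gr V := Pi.single 2 a with hs
  set t : Gr V := Pi.single 2 b with ht
  have hte : eps t = t := by
    rw [ht, eps_single]
    simp
  have hst : Pi.single 4 (wedgeAlt (show 2 + 2 = 4 from rfl) a b) = mul t s := by
    rw [mul_comm_of_even hte, hs, ht]
    exact (single_mul_single (show 2 + 2 = 4 from rfl) a b).symm
  have hts : (mul (mul t s) : Module.End ℂ (Gr V)) = mul t * mul s :=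
    LinearMap.ext fun b => Gr.mul_assoc t s b
  have hcomm : Commute (mul t : Module.End ℂ (Gr V)) (mul s) := by
    refine LinearMap.ext fun b => ?_
    rw [Module.End.mul_apply, Module.End.mul_apply, ← Gr.mul_assoc, ← Gr.mul_assoc,
      mul_comm_of_even hte]
  -- The two multiplications commute, so t^r s^r becomes (ts)^r and a single induction on r
  -- suffices.
  rw [← Module.End.mul_apply, ← hcomm.mul_pow, ← hts]
  induction r generalizing c with
  | zero =>
    rw [h0]
    exact Gr.one_mul c
  | succ r ih =>
    have h2 : (Pi.single (4 * (r + 1)) (w (r + 1)) : Gr V) =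
        mul (Pi.single (4 * r) (w r)) (mul t s) := by
      rw [← hst, hw]
      exact (single_mul_single (rfl : 4 * r + 4 = 4 * (r + 1)) _ _).symm
    rw [h2, Gr.mul_assoc, ih, pow_succ, Module.End.mul_apply]

end

variable {E : Type*} [NormedAddCommGroup E] [NormedSpace ℂ E] [FiniteDimensional ℂ E]
  {X : Type*} [TopologicalSpace X] [ChartedSpace E X] [IsManifold 𝓘(ℂ, E) ω X]

namespace GForms

theorem HasType.congr {p q p' q' : ℤ} {A : GForms E X} (h : HasType p q A) (hp : p = p')
    (hq : q = q') : HasType p' q' A := hp ▸ hq ▸ h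

namespace IsSymplectic

variable {S : GForms E X} {m : ℕ}

theorem hasType_lmul_pow (hS : IsSymplectic S) {p q : ℤ} {A : GForms E X} (hA : HasType p q A) :
    HasType (2 * m + p) q ((lmul S ^ m : Module.End ℂ (GForms E X)) A) :=
  (hS.type.lmul_pow hA m).congr (by ring) (by ring)

theorem hasType_lmul_sconj_pow (hS : IsSymplectic S) {p q : ℤ} {A : GForms E X}
    (hA : HasType p q A) :
    HasType p (2 * m + q) ((lmul (sconj S) ^ m : Module.End ℂ (GForms E X)) A) :=
  (hS.type.sconj.lmul_pow hA m).congr (by ring) (by ring)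

/-! ### The Lefschetz map on the Dolbeault cohomology -/

theorem exists_eq_sdelbar_of_lefschetz (hS : IsSymplectic S) (hX : SatisfiesDelDelbarLemma E X)
    (hE : Module.finrank ℂ E = 2 * (m + 1)) {A B : GForms E X} (hA : HasType 1 1 A)
    (hA0 : sdelbar A = 0) (hB : HasType (2 * m + 1) (2 * m) B)
    (h : (lmul (sconj S) ^ m : Module.End ℂ (GForms E X))
      ((lmul S ^ m : Module.End ℂ (GForms E X)) A) = sdelbar B) :
    ∃ C, HasType 1 0 C ∧ A = sdelbar C := by
  -- A is replaced by a d-closed representative; the correction ∂̄G is absorbed into B through the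
  -- form LG below.
  obtain ⟨G, hG, hG0⟩ := exists_sdel_sub_sdelbar_eq_zero hX (p := 1) (q := 0) hA hA0
  set A' := A - sdelbar G with hA'
  have hG1 : HasType 1 1 (sdelbar G) := hG.sdelbar
  have hA't : HasType 1 1 A' := hA.sub hG1
  have hA'0 : sdelbar A' = 0 := by rw [hA', map_sub, hA0, sdelbar_sdelbar, sub_zero]
  set T := (lmul S ^ m : Module.End ℂ (GForms E X)) A' with hT
  have hTt : HasType (2 * m + 1) 1 T := hS.hasType_lmul_pow hA't
  have hT1 : sdel T = 0 := by rw [hT, hS.sdel_lmul_pow, hG0, map_zero]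
  have hT2 : sdelbar T = 0 := by rw [hT, hS.sdelbar_lmul_pow, hA'0, map_zero]
  set LG := (lmul (sconj S) ^ m : Module.End ℂ (GForms E X))
    ((lmul S ^ m : Module.End ℂ (GForms E X)) G) with hLG
  have hLGt : HasType (2 * m + 1) (2 * m) LG :=
    (hS.hasType_lmul_sconj_pow (hS.hasType_lmul_pow hG)).congr rfl (by push_cast; ring)
  have h1 : (lmul (sconj S) ^ m : Module.End ℂ (GForms E X)) T = sdelbar (B - LG) := by
    rw [hT, hA', map_sub, map_sub, h, map_sub sdelbar, hLG, hS.sdelbar_lmul_sconj_pow,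
      hS.sdelbar_lmul_pow]
  -- L̄^m T is ∂̄-exact and ∂-closed, hence ∂∂̄U. Dividing ∂̄U by L̄^m gives K, and injectivity of
  -- L̄^m turns L̄^m T = ∂ L̄^m K into T = ∂K.
  obtain ⟨U, hU, hU'⟩ := exists_eq_sdel_sdelbar_of_eq_sdelbar hX (p := 2 * m) (q := 2 * m)
    (B := B - LG) ((hB.sub hLGt).congr (by push_cast; ring) (by push_cast; ring))
    (by rw [← h1, hS.sdel_lmul_sconj_pow, hT1, map_zero])
  obtain ⟨K, hK, hK'⟩ := hS.exists_lmul_sconj_pow_eq hE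
    (hU.sdelbar.congr rfl (by push_cast; ring) : HasType (2 * m : ℕ) (2 * m + 1) (sdelbar U))
  have hTK : T = sdel K := by
    refine sub_eq_zero.1 (hS.eq_zero_of_lmul_sconj_pow_eq_zero hE (p := 2 * m + 1)
      (hTt.sub (hK.sdel.congr (by push_cast; ring) rfl)) ?_)
    rw [map_sub, h1, hU', ← hS.sdel_lmul_sconj_pow, hK', sub_self]
  -- The same argument with ∂ and ∂̄ exchanged and L^m for L̄^m: T is ∂-exact and ∂̄-closed, so T =
  -- ∂∂̄W, and ∂W is divided by L^m.
  obtain ⟨W, hW, hW'⟩ := exists_eq_sdel_sdelbar_of_eq_sdel hX (p := 2 * m) (q := 0)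
    (B := K) (hK.congr rfl (by norm_num))
    (by rw [← neg_eq_zero, ← sdelbar_sdel, ← hTK, hT2])
  obtain ⟨P, hP, hP'⟩ := hS.exists_lmul_pow_eq hE
    (hW.sdel.congr (by push_cast; ring) rfl : HasType (2 * m + 1) (0 : ℕ) (sdel W))
  have hAP : A' = -sdelbar P := by
    refine eq_neg_of_add_eq_zero_left (hS.eq_zero_of_lmul_pow_eq_zero hE (q := 1)
      (hA't.add (hP.sdelbar.congr rfl (by norm_num))) ?_)
    rw [map_add, ← hT, hTK, hW', ← hS.sdelbar_lmul_pow, hP', sdelbar_sdel, add_neg_cancel]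
  refine ⟨G - P, hG.sub (hP.congr rfl (by norm_num)), ?_⟩
  rw [map_sub, sub_eq_add_neg, ← hAP, hA']
  abel

theorem exists_lefschetz_eq_add_sdelbar (hS : IsSymplectic S) (hX : SatisfiesDelDelbarLemma E X)
    (hE : Module.finrank ℂ E = 2 * (m + 1)) {B : GForms E X}
    (hB : HasType (2 * m + 1) (2 * m + 1) B) (hB0 : sdelbar B = 0) :
    ∃ A C, HasType 1 1 A ∧ sdelbar A = 0 ∧ HasType (2 * m + 1) (2 * m) C ∧
      (lmul (sconj S) ^ m : Module.End ℂ (GForms E X))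
        ((lmul S ^ m : Module.End ℂ (GForms E X)) A) = B + sdelbar C := by
  obtain ⟨G, hG, hG0⟩ := exists_sdel_sub_sdelbar_eq_zero hX (p := 2 * m + 1) (q := 2 * m)
    (hB.congr (by push_cast; ring) (by push_cast; ring)) hB0
  have hGt : HasType (2 * m + 1) (2 * m) G := hG.congr (by push_cast; ring) (by push_cast; ring)
  set B' := B - sdelbar G with hB'
  obtain ⟨T, hT, hT'⟩ := hS.exists_lmul_sconj_pow_eq hE (hB.sub hGt.sdelbar)
  -- Injectivity of L̄^m is available for every first index, here 2m + 2, so closedness passes from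
  -- L̄^m T to T.
  have hT1 : sdel T = 0 := by
    refine hS.eq_zero_of_lmul_sconj_pow_eq_zero hE hT.sdel ?_
    rw [← hS.sdel_lmul_sconj_pow, hT', hG0]
  obtain ⟨W, hW, hW0⟩ := exists_sdelbar_sub_sdel_eq_zero hX (p := 2 * m) (q := 1)
    (hT.congr (by push_cast; ring) rfl) hT1
  have hWt : HasType (2 * m + 1) 1 (sdel W) := hW.sdel.congr (by push_cast; ring) rfl
  obtain ⟨A, hA, hA'⟩ := hS.exists_lmul_pow_eq hE (hT.sub hWt)
  have hA0 : sdelbar A = 0 := by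
    refine hS.eq_zero_of_lmul_pow_eq_zero hE hA.sdelbar ?_
    rw [← hS.sdelbar_lmul_pow, hA', hW0]
  -- Making T ∂̄-closed costs the error ∂Q. It is ∂̄-closed, because all other terms of `hLA` are,
  -- hence equals ∂∂̄U = -∂̄∂U and is harmless modulo ∂̄-exact forms.
  set Q := (lmul (sconj S) ^ m : Module.End ℂ (GForms E X)) W with hQ
  have hQt : HasType (2 * m : ℕ) ((2 * m : ℕ) + 1) Q :=
    (hS.hasType_lmul_sconj_pow hW).congr rfl (by push_cast; ring)
  have hLA : (lmul (sconj S) ^ m : Module.End ℂ (GForms E X))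
      ((lmul S ^ m : Module.End ℂ (GForms E X)) A) = B - sdelbar G - sdel Q := by
    rw [hA', map_sub, hT', hQ, hS.sdel_lmul_sconj_pow]
  have hQ0 : sdel (sdelbar Q) = 0 := by
    have h1 := congrArg sdelbar hLA
    rw [hS.sdelbar_lmul_sconj_pow, hS.sdelbar_lmul_pow, hA0, map_zero, map_zero, map_sub, map_sub,
      hB0, sdelbar_sdelbar, sub_zero, zero_sub, sdelbar_sdel, neg_neg] at h1
    exact h1.symm
  obtain ⟨U, hU, hU'⟩ := exists_eq_sdel_sdelbar_of_eq_sdel hX (p := 2 * m) (q := 2 * m) hQt hQ0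
  refine ⟨A, sdel U - G, hA, hA0, HasType.sub (hU.sdel.congr (by push_cast; ring)
    (by push_cast; ring)) hGt, ?_⟩
  rw [hLA, hU', map_sub, sdelbar_sdel]
  abel

end IsSymplectic

/-! ### Comparison with the wedge product of forms -/

/-- The bridge from the operator calculus to the wedge product in the statement. Keeping the target
degree k free, tied only by `hk`, avoids transporting forms between equal degrees. -/
theorem comp_lefschetz {σ : DForm E X 2} (hσ : IsSmooth σ) {m k : ℕ} (A : GForms E X)
    (hk : 4 * m + (1 + 1) = k) :
    comp k ((lmul (sconj (ofForm σ hσ)) ^ m : Module.End ℂ (GForms E X))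
      ((lmul (ofForm σ hσ) ^ m : Module.End ℂ (GForms E X)) A)) =
    wedge hk (wedgePow (wedge (show 2 + 2 = 4 from rfl) σ (conjForm σ)) m) (comp (1 + 1) A) := by
  funext x
  have h1 := congrFun (mul_single_pow (V := E) (σ x) (conjForm σ x)
    (fun r => wedgePow (wedge (show 2 + 2 = 4 from rfl) σ (conjForm σ)) r x) rfl
    (fun _ => rfl) m (A.1 x)) k
  have h2 : (Pi.single (M := fun k => CAlt E k) 2 (conjForm σ x) : Gr E) =
      (sconj (ofForm σ hσ)).1 x := (conjG_single (V := E) 2 (σ x)).symm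
  rw [h2] at h1
  refine Eq.trans ?_ (h1.symm.trans (single_mul_apply (V := E) hk _ (A.1 x)))
  change ((lmul (sconj (ofForm σ hσ)) ^ m : Module.End ℂ (GForms E X)) _).1 x k = _
  rw [lmul_pow_val, lmul_pow_val]
  rfl

end GForms

open GForms

theorem GForms.sdelbar_ofForm_eq_zero {k : ℕ} {α : DForm E X k} (hα : IsSmooth α)
    (h : delbar α = 0) : sdelbar (ofForm α hα) = 0 := by
  refine Homog.ext (homog_ofForm α hα).sdelbar (fun _ _ _ => rfl) ?_
  rw [comp_sdelbar, comp_ofForm, h]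
  rfl

theorem comp_mem_smoothForms {p q : ℕ} {A : GForms E X} (hA : HasType p q A) :
    comp (p + q) A ∈ smoothForms E X p q := ⟨isSmooth_comp _ _, hA.isOfType rfl⟩

theorem comp_mem_dolbeaultCocycles {p q : ℕ} {A : GForms E X} (hA : HasType p q A)
    (h : sdelbar A = 0) : comp (p + q) A ∈ dolbeaultCocycles E X p q :=
  ⟨comp_mem_smoothForms hA, by rw [← comp_sdelbar, h]; rfl⟩

/-! ### The Lefschetz map on Dolbeault classes -/

section Cohomology

variable {σ : DForm E X 2} {m : ℕ}

theorem wedge_mem_dolbeaultCocycles (hσ : IsComplexSymplectic σ)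
    (hk : 4 * m + (1 + 1) = (2 * m + 1) + (2 * m + 1)) {α : DForm E X (1 + 1)}
    (hα : α ∈ dolbeaultCocycles E X 1 1) :
    wedge hk (wedgePow (wedge (show 2 + 2 = 4 from rfl) σ (conjForm σ)) m) α ∈
      dolbeaultCocycles E X (2 * m + 1) (2 * m + 1) := by
  have hS := isSymplectic_ofForm hσ
  have hA := hasType_ofForm hα.1.1 hα.1.2
  have hA0 := sdelbar_ofForm_eq_zero hα.1.1 hα.2
  have h1 := comp_lefschetz hσ.smooth (ofForm α hα.1.1) hk
  rw [comp_ofForm] at h1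
  rw [← h1]
  refine comp_mem_dolbeaultCocycles ((hS.hasType_lmul_sconj_pow (hS.hasType_lmul_pow hA)).congr
    (by push_cast; ring) (by push_cast; ring)) ?_
  rw [hS.sdelbar_lmul_sconj_pow, hS.sdelbar_lmul_pow, hA0, map_zero, map_zero]

/-- The Lefschetz map on cocycles. -/
def lefschetzCocycles (hσ : IsComplexSymplectic σ)
    (hk : 4 * m + (1 + 1) = (2 * m + 1) + (2 * m + 1)) :
    dolbeaultCocycles E X 1 1 →ₗ[ℂ] dolbeaultCocycles E X (2 * m + 1) (2 * m + 1) where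
  toFun α := ⟨_, wedge_mem_dolbeaultCocycles hσ hk α.2⟩
  map_add' _ _ := Subtype.ext <| funext fun _ => wedgeAlt_add_right (V := E) hk _ _ _
  map_smul' _ _ := Subtype.ext <| funext fun _ => wedgeAlt_smul_right (V := E) hk _ _ _

/-- From right to left this is well-definedness on classes, since the operators commute with ∂̄;
from left to right it is injectivity, which needs the ∂∂̄-lemma. -/
theorem lefschetzCocycles_mem_iff (hσ : IsComplexSymplectic σ) (hX : SatisfiesDelDelbarLemma E X)
    (hE : Module.finrank ℂ E = 2 * (m + 1)) (hk : 4 * m + (1 + 1) = (2 * m + 1) + (2 * m + 1))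
    (α : dolbeaultCocycles E X 1 1) :
    (lefschetzCocycles hσ hk α).1 ∈ dolbeaultCoboundaries E X (2 * m + 1) (2 * m + 1) ↔
      α.1 ∈ dolbeaultCoboundaries E X 1 1 := by
  obtain ⟨α, hα⟩ := α
  have hS := isSymplectic_ofForm hσ
  have hA := hasType_ofForm hα.1.1 hα.1.2
  have hA0 := sdelbar_ofForm_eq_zero hα.1.1 hα.2
  have h1 := comp_lefschetz hσ.smooth (ofForm α hα.1.1) hk
  rw [comp_ofForm] at h1
  constructor
  · rintro ⟨β, hβ, hβ'⟩
    have hB := hasType_ofForm hβ.1 hβ.2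
    obtain ⟨C, hC, hC'⟩ := hS.exists_eq_sdelbar_of_lefschetz hX hE
      (hA.congr (by norm_num) (by norm_num)) hA0
      (hB.congr (by push_cast; ring) (by push_cast; ring)) (by
        refine Homog.ext (k := (2 * m + 1) + (2 * m + 1))
          ((hS.hasType_lmul_sconj_pow (hS.hasType_lmul_pow hA)).homog (by push_cast; ring))
          (homog_ofForm β hβ.1).sdelbar ?_
        rw [h1]
        refine Eq.trans hβ' ?_
        conv_lhs => rw [← comp_ofForm β hβ.1]
        rfl)
    refine ⟨comp (1 + 0) C, comp_mem_smoothForms (hC.congr (by norm_num) (by norm_num)), ?_⟩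
    rw [← comp_sdelbar, ← hC', comp_ofForm]
  · rintro ⟨β, hβ, hβ'⟩
    have hB := hasType_ofForm hβ.1 hβ.2
    have hAB : ofForm α hα.1.1 = sdelbar (ofForm β hβ.1) := by
      refine Homog.ext (homog_ofForm _ _) (homog_ofForm _ _).sdelbar ?_
      rw [comp_ofForm, comp_sdelbar, comp_ofForm]
      exact hβ'
    refine ⟨comp ((2 * m + 1) + 2 * m) _, comp_mem_smoothForms
      ((hS.hasType_lmul_sconj_pow (m := m) (hS.hasType_lmul_pow (m := m) hB)).congr
      (by push_cast; ring) (by push_cast; ring)), ?_⟩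
    rw [← comp_sdelbar, hS.sdelbar_lmul_sconj_pow, hS.sdelbar_lmul_pow, ← hAB]
    exact h1.symm

theorem exists_lefschetzCocycles_sub_mem (hσ : IsComplexSymplectic σ)
    (hX : SatisfiesDelDelbarLemma E X) (hE : Module.finrank ℂ E = 2 * (m + 1))
    (hk : 4 * m + (1 + 1) = (2 * m + 1) + (2 * m + 1))
    (β : dolbeaultCocycles E X (2 * m + 1) (2 * m + 1)) : ∃ α : dolbeaultCocycles E X 1 1,
      (lefschetzCocycles hσ hk α).1 - β.1 ∈
        dolbeaultCoboundaries E X (2 * m + 1) (2 * m + 1) := by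
  obtain ⟨β, hβ⟩ := β
  have hS := isSymplectic_ofForm hσ
  have hB := hasType_ofForm hβ.1.1 hβ.1.2
  have hB0 := sdelbar_ofForm_eq_zero hβ.1.1 hβ.2
  obtain ⟨A, C, hA, hA0, hC, h⟩ := hS.exists_lefschetz_eq_add_sdelbar hX hE
    (hB.congr (by push_cast; ring) (by push_cast; ring)) hB0
  have h1 := comp_lefschetz hσ.smooth A hk
  refine ⟨⟨comp (1 + 1) A, comp_mem_dolbeaultCocycles (p := 1) (q := 1)
    (hA.congr (by norm_num) (by norm_num)) hA0⟩, comp ((2 * m + 1) + 2 * m) C,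
    comp_mem_smoothForms (hC.congr (by push_cast; ring) (by push_cast; ring)), ?_⟩
  change wedge hk _ (comp (1 + 1) A) - β = _
  have h2 : comp ((2 * m + 1) + (2 * m + 1)) (ofForm β hβ.1.1 + sdelbar C) =
      comp ((2 * m + 1) + (2 * m + 1)) (ofForm β hβ.1.1) +
        comp ((2 * m + 1) + (2 * m + 1)) (sdelbar C) := rfl
  rw [← h1, h, h2, comp_ofForm, add_sub_cancel_left]
  rfl

theorem exists_lefschetz_equiv (hσ : IsComplexSymplectic σ) (hX : SatisfiesDelDelbarLemma E X)
    (hE : Module.finrank ℂ E = 2 * (m + 1)) (hk : 4 * m + (1 + 1) = (2 * m + 1) + (2 * m + 1)) :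
    ∃ L : DolbeaultCohomology E X 1 1 ≃ₗ[ℂ] DolbeaultCohomology E X (2 * m + 1) (2 * m + 1),
      ∀ (α : DForm E X (1 + 1)) (hα : α ∈ dolbeaultCocycles E X 1 1),
        ∃ h : wedge hk (wedgePow (wedge (show 2 + 2 = 4 from rfl) σ (conjForm σ)) m) α ∈
            dolbeaultCocycles E X (2 * m + 1) (2 * m + 1),
          L (dolbeaultClass α hα) = dolbeaultClass _ h := by
  let f := Submodule.mapQ ((dolbeaultCoboundaries E X 1 1).submoduleOf
    (dolbeaultCocycles E X 1 1)) ((dolbeaultCoboundaries E X (2 * m + 1) (2 * m + 1)).submoduleOf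
    (dolbeaultCocycles E X (2 * m + 1) (2 * m + 1))) (lefschetzCocycles hσ hk)
    fun α hα => (lefschetzCocycles_mem_iff hσ hX hE hk α).2 hα
  have hf : Function.Bijective f := by
    constructor
    · refine (injective_iff_map_eq_zero f).2 fun a ha => ?_
      obtain ⟨α, rfl⟩ := Submodule.Quotient.mk_surjective _ a
      exact (Submodule.Quotient.mk_eq_zero _).2 ((lefschetzCocycles_mem_iff hσ hX hE hk α).1
        ((Submodule.Quotient.mk_eq_zero ((dolbeaultCoboundaries E X (2 * m + 1)
          (2 * m + 1)).submoduleOf (dolbeaultCocycles E X (2 * m + 1) (2 * m + 1)))).1 ha))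
    · intro b
      obtain ⟨β, rfl⟩ := Submodule.Quotient.mk_surjective _ b
      obtain ⟨α, hα⟩ := exists_lefschetzCocycles_sub_mem hσ hX hE hk β
      exact ⟨Submodule.Quotient.mk α, (Submodule.Quotient.eq _).2 hα⟩
  exact ⟨LinearEquiv.ofBijective f hf, fun α hα => ⟨wedge_mem_dolbeaultCocycles hσ hk hα, rfl⟩⟩

end Cohomology

end

end CplxSympl

end

theorem lemma2p4 {E : Type*} [NormedAddCommGroup E] [NormedSpace ℂ E] [FiniteDimensional ℂ E]
    {X : Type*} [TopologicalSpace X] [ChartedSpace E X] [IsManifold 𝓘(ℂ, E) ω X]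
    [T2Space X] [CompactSpace X] [ConnectedSpace X]
    (n : ℕ) (hn : 1 ≤ n) (hdim : Module.finrank ℂ E = 2 * n)
    (σ : CplxSympl.DForm E X 2) (hσ : CplxSympl.IsComplexSymplectic σ)
    (hX : CplxSympl.SatisfiesDelDelbarLemma E X) :
    ∃ L : CplxSympl.DolbeaultCohomology E X 1 1 ≃ₗ[ℂ]
        CplxSympl.DolbeaultCohomology E X (2 * n - 1) (2 * n - 1),
      ∀ (α : CplxSympl.DForm E X (1 + 1)) (hα : α ∈ CplxSympl.dolbeaultCocycles E X 1 1),
        ∃ h : CplxSympl.wedge (show 4 * (n - 1) + (1 + 1) = (2 * n - 1) + (2 * n - 1) by omega)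
            (CplxSympl.wedgePow
              (CplxSympl.wedge (show 2 + 2 = 4 from rfl) σ (CplxSympl.conjForm σ)) (n - 1)) α ∈
            CplxSympl.dolbeaultCocycles E X (2 * n - 1) (2 * n - 1),
          L (CplxSympl.dolbeaultClass α hα) = CplxSympl.dolbeaultClass _ h := by
  -- After this substitution the truncated differences n - 1 and 2n - 1 compute to m and 2m + 1, so
  -- the groups agree definitionally.
  obtain ⟨m, rfl⟩ : ∃ m, n = m + 1 := ⟨n - 1, by omega⟩
  exact CplxSympl.exists_lefschetz_equiv hσ hX hdim (by omega)
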